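/- **Setting.** Let $d\in\{2,3\}$ and let $\Omega\subset\mathbb R^d$ be a bounded open set with $\operatorname{int}\overline\Omega=\Omega$ (for example a bounded Lipschitz domain). Let $\mathfrak T_h$ be a finite face-to-face partition of $\Omega$ into simplices and parallelepipeds: the closed cells cover $\overline\Omega$, their interiors are disjoint, and any two faces coincide or meet in a set of zero surface measure. Let $k$ be a measurable symmetric matrix field on $\Omega$ with $k_{\min}|\zeta|^2\le\zeta^Tk(x)\zeta\le k_{\max}|\zeta|^2$ for all $x\in\Omega$, $\zeta\in\mathbb R^d$, where $k_{\min}>0$, and let $f\in L^2(\Omega)$. For a cell $K$ and a face $e$ of $K$ let $\chi_e^K$ be the lowest-order Raviart–Thomas shape function ($\operatorname{div}\chi_e^K=1/|K|$, outward normal component $1/|e|$ on $e$ and $0$ on the other faces). Let $N\ge1$ and let $u_1,\dots,u_N\in H(\mathrm{div},\Omega)$ be global fields such that, for every $i$, every cell $K$ and every face $e$ of $K$, $u_i\cdot n_{\partial K}\in L^2(\partial K)$ and $\int_e u_i\cdot n_{\partial K}\,ds\neq0$. For each $K$, $i$ and each shape function $\chi=\chi_e^K$, let $\eta_{i,\chi}^K\in[L^2(K)]^d$,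 $\psi_{i,\chi}^K\in H(\mathrm{div},K)$, $\phi_{i,\chi}^K\in L^2(K)/\mathbb R$ be the weak solution of $$\psi+k\eta=0,\quad \eta-\nabla\phi=0,\quad \operatorname{div}\psi=\operatorname{div}\chi\ \text{ in }K,\qquad \psi\cdot n_{\partial K}=\frac{\int_{e'}\chi\cdot n_{\partial K}\,ds}{\int_{e'}u_i\cdot n_{\partial K}\,ds}\,u_i\cdot n_{\partial K}\ \text{ on each face }e'\text{ of }K,$$ that is, $(k\eta,\xi)_K+(\psi,\xi)_K=0$ for all $\xi\in[L^2(K)]^d$; $(\eta,\tau)_K+(\phi,\operatorname{div}\tau)_K=0$ for all $\tau\in H(\mathrm{div},K)$ with $\tau\cdot n_{\partial K}=0$; $(\operatorname{div}\psi,q)_K=(\operatorname{div}\chi,q)_K$ for all $q\in L^2(K)$; and the boundary condition above. Let - $X_1=\{\theta\in[L^2(\Omega)]^d:\theta|_K\in\operatorname{span}_{i,e}\{\eta_{i,\chi_e}^K\}\ \forall K\}$, - $\tilde X_2=\{u\in[L^2(\Omega)]^d:u|_K\in\operatorname{span}_{i,e}\{\psi_{i,\chi_e}^K\}\ \forall K\}$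 and $X_2=\tilde X_2\cap H(\mathrm{div},\Omega)$, - $Q_h$ be the space of functions that are constant on each cell, - $\Pi$ be the space of $\pi\in L^2\big(\bigcup_K\partial K\big)$ with $\pi=0$ on every face contained in $\partial\Omega$ and $\pi|_e\in X_2\cdot n_e$ on every other face $e$, - $[C\tau,\pi]=\sum_K\int_{\partial K}(\tau\cdot n_{\partial K})\,\pi\,ds$ for $\tau\in\tilde X_2$, $\pi\in\Pi$. *Global expanded mixed MsFEM*: find $(\theta,u,p)\in X_1\times X_2\times Q_h$ with $$(k\theta,\xi)+(u,\xi)=0,\qquad (\theta,\tau)+(p,\operatorname{div}\tau)=0,\qquad (\operatorname{div}u,q)=(f,q)$$ for all $\xi\in X_1$, $\tau\in X_2$, $q\in Q_h$. *Hybridized method*: find $(\bar\theta,\bar u,\bar p,\lambda)\in X_1\times\tilde X_2\times Q_h\times\Pi$ with $$(k\bar\theta,\xi)+(\bar u,\xi)=0,\quad (\bar\theta,\tau)+\sum_K(\bar p,\operatorname{div}\tau)_K=[C\tau,\lambda],\quad \sum_K(\operatorname{div}\bar u,q)_K=(f,q),\quad [C\bar u,\pi]=0$$ for all $\xi\in X_1$,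 $\tau\in\tilde X_2$, $q\in Q_h$, $\pi\in\Pi$. **Theorem.** The global expanded mixed MsFEM has a unique solution $(\theta,u,p)$, the hybridized method has a unique solution $(\bar\theta,\bar u,\bar p,\lambda)$, and $(\bar\theta,\bar u,\bar p)=(\theta,u,p)$. -/

import Mathlib

open MeasureTheory
open scoped ContDiff

noncomputable section

namespace MsFEM

/-- Euclidean space of dimension `d`. -/
abbrev E (d : ℕ) := EuclideanSpace ℝ (Fin d)

/-- `L²(S)` for scalar functions. -/
abbrev L2 {d : ℕ} (S : Set (E d)) := Lp ℝ 2 ((volume : Measure (E d)).restrict S)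

/-- `[L²(S)]^d`, vector fields. -/
abbrev L2v {d : ℕ} (S : Set (E d)) := Lp (E d) 2 ((volume : Measure (E d)).restrict S)

/-- `(d-1)`-dimensional surface measure: the Hausdorff measure, normalised so that it is the
Lebesgue measure on hyperplanes. -/
def surf (d : ℕ) : Measure (E d) := Measure.euclideanHausdorffMeasure (d - 1)

/-! ### `H(div)` and normal traces -/

/-- `δ ∈ L²(U)` is the distributional divergence of `w` on the open set `U`:
`∫_U w · ∇v = - ∫_U δ v` for all `v ∈ C_c^∞(U)`; here `w · ∇v` is `fderiv ℝ v x (w x)`. -/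
def IsWeakDiv {d : ℕ} (U : Set (E d)) (w : E d → E d) (δ : E d → ℝ) : Prop :=
  MemLp δ 2 (volume.restrict U) ∧
  ∀ v : E d → ℝ, ContDiff ℝ ∞ v → HasCompactSupport v → tsupport v ⊆ U →
    ∫ x in U, fderiv ℝ v x (w x) = - ∫ x in U, δ x * v x

/-- `w ∈ H(div, U)`. -/
def MemHdiv {d : ℕ} (U : Set (E d)) (w : E d → E d) : Prop :=
  MemLp w 2 (volume.restrict U) ∧ ∃ δ, IsWeakDiv U w δ

open Classical in
/-- The divergence on `U` of a field in `H(div, U)` (determined almost everywhere on `U`). -/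
def wdiv {d : ℕ} (U : Set (E d)) (w : E d → E d) : E d → ℝ :=
  if h : ∃ δ, IsWeakDiv U w δ then h.choose else 0

/-- A cell of the partition: a `d`-simplex, or a parallelepiped with a corner `a` and edge
vectors `v` (in particular a rectangle or a brick). -/
inductive Cell (d : ℕ) where
  | simplex (s : Affine.Simplex ℝ (E d) d) : Cell d
  | box (a : E d) (v : Module.Basis (Fin d) ℝ (E d)) : Cell d

namespace Cell

/-- The closed cell. -/
def carrier {d : ℕ} : Cell d → Set (E d)
  | simplex s => convexHull ℝ (Set.range s.points)
  | box a v => {x | ∀ i, v.repr (x - a) i ∈ Set.Icc (0 : ℝ) 1}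

/-- The open cell. -/
def dom {d : ℕ} (K : Cell d) : Set (E d) := interior K.carrier

/-- The boundary `∂K`. -/
def bdry {d : ℕ} (K : Cell d) : Set (E d) := frontier K.carrier

/-- Labels of the faces: the face opposite to the vertex `j` of a simplex; for a
parallelepiped, the face on which the `i`-th coordinate is `1` or `0`. -/
def FaceIdx {d : ℕ} : Cell d → Type
  | simplex _ => Fin (d + 1)
  | box _ _ => Fin d × Bool

/-- The `(d-1)`-dimensional closed faces of a cell. -/
def face {d : ℕ} : (K : Cell d) → K.FaceIdx → Set (E d)
  | simplex s, (j : Fin (d + 1)) => convexHull ℝ (s.points '' {j}ᶜ)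
  | box a v, ((i, b) : Fin d × Bool) =>
      {x | x ∈ (box a v).carrier ∧ v.repr (x - a) i = if b then 1 else 0}

/-- The lowest-order Raviart–Thomas shape function `χ_e^K` of the face `e`: its divergence is
`1/|K|`, its outward normal component is `1/|e|` on `e` and `0` on the other faces. -/
def rt0 {d : ℕ} : (K : Cell d) → K.FaceIdx → E d → E d
  | simplex s, (j : Fin (d + 1)) => fun x =>
      (d * volume.real (simplex s).carrier)⁻¹ • (x - s.points j)
  | box a v, ((i, b) : Fin d × Bool) => fun x =>
      ((v.repr (x - a) i - if b then 0 else 1) / volume.real (box a v).carrier) • v i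

end Cell

/-- `g ∈ L²(∂K)` is the outward normal component `w · n_{∂K}` of `w ∈ H(div, K)`:
`∫_K (w · ∇v + v div w) = ∫_{∂K} g v` for all `v` smooth up to the boundary. -/
def IsNormalTrace {d : ℕ} (K : Cell d) (w : E d → E d) (g : E d → ℝ) : Prop :=
  MemHdiv K.dom w ∧ MemLp g 2 ((surf d).restrict K.bdry) ∧
  ∀ v : E d → ℝ, ContDiff ℝ ∞ v →
    ∫ x in K.dom, (fderiv ℝ v x (w x) + wdiv K.dom w x * v x)
      = ∫ x in K.bdry, g x * v x ∂(surf d)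

/-- `w ∈ H(div, K)` and `w · n_{∂K} ∈ L²(∂K)`. -/
def HasNormalTrace {d : ℕ} (K : Cell d) (w : E d → E d) : Prop := ∃ g, IsNormalTrace K w g

open Classical in
/-- The outward normal component `w · n_{∂K}` (determined almost everywhere on `∂K`). -/
def normalTrace {d : ℕ} (K : Cell d) (w : E d → E d) : E d → ℝ :=
  if h : ∃ g, IsNormalTrace K w g then h.choose else 0

/-- `w ∈ H^0(div, K)`: the normal component vanishes on `∂K`. -/
def MemHdiv0 {d : ℕ} (K : Cell d) (w : E d → E d) : Prop := IsNormalTrace K w 0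

/-! ### Meshes -/

/-- The finite family `cell` is a partition of `Ω`: the closed cells cover `closure Ω`, the open
cells are disjoint, and the partition is face-to-face, i.e. two faces coincide or meet at most in
a set of zero surface measure (no hanging nodes). -/
structure IsMesh {d : ℕ} {ι : Type*} (Ω : Set (E d)) (cell : ι → Cell d) : Prop where
  cover : ⋃ K, (cell K).carrier = closure Ω
  disjoint : Pairwise fun K K' => Disjoint (cell K).dom (cell K').dom
  faceToFace : ∀ K K' (l : (cell K).FaceIdx) (l' : (cell K').FaceIdx),
    (cell K).face l = (cell K').face l' ∨ surf d ((cell K).face l ∩ (cell K').face l') = 0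

/-- The union of all the faces of the partition. -/
def skeleton {d : ℕ} {ι : Type*} (cell : ι → Cell d) : Set (E d) := ⋃ K, (cell K).bdry

/-- `L²` of the faces of the partition. -/
abbrev L2skel {d : ℕ} {ι : Type*} (cell : ι → Cell d) :=
  Lp ℝ 2 ((surf d).restrict (skeleton cell))

/-! ### The coefficient and the multiscale basis -/

/-- The matrix-vector product `k(x) ζ(x)`. -/
def app {d : ℕ} (k : E d → Matrix (Fin d) (Fin d) ℝ) (ζ : E d → E d) (x : E d) : E d :=
  Matrix.toEuclideanCLM (𝕜 := ℝ) (k x) (ζ x)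

/-- `k` is measurable, symmetric, and uniformly bounded and elliptic on `Ω`. -/
structure IsCoefficient {d : ℕ} (Ω : Set (E d)) (k : E d → Matrix (Fin d) (Fin d) ℝ) : Prop where
  measurable : ∀ i j, AEMeasurable (fun x => k x i j) (volume.restrict Ω)
  symm : ∀ x ∈ Ω, (k x).IsSymm
  bounds : ∃ kmin kmax : ℝ, 0 < kmin ∧ ∀ x ∈ Ω, ∀ ζ : E d,
    kmin * ‖ζ‖ ^ 2 ≤ inner ℝ ζ (Matrix.toEuclideanCLM (𝕜 := ℝ) (k x) ζ) ∧
    inner ℝ ζ (Matrix.toEuclideanCLM (𝕜 := ℝ) (k x) ζ) ≤ kmax * ‖ζ‖ ^ 2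

/-- `((η, ψ), φ)` solves, in the weak expanded mixed formulation on `K`,
`ψ + k η = 0`, `η = ∇φ`, `div ψ = div χ` in `K`, and `ψ · n = b` on `∂K`, where on each face `e`
of `K` the prescribed flux `b` is `(∫_e χ · n / ∫_e U · n) U · n`, for a given global field `U`. -/
structure IsMsBasis {d : ℕ} (k : E d → Matrix (Fin d) (Fin d) ℝ) (K : Cell d)
    (χ U : E d → E d) (η ψ : E d → E d) (φ : E d → ℝ) : Prop where
  eta_mem : MemLp η 2 (volume.restrict K.dom)
  psi_mem : MemHdiv K.dom ψ
  phi_mem : MemLp φ 2 (volume.restrict K.dom)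
  flux : ∀ ξ : E d → E d, MemLp ξ 2 (volume.restrict K.dom) →
    (∫ x in K.dom, inner ℝ (app k η x) (ξ x)) + ∫ x in K.dom, inner ℝ (ψ x) (ξ x) = 0
  gradient : ∀ τ : E d → E d, MemHdiv0 K τ →
    (∫ x in K.dom, inner ℝ (η x) (τ x)) + ∫ x in K.dom, φ x * wdiv K.dom τ x = 0
  divergence : ∀ q : E d → ℝ, MemLp q 2 (volume.restrict K.dom) →
    ∫ x in K.dom, wdiv K.dom ψ x * q x = ∫ x in K.dom, wdiv K.dom χ x * q x
  trace : HasNormalTrace K ψ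
  boundary : ∀ l : K.FaceIdx, normalTrace K ψ =ᵐ[(surf d).restrict (K.face l)] fun x =>
    ((∫ y in K.face l, normalTrace K χ y ∂(surf d)) /
      (∫ y in K.face l, normalTrace K U y ∂(surf d))) * normalTrace K U x

/-- The global fields are velocity fields in `H(div, Ω)` whose normal components on the faces are
square integrable and have nonzero mean on each face, so that the multiscale basis makes sense. -/
structure IsGlobalFields {d N : ℕ} {ι : Type*} (Ω : Set (E d)) (cell : ι → Cell d)
    (U : Fin N → E d → E d) : Prop where
  mem : ∀ i, MemHdiv Ω (U i)
  trace : ∀ i K, HasNormalTrace (cell K) (U i)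
  flux_ne_zero : ∀ i K (l : (cell K).FaceIdx),
    ∫ x in (cell K).face l, normalTrace (cell K) (U i) x ∂(surf d) ≠ 0

/-- `span {η_{i,χ}^K}`, over all global fields `i` and all faces of `K`. -/
def etaSpan {d N : ℕ} (k : E d → Matrix (Fin d) (Fin d) ℝ) (U : Fin N → E d → E d) (K : Cell d) :
    Submodule ℝ (E d → E d) :=
  Submodule.span ℝ {η | ∃ i, ∃ l, ∃ ψ φ, IsMsBasis k K (K.rt0 l) (U i) η ψ φ}

/-- `span {ψ_{i,χ}^K}`, over all global fields `i` and all faces of `K`. -/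
def psiSpan {d N : ℕ} (k : E d → Matrix (Fin d) (Fin d) ℝ) (U : Fin N → E d → E d) (K : Cell d) :
    Submodule ℝ (E d → E d) :=
  Submodule.span ℝ {ψ | ∃ i, ∃ l, ∃ η φ, IsMsBasis k K (K.rt0 l) (U i) η ψ φ}

/-! ### Finite element spaces and discrete problems -/

section Problems

variable {d N : ℕ} {ι : Type*} (Ω : Set (E d)) (cell : ι → Cell d)
  (k : E d → Matrix (Fin d) (Fin d) ℝ) (U : Fin N → E d → E d)

/-- `X_{1,h}^g`. -/
def X1 : Set (L2v Ω) :=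
  {θ | ∀ K, ∃ s ∈ etaSpan k U (cell K), θ =ᵐ[volume.restrict (cell K).dom] s}

/-- The discontinuous velocity space (no normal continuity). -/
def X2tilde : Set (L2v Ω) :=
  {u | ∀ K, ∃ s ∈ psiSpan k U (cell K), u =ᵐ[volume.restrict (cell K).dom] s}

/-- `X_{2,h}^g`, the velocity space contained in `H(div, Ω)`. -/
def X2 : Set (L2v Ω) :=
  {u | MemHdiv Ω u ∧
    ∀ K, ∃ s ∈ psiSpan k U (cell K), u =ᵐ[volume.restrict (cell K).dom] s}

/-- `Q_h`: the functions that are constant on each cell. -/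
def Qh : Set (L2 Ω) :=
  {q | ∀ K, ∃ c : ℝ, q =ᵐ[volume.restrict (cell K).dom] fun _ => c}

/-- The Lagrange multiplier space `Π_h^g`: on an interface `e` the multiplier lies in
`X_{2,h}^g · n_e` (a linear space, so the orientation of `n_e` is irrelevant), and it vanishes on
the faces contained in `∂Ω`. -/
def Pih : Set (L2skel cell) :=
  {π | ∀ K (l : (cell K).FaceIdx),
    (¬ (cell K).face l ⊆ frontier Ω → ∃ u ∈ X2 Ω cell k U,
      π =ᵐ[(surf d).restrict ((cell K).face l)] normalTrace (cell K) u) ∧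
    ((cell K).face l ⊆ frontier Ω →
      π =ᵐ[(surf d).restrict ((cell K).face l)] fun _ => 0)}

/-- `[C_h^g(τ), π] = ∑_K (τ · n_{∂K}, π)_{∂K}`. -/
def Ch [Fintype ι] (τ : E d → E d) (π : E d → ℝ) : ℝ :=
  ∑ K, ∫ x in (cell K).bdry, normalTrace (cell K) τ x * π x ∂(surf d)

/-- `∑_K (div τ, q)_K`. -/
def brokenDiv [Fintype ι] (τ : E d → E d) (q : E d → ℝ) : ℝ :=
  ∑ K, ∫ x in (cell K).dom, wdiv (cell K).dom τ x * q x

/-- `(θ, u, p)` solves the global expanded mixed MsFEM problem with source `f`. -/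
structure IsSolution (f : E d → ℝ) (s : L2v Ω × L2v Ω × L2 Ω) : Prop where
  theta_mem : s.1 ∈ X1 Ω cell k U
  u_mem : s.2.1 ∈ X2 Ω cell k U
  p_mem : s.2.2 ∈ Qh Ω cell
  eq1 : ∀ ξ ∈ X1 Ω cell k U,
    (∫ x in Ω, inner ℝ (app k s.1 x) (ξ x)) + ∫ x in Ω, inner ℝ (s.2.1 x) (ξ x) = 0
  eq2 : ∀ τ ∈ X2 Ω cell k U,
    (∫ x in Ω, inner ℝ (s.1 x) (τ x)) + ∫ x in Ω, s.2.2 x * wdiv Ω τ x = 0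
  eq3 : ∀ q ∈ Qh Ω cell, ∫ x in Ω, wdiv Ω s.2.1 x * q x = ∫ x in Ω, f x * q x

/-- `(θ, u, p, lam)` solves the hybridized global expanded mixed MsFEM problem with source `f`. -/
structure IsHybridSolution [Fintype ι] (f : E d → ℝ)
    (s : L2v Ω × L2v Ω × L2 Ω × L2skel cell) : Prop where
  theta_mem : s.1 ∈ X1 Ω cell k U
  u_mem : s.2.1 ∈ X2tilde Ω cell k U
  p_mem : s.2.2.1 ∈ Qh Ω cell
  lam_mem : s.2.2.2 ∈ Pih Ω cell k U
  eq1 : ∀ ξ ∈ X1 Ω cell k U,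
    (∫ x in Ω, inner ℝ (app k s.1 x) (ξ x)) + ∫ x in Ω, inner ℝ (s.2.1 x) (ξ x) = 0
  eq2 : ∀ τ ∈ X2tilde Ω cell k U,
    (∫ x in Ω, inner ℝ (s.1 x) (τ x)) + brokenDiv cell τ s.2.2.1 = Ch cell τ s.2.2.2
  eq3 : ∀ q ∈ Qh Ω cell, brokenDiv cell s.2.1 q = ∫ x in Ω, f x * q x
  eq4 : ∀ π ∈ Pih Ω cell k U, Ch cell s.2.1 π = 0

end Problems

end MsFEM

end

/-! The algebraic core is that ψ = -kη holds almost everywhere on each cell. Multiplication by k, a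
coercive operator on L², therefore maps X₁ onto the discontinuous velocity space. Take zero source.
Since div u is constant on each cell, the third equation forces div u = 0. Testing the second
equation with u and the first with θ leaves (kθ, θ) = 0, so θ = 0. Writing u = kζ with ζ in X₁ and
testing the first equation with ζ gives u = 0. Pressure and multiplier then vanish if they are
determined by their pairings with velocities. All spaces are finite-dimensional, so uniqueness
yields existence and no inf-sup constant is needed (`IsHybridSystem.eq_zero`,
`IsHybridSystem.exists_solution`).

The concrete input comes from velocities whose flux is concentrated on a single face, where it is
any combination of the global fluxes U_i · n (`exists_face_field`). As U_i lies in H(div, Ω), its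
flux does not jump, and neither does that of the corresponding face field, which thus lies in X₂.
Hence the multipliers on an interior face are exactly the combinations of global fluxes. The jump of
a discontinuous velocity, cut off to Ω, is itself a multiplier, and testing with it shows that the
constraint characterises X₂ (`mem_X2_of_Ch`). A multiplier tested with a one-sided face field has
zero L² norm on that face (`Pih_eq_zero`).

For the pressure (`Qh_eq_zero`), face fields show that the cell values c_K agree across interior
faces and vanish at boundary faces. No path of cells to the boundary is needed: the flux of c² x
then cancels over the skeleton, while its total is the sum of c_K² d |K|, so every c_K is zero.

Face fields exist only because the multiscale basis does. This is a Neumann problem on each cell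
(`exists_neumann`), solved by Lax–Milgram using a trace and a Poincaré inequality. Green's formula
for the Raviart–Thomas fields, proved by slicing a simplex as a cone and a parallelepiped as a
prism, provides the boundary analysis. Finally, on X₂ the multiplier term vanishes, so a hybrid
solution solves the global problem, and uniqueness there identifies the two. -/

noncomputable section

namespace MsFEM

/-! ### Convex geometry of simplices and parallelepipeds -/

namespace Cell

variable {d : ℕ}

instance (K : Cell d) : Fintype K.FaceIdx :=
  match K with
  | simplex _ => inferInstanceAs (Fintype (Fin (d + 1)))
  | box _ _ => inferInstanceAs (Fintype (Fin d × Bool))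

/-- The affine basis formed by the vertices of a full-dimensional simplex. -/
def vertexBasis (s : Affine.Simplex ℝ (E d) d) : AffineBasis (Fin (d + 1)) ℝ (E d) where
  toFun := s.points
  ind' := s.independent
  tot' := by
    rw [s.independent.affineSpan_eq_top_iff_card_eq_finrank_add_one]
    simp

/-- The `i`-th coordinate relative to the corner `a` and the edge vectors `v`. -/
def boxCoord (a : E d) (v : Module.Basis (Fin d) ℝ (E d)) (i : Fin d) : E d →ᵃ[ℝ] ℝ where
  toFun x := v.repr (x - a) i
  linear := v.coord i
  map_vadd' p w := by
    simp only [vadd_eq_add, Module.Basis.coord_apply]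
    rw [← Finsupp.add_apply, ← map_add]
    congr 2
    abel_nf

lemma boxCoord_linear (a : E d) (v : Module.Basis (Fin d) ℝ (E d)) (i : Fin d) :
    (boxCoord a v i).linear = v.coord i := rfl

/-- The affine function that vanishes on the hyperplane of a face and is nonnegative on the cell:
a barycentric coordinate of a simplex, a coordinate or one minus a coordinate of a box. -/
def bary : (K : Cell d) → K.FaceIdx → E d →ᵃ[ℝ] ℝ
  | simplex s, (j : Fin (d + 1)) => (vertexBasis s).coord j
  | box a v, ((i, true) : Fin d × Bool) => AffineMap.const ℝ (E d) 1 - boxCoord a v i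
  | box a v, ((i, false) : Fin d × Bool) => boxCoord a v i

lemma bary_box_true (a : E d) (v : Module.Basis (Fin d) ℝ (E d)) (i : Fin d) (x : E d) :
    (box a v).bary ((i, true) : Fin d × Bool) x = 1 - v.repr (x - a) i := rfl

lemma bary_box_false (a : E d) (v : Module.Basis (Fin d) ℝ (E d)) (i : Fin d) (x : E d) :
    (box a v).bary ((i, false) : Fin d × Bool) x = v.repr (x - a) i := rfl

lemma continuous_bary (K : Cell d) (l : K.FaceIdx) : Continuous (K.bary l) :=
  AffineMap.continuous_of_finiteDimensional _

/-- Presents both kinds of cell as an intersection of half-spaces indexed by faces, so that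
interior, boundary and adjacency can be read off from signs of affine functions. -/
lemma mem_carrier_iff (K : Cell d) (x : E d) : x ∈ K.carrier ↔ ∀ l, 0 ≤ K.bary l x := by
  cases K with
  | simplex s =>
    have := (vertexBasis s).convexHull_eq_nonneg_coord
    change x ∈ convexHull ℝ (Set.range (vertexBasis s)) ↔ _
    rw [this]
    exact Iff.rfl
  | box a v =>
    change (∀ i, v.repr (x - a) i ∈ Set.Icc (0 : ℝ) 1) ↔ ∀ l : Fin d × Bool, 0 ≤ (box a v).bary l x
    constructor
    · rintro h ⟨i, b⟩
      cases b
      · exact (h i).1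
      · rw [bary_box_true]; linarith [(h i).2]
    · intro h i
      have h1 := h (i, true)
      rw [bary_box_true] at h1
      exact ⟨h (i, false), by linarith⟩

lemma mem_face_iff (K : Cell d) (l : K.FaceIdx) (x : E d) :
    x ∈ K.face l ↔ x ∈ K.carrier ∧ K.bary l x = 0 := by
  cases K with
  | simplex s =>
    let j : Fin (d + 1) := l
    let b := vertexBasis s
    change x ∈ convexHull ℝ (b '' {j}ᶜ) ↔ x ∈ (simplex s).carrier ∧ b.coord j x = 0
    rw [mem_carrier_iff]
    change _ ↔ (∀ i : Fin (d + 1), 0 ≤ b.coord i x) ∧ b.coord j x = 0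
    constructor
    · intro hx
      have hc : Convex ℝ {y | (∀ i, 0 ≤ b.coord i y) ∧ b.coord j y = 0} := by
        intro y hy z hz α β hα hβ hαβ
        have key : ∀ i, b.coord i (α • y + β • z) = α * b.coord i y + β * b.coord i z := by
          intro i
          have := Convex.combo_affine_apply (f := b.coord i) (x := y) (y := z) hαβ
          simpa using this
        refine ⟨fun i => ?_, ?_⟩
        · rw [key]
          exact add_nonneg (mul_nonneg hα (hy.1 i)) (mul_nonneg hβ (hz.1 i))
        · rw [key, hy.2, hz.2]; simp
      refine convexHull_min ?_ hc hx
      rintro _ ⟨i, hi, rfl⟩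
      refine ⟨fun m => ?_, ?_⟩
      · by_cases h : m = i
        · subst h; simp
        · rw [b.coord_apply_ne h]
      · exact b.coord_apply_ne (fun h => hi h.symm)
    · rintro ⟨h0, hj⟩
      have hsum := b.linear_combination_coord_eq_self x
      have h1 := b.sum_coord_apply_eq_one x
      -- The vertex `j` carries weight zero; dropping it leaves a convex combination of the vertices
      -- of the face.
      rw [← hsum, ← Finset.sum_erase (Finset.univ) (a := j) (by rw [hj, zero_smul])]
      refine (convex_convexHull ℝ _).sum_mem (fun i _ => h0 i) ?_ ?_
      · rw [← h1]; exact Finset.sum_erase (f := fun i => b.coord i x) _ hj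
      · intro i hi
        refine subset_convexHull ℝ _ ⟨i, ?_, rfl⟩
        simpa using hi
  | box a v =>
    obtain ⟨i, b⟩ : Fin d × Bool := l
    change (x ∈ (box a v).carrier ∧ v.repr (x - a) i = if b then 1 else 0) ↔ _
    cases b
    · exact Iff.rfl
    · rw [bary_box_true]
      simp only [if_true]
      constructor
      · rintro ⟨h, h'⟩; exact ⟨h, by linarith⟩
      · rintro ⟨h, h'⟩; exact ⟨h, by linarith⟩

lemma exists_bary_pos (K : Cell d) : ∃ x, ∀ l, 0 < K.bary l x := by
  cases K with
  | simplex s =>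
    let b := vertexBasis s
    have key : ∀ j : Fin (d + 1), 0 < b.coord j (Finset.univ.centroid ℝ b) := by
      intro j
      rw [b.coord_apply_centroid (Finset.mem_univ j)]
      simp; positivity
    exact ⟨Finset.univ.centroid ℝ b, key⟩
  | box a v =>
    refine ⟨a + ∑ i, (2⁻¹ : ℝ) • v i, ?_⟩
    rintro (⟨i, b⟩ : Fin d × Bool)
    have : v.repr (a + ∑ i, (2⁻¹ : ℝ) • v i - a) i = 2⁻¹ := by
      rw [add_sub_cancel_left, v.repr_sum_self]
    cases b
    · rw [bary_box_false, this]; norm_num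
    · rw [bary_box_true, this]; norm_num

/-- The witness is the centre of the face. In dimension zero the face opposite to the only vertex is
empty, hence `hd`. -/
lemma exists_bary_eq_zero (hd : 1 ≤ d) (K : Cell d) (l : K.FaceIdx) :
    ∃ x, K.bary l x = 0 ∧ ∀ m, m ≠ l → 0 < K.bary m x := by
  cases K with
  | simplex s =>
    let b := vertexBasis s
    suffices key : ∀ j : Fin (d + 1), ∃ x, b.coord j x = 0 ∧ ∀ m : Fin (d + 1), m ≠ j →
      0 < b.coord m x from key l
    intro j
    have hne : (Finset.univ.erase j).Nonempty := by
      rw [← Finset.card_pos, Finset.card_erase_of_mem (Finset.mem_univ _)]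
      simp; omega
    refine ⟨(Finset.univ.erase j).centroid ℝ b, ?_, ?_⟩
    · exact b.coord_apply_combination_of_notMem (by simp)
        (Finset.sum_centroidWeights_eq_one_of_nonempty ℝ _ hne)
    · intro m hm
      rw [b.coord_apply_centroid (s := Finset.univ.erase j) (i := m)
        (Finset.mem_erase.2 ⟨hm, Finset.mem_univ _⟩)]
      have := hne.card_pos
      positivity
  | box a v =>
    obtain ⟨i, b⟩ : Fin d × Bool := l
    let c : Fin d → ℝ := fun m => if m = i then (if b then 1 else 0) else 2⁻¹
    have hc : ∀ m, v.repr (a + ∑ i, c i • v i - a) m = c m := by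
      intro m
      rw [add_sub_cancel_left, v.repr_sum_self]
    refine ⟨a + ∑ i, c i • v i, ?_, ?_⟩
    · cases b
      · rw [bary_box_false, hc]; simp [c]
      · rw [bary_box_true, hc]; simp [c]
    · rintro (⟨m, b'⟩ : Fin d × Bool) hm
      by_cases hmi : m = i
      · subst hmi
        have hb : b' ≠ b := fun h => hm (by rw [h])
        cases b' <;> cases b <;> simp_all [bary_box_false, bary_box_true, c]
      · cases b'
        · rw [bary_box_false, hc]; simp [c, hmi]
        · rw [bary_box_true, hc]; simp [c, hmi]; norm_num

lemma isClosed_carrier (K : Cell d) : IsClosed K.carrier := by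
  have : K.carrier = ⋂ l, {x | 0 ≤ K.bary l x} := by
    ext x; simp [mem_carrier_iff]
  rw [this]
  exact isClosed_iInter fun l => isClosed_le continuous_const (K.continuous_bary l)

lemma isCompact_carrier (K : Cell d) : IsCompact K.carrier := by
  cases K with
  | simplex s =>
    exact (Set.finite_range s.points).isCompact_convexHull ℝ
  | box a v =>
    have : (box a v).carrier = (fun c : Fin d → ℝ => a + ∑ i, c i • v i) ''
        (Set.univ.pi fun _ => Set.Icc (0 : ℝ) 1) := by
      ext x
      constructor
      · intro hx
        refine ⟨fun i => v.repr (x - a) i, fun i _ => hx i, ?_⟩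
        simp only
        rw [v.sum_repr]; abel
      · rintro ⟨c, hc, rfl⟩ i
        simp only
        rw [add_sub_cancel_left, v.repr_sum_self]
        exact hc i trivial
    rw [this]
    exact (isCompact_univ_pi fun _ => isCompact_Icc).image (by fun_prop)

lemma bary_add (K : Cell d) (l : K.FaceIdx) (x w : E d) :
    K.bary l (x + w) = K.bary l x + (K.bary l).linear w := by
  rw [add_comm, ← vadd_eq_add, AffineMap.map_vadd, vadd_eq_add, add_comm]

lemma bary_combo (K : Cell d) (l : K.FaceIdx) {x y : E d} {α β : ℝ} (h : α + β = 1) :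
    K.bary l (α • x + β • y) = α * K.bary l x + β * K.bary l y := by
  simpa using Convex.combo_affine_apply (f := K.bary l) (x := x) (y := y) h

lemma convex_carrier (K : Cell d) : Convex ℝ K.carrier := by
  intro x hx y hy α β hα hβ hαβ
  rw [mem_carrier_iff] at *
  intro l
  rw [bary_combo K l hαβ]
  exact add_nonneg (mul_nonneg hα (hx l)) (mul_nonneg hβ (hy l))

/-- A direction of decrease of the affine function of a face. -/
lemma exists_linear_neg (hd : 1 ≤ d) (K : Cell d) (l : K.FaceIdx) :
    ∃ w, (K.bary l).linear w < 0 := by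
  obtain ⟨x, hx⟩ := K.exists_bary_pos
  obtain ⟨y, hy, -⟩ := K.exists_bary_eq_zero hd l
  refine ⟨y - x, ?_⟩
  have := K.bary_add l x (y - x)
  rw [add_sub_cancel, hy] at this
  linarith [hx l]

/-- At an interior point no face function can vanish: a small move in a direction of decrease stays
in the cell but would make it negative. Conversely, finitely many strict inequalities cut out an
open subset of the cell. -/
lemma mem_dom_iff (hd : 1 ≤ d) (K : Cell d) (x : E d) : x ∈ K.dom ↔ ∀ l, 0 < K.bary l x := by
  constructor
  · intro hx l
    have h0 := (K.mem_carrier_iff x).1 (interior_subset hx) l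
    refine lt_of_le_of_ne h0 fun h => ?_
    obtain ⟨w, hw⟩ := K.exists_linear_neg hd l
    have hc : Filter.Tendsto (fun t : ℝ => x + t • w) (nhdsWithin 0 (Set.Ioi 0)) (nhds x) := by
      have : Continuous fun t : ℝ => x + t • w := by fun_prop
      simpa using (this.tendsto 0).mono_left nhdsWithin_le_nhds
    have h1 := hc.eventually (mem_interior_iff_mem_nhds.1 hx)
    obtain ⟨t, ht1, ht2⟩ := (h1.and self_mem_nhdsWithin).exists
    have h2 := (K.mem_carrier_iff _).1 ht1 l
    rw [bary_add, ← h, map_smul, smul_eq_mul] at h2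
    have : (0 : ℝ) < t := ht2
    nlinarith
  · intro h
    have ho : IsOpen {x | ∀ l, 0 < K.bary l x} := by
      rw [Set.ofPred_forall]
      exact isOpen_iInter_of_finite fun l => isOpen_lt continuous_const (K.continuous_bary l)
    exact interior_maximal (fun y hy => (K.mem_carrier_iff y).2 fun l => (hy l).le) ho h

lemma isOpen_dom (K : Cell d) : IsOpen K.dom := isOpen_interior

lemma dom_subset_carrier (K : Cell d) : K.dom ⊆ K.carrier := interior_subset

lemma dom_nonempty (hd : 1 ≤ d) (K : Cell d) : K.dom.Nonempty := by
  obtain ⟨x, hx⟩ := K.exists_bary_pos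
  exact ⟨x, (K.mem_dom_iff hd x).2 hx⟩

lemma closure_dom (hd : 1 ≤ d) (K : Cell d) : closure K.dom = K.carrier := by
  rw [dom, K.convex_carrier.closure_interior_eq_closure_of_nonempty_interior (K.dom_nonempty hd),
    K.isClosed_carrier.closure_eq]

lemma face_subset_carrier (K : Cell d) (l : K.FaceIdx) : K.face l ⊆ K.carrier :=
  fun x hx => ((K.mem_face_iff l x).1 hx).1

lemma isClosed_face (K : Cell d) (l : K.FaceIdx) : IsClosed (K.face l) := by
  have : K.face l = K.carrier ∩ {x | K.bary l x = 0} := by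
    ext x; exact K.mem_face_iff l x
  rw [this]
  exact K.isClosed_carrier.inter (isClosed_eq (K.continuous_bary l) continuous_const)

lemma isCompact_face (K : Cell d) (l : K.FaceIdx) : IsCompact (K.face l) :=
  K.isCompact_carrier.of_isClosed_subset (K.isClosed_face l) (K.face_subset_carrier l)

lemma bdry_eq_iUnion_face (hd : 1 ≤ d) (K : Cell d) : K.bdry = ⋃ l, K.face l := by
  ext x
  rw [bdry, frontier, K.isClosed_carrier.closure_eq, Set.mem_sdiff, Set.mem_iUnion]
  change (_ ∧ x ∉ K.dom) ↔ _
  rw [K.mem_dom_iff hd]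
  constructor
  · rintro ⟨h, h'⟩
    push Not at h'
    obtain ⟨l, hl⟩ := h'
    exact ⟨l, (K.mem_face_iff l x).2 ⟨h, le_antisymm hl ((K.mem_carrier_iff x).1 h l)⟩⟩
  · rintro ⟨l, hl⟩
    rw [mem_face_iff] at hl
    exact ⟨hl.1, fun h => (h l).ne' hl.2⟩

lemma face_subset_bdry (hd : 1 ≤ d) (K : Cell d) (l : K.FaceIdx) : K.face l ⊆ K.bdry := by
  rw [bdry_eq_iUnion_face hd]; exact Set.subset_iUnion _ l

lemma isClosed_bdry (K : Cell d) : IsClosed K.bdry := isClosed_frontier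

lemma isCompact_bdry (K : Cell d) : IsCompact K.bdry :=
  K.isCompact_carrier.of_isClosed_subset K.isClosed_bdry K.isClosed_carrier.frontier_subset

lemma volume_bdry (K : Cell d) : volume K.bdry = 0 := K.convex_carrier.addHaar_frontier _

/-- The relative interior of a face avoids all other faces. This excludes the first alternative of
the face-to-face condition when it is applied to two faces of one cell. -/
lemma face_injective (hd : 1 ≤ d) (K : Cell d) : Function.Injective K.face := by
  intro l l' h
  by_contra hne
  obtain ⟨x, hx, hx'⟩ := K.exists_bary_eq_zero hd l
  have hmem : x ∈ K.face l := by
    rw [mem_face_iff, mem_carrier_iff]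
    refine ⟨fun m => ?_, hx⟩
    by_cases hm : m = l
    · rw [hm, hx]
    · exact (hx' m hm).le
  rw [h, mem_face_iff] at hmem
  exact (hx' l' (fun h => hne h.symm)).ne' hmem.2

end Cell

/-! ### Slicing Euclidean space by parallel hyperplanes -/

section Slicing

variable {d : ℕ} (ℓ : E d →ₗ[ℝ] ℝ) (e : E d)

/-- The decomposition of `E d` into a line transversal to a hyperplane and the hyperplane. -/
def sliceEquiv (he : ℓ e = 1) : (ℝ × LinearMap.ker ℓ) ≃L[ℝ] E d :=
  LinearEquiv.toContinuousLinearEquiv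
    { toFun := fun p => p.1 • e + p.2
      map_add' := fun p q => by simp only [Prod.fst_add, Prod.snd_add, add_smul,
                    Submodule.coe_add]; abel
      map_smul' := fun c p => by simp [mul_smul]
      invFun := fun x => (ℓ x, ⟨x - ℓ x • e, by simp [he]⟩)
      left_inv := fun p => by
        have h : ℓ p.2 = 0 := p.2.2
        ext <;> simp [he, h]
      right_inv := fun x => by simp }

lemma sliceEquiv_apply (he : ℓ e = 1) (p : ℝ × LinearMap.ker ℓ) :
    sliceEquiv ℓ e he p = p.1 • e + p.2 := rfl

/-- The linear isomorphism transports the product measure to a Haar measure, and Haar measures are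
proportional. The value of `κ` is never computed: the constants in Green's formula are identified
later by testing with the function 1. -/
lemma exists_integral_slice (he : ℓ e = 1) (o : E d) : ∃ κ : ℝ, 0 < κ ∧
    ∀ g : E d → ℝ, Integrable g →
      ∫ x, g x = κ * ∫ s : ℝ, ∫ w : LinearMap.ker ℓ, g (o + s • e + w) := by
  let L := sliceEquiv ℓ e he
  let ν : Measure (E d) := Measure.map L volume
  have hvol : (volume : Measure (ℝ × LinearMap.ker ℓ)).IsAddHaarMeasure := by
    rw [Measure.volume_eq_prod]; infer_instance
  have hν : ν.IsAddHaarMeasure := L.isAddHaarMeasure_map volume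
  let c := Measure.addHaarScalarFactor (volume : Measure (E d)) ν
  have hc : (volume : Measure (E d)) = c • ν := Measure.isAddLeftInvariant_eq_smul _ _
  have hc0 : 0 < c := Measure.addHaarScalarFactor_pos_of_isAddHaarMeasure _ _
  refine ⟨c, by exact_mod_cast hc0, fun g hg => ?_⟩
  have hg' : Integrable (fun x => g (o + x)) := hg.comp_add_left o
  rw [← integral_add_left_eq_self g o]
  have h1 : Integrable (fun x => g (o + x)) ν := by
    rw [hc] at hg'
    have := (integrable_smul_measure (μ := ν) (c := (c : ENNReal)) (f := fun x => g (o + x))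
      (by exact_mod_cast hc0.ne') ENNReal.coe_ne_top).1 hg'
    exact this
  have h2 : Integrable (fun p => g (o + L p)) (volume : Measure (ℝ × LinearMap.ker ℓ)) :=
    (integrable_map_equiv L.toHomeomorph.toMeasurableEquiv _).1 h1
  conv_lhs => rw [hc]
  rw [integral_smul_nnreal_measure]
  have h3 : ∫ x, g (o + x) ∂ν = ∫ p, g (o + L p) :=
    integral_map_equiv L.toHomeomorph.toMeasurableEquiv _
  rw [h3, Measure.volume_eq_prod, integral_prod _ h2]
  simp only [L, sliceEquiv_apply, ← add_assoc]
  rfl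

lemma finrank_ker_eq (hd : 1 ≤ d) (he : ℓ e = 1) : Module.finrank ℝ (LinearMap.ker ℓ) = d - 1 := by
  have h1 := LinearMap.finrank_range_add_finrank_ker ℓ
  have h2 : LinearMap.range ℓ = ⊤ := by
    rw [LinearMap.range_eq_top]
    intro t
    exact ⟨t • e, by simp [he]⟩
  rw [h2, finrank_top, finrank_euclideanSpace_fin] at h1
  simp at h1
  omega

lemma isometry_add_coe (p : E d) : Isometry fun w : LinearMap.ker ℓ => p + (w : E d) :=
  (isometry_add_left p).comp isometry_subtype_coe

lemma range_add_coe (p : E d) :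
    Set.range (fun w : LinearMap.ker ℓ => p + (w : E d)) = {x | ℓ x = ℓ p} := by
  ext x
  constructor
  · rintro ⟨w, rfl⟩
    have h : ℓ w = 0 := w.2
    simp [h]
  · intro hx
    exact ⟨⟨x - p, by simpa [sub_eq_zero] using hx⟩, by simp⟩

/-- Translating the kernel into a parallel hyperplane is an isometry, so it preserves the Hausdorff
measure, which on a space of dimension d - 1 is the Lebesgue measure. This turns surface integrals
over faces into integrals over the kernel. -/
lemma map_volume_eq_surf (hd : 1 ≤ d) (he : ℓ e = 1) (p : E d) :
    Measure.map (fun w : LinearMap.ker ℓ => p + (w : E d)) volume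
      = (surf d).restrict {x | ℓ x = ℓ p} := by
  have h := (isometry_add_coe ℓ p).map_euclideanHausdorffMeasure (d := d - 1)
  rw [range_add_coe] at h
  rw [surf, ← h, ← finrank_ker_eq ℓ e hd he, InnerProductSpace.euclideanHausdorffMeasure_eq_volume]

lemma isClosedEmbedding_add_coe (p : E d) :
    Topology.IsClosedEmbedding fun w : LinearMap.ker ℓ => p + (w : E d) :=
  (isometry_add_coe ℓ p).isClosedEmbedding

lemma setIntegral_surf (hd : 1 ≤ d) (he : ℓ e = 1) (p : E d) {S : Set (E d)}
    (hS : MeasurableSet S) (hp : ∀ x ∈ S, ℓ x = ℓ p) (g : E d → ℝ) :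
    ∫ x in S, g x ∂(surf d) = ∫ w in {w : LinearMap.ker ℓ | p + (w : E d) ∈ S}, g (p + w) := by
  have h1 : (surf d).restrict S = ((surf d).restrict {x | ℓ x = ℓ p}).restrict S := by
    rw [Measure.restrict_restrict hS, Set.inter_eq_left.2 (show S ⊆ {x | ℓ x = ℓ p} from hp)]
  rw [h1, ← map_volume_eq_surf ℓ e hd he p,
    (isClosedEmbedding_add_coe ℓ p).measurableEmbedding.setIntegral_map]
  rfl

lemma surf_pos (hd : 1 ≤ d) (he : ℓ e = 1) (p : E d) {O : Set (E d)} (hO : IsOpen O)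
    (hp : p ∈ O) : surf d (O ∩ {x | ℓ x = ℓ p}) ≠ 0 := by
  rw [← Measure.restrict_apply hO.measurableSet, ← map_volume_eq_surf ℓ e hd he p,
    (isClosedEmbedding_add_coe ℓ p).measurableEmbedding.map_apply]
  refine (IsOpen.measure_pos volume (hO.preimage (isometry_add_coe ℓ p).continuous)
    ⟨0, ?_⟩).ne'
  simpa using hp

variable {ℓ e}

lemma setIntegral_slice {κ : ℝ} {o : E d}
    (hκ : ∀ g : E d → ℝ, Integrable g →
      ∫ x, g x = κ * ∫ s : ℝ, ∫ w : LinearMap.ker ℓ, g (o + s • e + w))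
    {K : Set (E d)} (hK : MeasurableSet K)
    (h01 : ∀ (s : ℝ) (w : LinearMap.ker ℓ), o + s • e + w ∈ K → s ∈ Set.Icc (0 : ℝ) 1)
    {G : E d → ℝ} (hG : IntegrableOn G K) :
    ∫ x in K, G x = κ * ∫ s in Set.Ioo (0 : ℝ) 1,
      ∫ w : LinearMap.ker ℓ, K.indicator G (o + s • e + w) := by
  rw [← integral_indicator hK, hκ _ (hG.integrable_indicator hK)]
  congr 1
  rw [← integral_Icc_eq_integral_Ioo]
  refine (setIntegral_eq_integral_of_forall_compl_eq_zero fun s hs => ?_).symm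
  refine integral_eq_zero_of_ae (Filter.Eventually.of_forall fun w => ?_)
  exact Set.indicator_of_notMem (fun h => hs (h01 s w h)) _

/-- The divergence theorem for the field x - o on a cone with apex `o`. The slice at height s is the
base scaled by s, so rescaling contributes s^(d-1). Along each ray the integrand becomes the
derivative of s^d v(o + s(e + w)), and only the value on the base survives. -/
lemma integral_cone (hd : 1 ≤ d) (he : ℓ e = 1) {κ : ℝ} {o : E d}
    (hκ : ∀ g : E d → ℝ, Integrable g →
      ∫ x, g x = κ * ∫ s : ℝ, ∫ w : LinearMap.ker ℓ, g (o + s • e + w))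
    {K : Set (E d)} (hK : IsCompact K)
    (h01 : ∀ (s : ℝ) (w : LinearMap.ker ℓ), o + s • e + w ∈ K → s ∈ Set.Icc (0 : ℝ) 1)
    {B : Set (LinearMap.ker ℓ)} (hB : IsCompact B)
    (hKB : ∀ s ∈ Set.Ioo (0 : ℝ) 1, ∀ w : LinearMap.ker ℓ, o + s • e + w ∈ K ↔ s⁻¹ • w ∈ B)
    {v : E d → ℝ} (hv : ContDiff ℝ ∞ v) :
    ∫ x in K, (fderiv ℝ v x (x - o) + d * v x) = κ * ∫ w in B, v (o + e + w) := by
  have hDv : Continuous (fderiv ℝ v) := hv.continuous_fderiv (by simp)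
  have hcG : Continuous fun x => fderiv ℝ v x (x - o) + d * v x := by
    have := hv.continuous
    fun_prop
  rw [setIntegral_slice hκ hK.measurableSet h01 (hcG.continuousOn.integrableOn_compact hK)]
  congr 1
  have step : ∀ s ∈ Set.Ioo (0 : ℝ) 1,
      ∫ w : LinearMap.ker ℓ, K.indicator (fun x => fderiv ℝ v x (x - o) + d * v x)
        (o + s • e + w) = ∫ w in B, s ^ (d - 1) * (fderiv ℝ v (o + s • (e + w)) (s • (e + w))
          + d * v (o + s • (e + w))) := by
    intro s hs
    have hs0 : s ≠ 0 := hs.1.ne'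
    have h1 : ∀ w : LinearMap.ker ℓ, K.indicator (fun x => fderiv ℝ v x (x - o) + d * v x)
        (o + s • e + w) = (fun w' : LinearMap.ker ℓ => B.indicator (fun w' => 
          fderiv ℝ v (o + s • (e + w')) (s • (e + w')) + d * v (o + s • (e + w'))) w')
            (s⁻¹ • w) := by
      intro w
      have h2 : o + s • (e + ((s⁻¹ • w : LinearMap.ker ℓ) : E d)) = o + s • e + w := by
        rw [smul_add, Submodule.coe_smul, smul_inv_smul₀ hs0, add_assoc]
      by_cases hw : o + s • e + w ∈ K
      · simp only
        rw [Set.indicator_of_mem hw, Set.indicator_of_mem ((hKB s hs w).1 hw), h2]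
        congr 2
        rw [← h2]; abel
      · simp only
        rw [Set.indicator_of_notMem hw, Set.indicator_of_notMem fun h => hw ((hKB s hs w).2 h)]
    simp_rw [h1]
    rw [Measure.integral_comp_inv_smul, finrank_ker_eq ℓ e hd he, integral_indicator hB.measurableSet,
      abs_of_nonneg (pow_nonneg hs.1.le _), smul_eq_mul, integral_const_mul]
  rw [setIntegral_congr_fun measurableSet_Ioo step]
  have hint : Integrable (Function.uncurry fun (s : ℝ) (w : LinearMap.ker ℓ) =>
      s ^ (d - 1) * (fderiv ℝ v (o + s • (e + w)) (s • (e + w)) + d * v (o + s • (e + w))))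
      ((volume.restrict (Set.Ioo (0 : ℝ) 1)).prod (volume.restrict B)) := by
    rw [Measure.prod_restrict]
    refine IntegrableOn.mono_set (t := Set.Icc (0 : ℝ) 1 ×ˢ B) ?_
      (Set.prod_mono Set.Ioo_subset_Icc_self le_rfl)
    refine ContinuousOn.integrableOn_compact (isCompact_Icc.prod hB) (Continuous.continuousOn ?_)
    have := hv.continuous
    unfold Function.uncurry
    fun_prop
  rw [integral_integral_swap hint]
  refine setIntegral_congr_fun hB.measurableSet fun w _ => ?_
  beta_reduce
  rw [← integral_Ioc_eq_integral_Ioo, ← intervalIntegral.integral_of_le zero_le_one]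
  have hder : ∀ s ∈ Set.uIcc (0 : ℝ) 1, HasDerivAt (fun s : ℝ => s ^ d * v (o + s • (e + (w : E d))))
      (s ^ (d - 1) * (fderiv ℝ v (o + s • (e + (w : E d))) (s • (e + w))
        + d * v (o + s • (e + (w : E d))))) s := by
    intro s _
    have h1 : HasDerivAt (fun s : ℝ => o + s • (e + (w : E d))) (e + w) s := by
      simpa using ((hasDerivAt_id s).smul_const (e + (w : E d))).const_add o
    have h2 := ((hv.differentiable (by simp)) (o + s • (e + (w : E d)))).hasFDerivAt.comp_hasDerivAt
      s h1
    have h3 := (hasDerivAt_pow d s).mul h2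
    refine h3.congr_deriv ?_
    -- Removes the truncated subtraction from the exponent d - 1.
    obtain ⟨n, rfl⟩ : ∃ n, d = n + 1 := ⟨d - 1, by omega⟩
    simp only [map_smul, smul_eq_mul, Nat.add_sub_cancel, Function.comp, pow_succ]
    push_cast
    ring
  rw [intervalIntegral.integral_eq_sub_of_hasDerivAt hder]
  -- The contribution of the apex is 0^d, which vanishes only because d is positive.
  · simp [add_assoc, show d ≠ 0 by omega]
  · refine Continuous.intervalIntegrable ?_ _ _
    have := hv.continuous
    fun_prop

/-- The analogue of `integral_cone` when all slices are translates of the base: along each segment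
the integrand is the derivative of s v(o + s e + w). The field vanishes on the bottom s = 0 and is
parallel to the lateral faces. -/
lemma integral_prism {κ : ℝ} {o : E d} (he : ℓ e = 1)
    (hκ : ∀ g : E d → ℝ, Integrable g →
      ∫ x, g x = κ * ∫ s : ℝ, ∫ w : LinearMap.ker ℓ, g (o + s • e + w))
    {K : Set (E d)} (hK : IsCompact K)
    (h01 : ∀ (s : ℝ) (w : LinearMap.ker ℓ), o + s • e + w ∈ K → s ∈ Set.Icc (0 : ℝ) 1)
    {B : Set (LinearMap.ker ℓ)} (hB : IsCompact B)
    (hKB : ∀ s ∈ Set.Ioo (0 : ℝ) 1, ∀ w : LinearMap.ker ℓ, o + s • e + w ∈ K ↔ w ∈ B)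
    {v : E d → ℝ} (hv : ContDiff ℝ ∞ v) :
    ∫ x in K, (fderiv ℝ v x (ℓ (x - o) • e) + v x) = κ * ∫ w in B, v (o + e + w) := by
  have hDv : Continuous (fderiv ℝ v) := hv.continuous_fderiv (by simp)
  have hℓ : Continuous ℓ := ℓ.continuous_of_finiteDimensional
  have hcG : Continuous fun x => fderiv ℝ v x (ℓ (x - o) • e) + v x := by
    have := hv.continuous
    fun_prop
  rw [setIntegral_slice hκ hK.measurableSet h01 (hcG.continuousOn.integrableOn_compact hK)]
  congr 1
  have step : ∀ s ∈ Set.Ioo (0 : ℝ) 1,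
      ∫ w : LinearMap.ker ℓ, K.indicator (fun x => fderiv ℝ v x (ℓ (x - o) • e) + v x)
        (o + s • e + w) = ∫ w in B, (fderiv ℝ v (o + s • e + w) (s • e) + v (o + s • e + w)) := by
    intro s hs
    rw [← integral_indicator hB.measurableSet]
    congr 1
    ext w
    have h2 : ℓ (o + s • e + w - o) = s := by
      have h : ℓ w = 0 := w.2
      simp [he, h]
    by_cases hw : o + s • e + w ∈ K
    · rw [Set.indicator_of_mem hw, Set.indicator_of_mem ((hKB s hs w).1 hw), h2]
    · rw [Set.indicator_of_notMem hw, Set.indicator_of_notMem fun h => hw ((hKB s hs w).2 h)]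
  rw [setIntegral_congr_fun measurableSet_Ioo step]
  have hint : Integrable (Function.uncurry fun (s : ℝ) (w : LinearMap.ker ℓ) =>
      (fderiv ℝ v (o + s • e + w) (s • e) + v (o + s • e + w)))
      ((volume.restrict (Set.Ioo (0 : ℝ) 1)).prod (volume.restrict B)) := by
    rw [Measure.prod_restrict]
    refine IntegrableOn.mono_set (t := Set.Icc (0 : ℝ) 1 ×ˢ B) ?_
      (Set.prod_mono Set.Ioo_subset_Icc_self le_rfl)
    refine ContinuousOn.integrableOn_compact (isCompact_Icc.prod hB) (Continuous.continuousOn ?_)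
    have := hv.continuous
    unfold Function.uncurry
    fun_prop
  rw [integral_integral_swap hint]
  refine setIntegral_congr_fun hB.measurableSet fun w _ => ?_
  beta_reduce
  rw [← integral_Ioc_eq_integral_Ioo, ← intervalIntegral.integral_of_le zero_le_one]
  have hder : ∀ s ∈ Set.uIcc (0 : ℝ) 1, HasDerivAt (fun s : ℝ => s * v (o + s • e + (w : E d)))
      (fderiv ℝ v (o + s • e + (w : E d)) (s • e) + v (o + s • e + (w : E d))) s := by
    intro s _
    have h1 : HasDerivAt (fun s : ℝ => o + s • e + (w : E d)) e s := by
      simpa using (((hasDerivAt_id s).smul_const e).const_add o).add_const (w : E d)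
    have h2 := ((hv.differentiable (by simp)) (o + s • e + (w : E d))).hasFDerivAt.comp_hasDerivAt
      s h1
    have h3 := (hasDerivAt_id s).mul h2
    refine h3.congr_deriv ?_
    simp only [map_smul, smul_eq_mul, Function.comp, id]
    ring
  rw [intervalIntegral.integral_eq_sub_of_hasDerivAt hder]
  · simp
  · refine Continuous.intervalIntegrable ?_ _ _
    have := hv.continuous
    fun_prop

end Slicing

/-! ### Green's formula for Raviart–Thomas fields and the size of faces -/

namespace Cell

variable {d : ℕ}

lemma dom_ae_eq_carrier (K : Cell d) : K.dom =ᵐ[volume] K.carrier :=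
  interior_ae_eq_of_null_frontier K.volume_bdry

lemma volume_real_pos (hd : 1 ≤ d) (K : Cell d) : 0 < volume.real K.carrier := by
  refine ENNReal.toReal_pos (fun h => ?_) K.isCompact_carrier.measure_lt_top.ne
  exact (K.isOpen_dom.measure_pos volume (K.dom_nonempty hd)).ne'
    (measure_mono_null K.dom_subset_carrier h)

/-- A point of the cell and a direction pointing to the hyperplane of a face. -/
lemma exists_transversal (hd : 1 ≤ d) (K : Cell d) (l : K.FaceIdx) :
    ∃ e, (-(K.bary l).linear) e = 1 := by
  obtain ⟨w, hw⟩ := K.exists_linear_neg hd l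
  refine ⟨(-(K.bary l).linear w)⁻¹ • w, ?_⟩
  rw [LinearMap.neg_apply, map_smul, smul_eq_mul, ← mul_neg, inv_mul_cancel₀ (by linarith)]

/-- The slicing functional is minus the linear part of the face function, so `e` points towards the
face, `o` lies in the slice s = 0 and the hyperplane of the face is the slice s = 1. -/
lemma bary_slice (K : Cell d) (l : K.FaceIdx) {o e : E d} (he : (-(K.bary l).linear) e = 1)
    (ho : K.bary l o = 1) (s : ℝ) (w : LinearMap.ker (-(K.bary l).linear)) :
    K.bary l (o + s • e + w) = 1 - s := by
  have hw : (-(K.bary l).linear) w = 0 := w.2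
  rw [LinearMap.neg_apply] at hw he
  rw [bary_add, bary_add, ho, map_smul, smul_eq_mul]
  linear_combination (-1 : ℝ) * hw - s * he

lemma isCompact_face_slice (K : Cell d) (l : K.FaceIdx) (p : E d) :
    IsCompact {w : LinearMap.ker (-(K.bary l).linear) | p + (w : E d) ∈ K.face l} :=
  (isClosedEmbedding_add_coe _ p).isCompact_preimage (K.isCompact_face l)

lemma setIntegral_face (hd : 1 ≤ d) (K : Cell d) (l : K.FaceIdx) {o e : E d}
    (he : (-(K.bary l).linear) e = 1) (ho : K.bary l o = 1) (v : E d → ℝ) :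
    ∫ w in {w : LinearMap.ker (-(K.bary l).linear) | o + e + (w : E d) ∈ K.face l},
      v (o + e + w) = ∫ x in K.face l, v x ∂(surf d) := by
  rw [setIntegral_surf _ e hd he (o + e) (K.isClosed_face l).measurableSet]
  intro x hx
  have h1 : K.bary l x = 0 := ((K.mem_face_iff l x).1 hx).2
  have h2 : K.bary l (o + e) = 0 := by simpa using K.bary_slice l he ho 1 0
  have h3 := K.bary_add l (o + e) (x - (o + e))
  rw [add_sub_cancel, h1, h2, map_sub] at h3
  simp only [LinearMap.neg_apply]
  linarith

lemma rt0_simplex (s : Affine.Simplex ℝ (E d) d) (j : Fin (d + 1)) (x : E d) :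
    (simplex s).rt0 j x = (d * volume.real (simplex s).carrier)⁻¹ • (x - s.points j) := rfl

lemma rt0_box_true (a : E d) (v : Module.Basis (Fin d) ℝ (E d)) (i : Fin d) (x : E d) :
    (box a v).rt0 ((i, true) : Fin d × Bool) x
      = (v.repr (x - a) i / volume.real (box a v).carrier) • v i := by
  simp [rt0]

lemma rt0_box_false (a : E d) (v : Module.Basis (Fin d) ℝ (E d)) (i : Fin d) (x : E d) :
    (box a v).rt0 ((i, false) : Fin d × Bool) x
      = ((v.repr (x - a) i - 1) / volume.real (box a v).carrier) • v i := by
  simp [rt0]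

lemma continuous_rt0 (K : Cell d) (l : K.FaceIdx) : Continuous (K.rt0 l) := by
  cases K with
  | simplex s =>
    change Continuous fun x => (d * volume.real (simplex s).carrier)⁻¹ • (x - s.points l)
    fun_prop
  | box a v =>
    obtain ⟨i, b⟩ : Fin d × Bool := l
    have hc : Continuous (boxCoord a v i) := AffineMap.continuous_of_finiteDimensional _
    change Continuous fun x => ((boxCoord a v i x - if b then 0 else 1) /
      volume.real (box a v).carrier) • v i
    fun_prop

/-- A simplex is the cone with apex the vertex `j` over the opposite face, so `integral_cone`
applies. -/
lemma exists_rt0_divergence_simplex (hd : 1 ≤ d) (s : Affine.Simplex ℝ (E d) d)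
    (j : Fin (d + 1)) : ∃ c : ℝ, ∀ v : E d → ℝ, ContDiff ℝ ∞ v →
    ∫ x in (simplex s).carrier, (fderiv ℝ v x (x - s.points j) + d * v x)
      = c * ∫ x in (simplex s).face j, v x ∂(surf d) := by
  let K : Cell d := simplex s
  let l : K.FaceIdx := j
  let o := s.points j
  have ho : K.bary l o = 1 := (vertexBasis s).coord_apply_eq j
  have ho' : ∀ m : K.FaceIdx, m ≠ l → K.bary m o = 0 :=
    fun m hm => (vertexBasis s).coord_apply_ne hm
  obtain ⟨e, he⟩ := K.exists_transversal hd l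
  obtain ⟨κ, -, hκ⟩ := exists_integral_slice (-(K.bary l).linear) e he o
  refine ⟨κ, fun v hv => ?_⟩
  rw [← K.setIntegral_face hd l he ho v]
  refine integral_cone hd he hκ K.isCompact_carrier ?_ (K.isCompact_face_slice l _) ?_ hv
  · intro t w h
    rw [mem_carrier_iff] at h
    have hb := K.bary_slice l he ho t w
    have hsum : ∑ m : Fin (d + 1), (vertexBasis s).coord m (o + t • e + w) = 1 :=
      (vertexBasis s).sum_coord_apply_eq_one _
    have hle : (vertexBasis s).coord j (o + t • e + w) ≤ 1 := by
      rw [← hsum]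
      exact Finset.single_le_sum (f := fun m => (vertexBasis s).coord m (o + t • e + w))
        (fun m _ => h m) (Finset.mem_univ j)
    have h0 := h l
    change K.bary l (o + t • e + w) ≤ 1 at hle
    rw [hb] at hle h0
    constructor <;> linarith
  · intro t ht w
    -- The other barycentric coordinates vanish at the apex and hence are homogeneous of degree one
    -- along rays; their signs are therefore the same in the slice and in the base.
    have key : ∀ m, m ≠ l → K.bary m (o + e + ((t⁻¹ • w : LinearMap.ker _) : E d))
        = t⁻¹ * K.bary m (o + t • e + w) := by
      intro m hm
      rw [bary_add, bary_add, bary_add, bary_add, ho' m hm, Submodule.coe_smul, map_smul, map_smul,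
        smul_eq_mul, smul_eq_mul]
      have : t ≠ 0 := ht.1.ne'
      field_simp
      ring
    have hl : K.bary l (o + e + ((t⁻¹ • w : LinearMap.ker _) : E d)) = 0 := by
      have := K.bary_slice l he ho 1 (t⁻¹ • w)
      simpa using this
    change _ ↔ o + e + ((t⁻¹ • w : LinearMap.ker _) : E d) ∈ K.face l
    rw [mem_face_iff]
    rw [mem_carrier_iff, mem_carrier_iff]
    constructor
    · intro h
      refine ⟨fun m => ?_, hl⟩
      by_cases hm : m = l
      · rw [hm, hl]
      · rw [key m hm]; exact mul_nonneg (inv_nonneg.2 ht.1.le) (h m)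
    · rintro ⟨h, -⟩ m
      by_cases hm : m = l
      · rw [hm, K.bary_slice l he ho]; linarith [ht.2]
      · have := h m
        rw [key m hm] at this
        exact nonneg_of_mul_nonneg_right this (inv_pos.2 ht.1)

/-- The face of a box opposite to a given one. -/
lemma box_bary_opposite (a : E d) (v : Module.Basis (Fin d) ℝ (E d)) (i : Fin d) (b : Bool)
    (x : E d) : (box a v).bary ((i, !b) : Fin d × Bool) x
      = 1 - (box a v).bary ((i, b) : Fin d × Bool) x := by
  cases b
  · rfl
  · change (box a v).bary ((i, false) : Fin d × Bool) x = _
    rw [bary_box_true, bary_box_false]; ring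

/-- A parallelepiped is a prism in the direction `v i` over the chosen face, so `integral_prism`
applies. -/
lemma exists_rt0_divergence_box (hd : 1 ≤ d) (a : E d) (v : Module.Basis (Fin d) ℝ (E d))
    (i : Fin d) (b : Bool) : ∃ c : ℝ, ∀ g : E d → ℝ, ContDiff ℝ ∞ g →
    ∫ x in (box a v).carrier, (fderiv ℝ g x ((v.repr (x - a) i - if b then 0 else 1) • v i) + g x)
      = c * ∫ x in (box a v).face ((i, b) : Fin d × Bool), g x ∂(surf d) := by
  let K : Cell d := box a v
  let l : K.FaceIdx := ((i, b) : Fin d × Bool)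
  -- The direction must point out of the cell through the chosen face, with the origin `o` on the
  -- opposite face. The two sign changes cancel in the field itself.
  let e : E d := if b then v i else -v i
  let o : E d := if b then a else a + v i
  have hlin : ∀ (m : Fin d) (b' : Bool) (w : E d), (K.bary ((m, b') : Fin d × Bool)).linear w
      = if b' then -v.repr w m else v.repr w m := by
    intro m b' w
    cases b'
    · rfl
    · change ((AffineMap.const ℝ (E d) (1 : ℝ)) - boxCoord a v m).linear w = _
      simp [boxCoord_linear]
  have ho : K.bary l o = 1 := by
    cases b
    · change (box a v).bary ((i, false) : Fin d × Bool) (a + v i) = 1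
      rw [bary_box_false]; simp
    · change (box a v).bary ((i, true) : Fin d × Bool) a = 1
      rw [bary_box_true]; simp
  have he : (-(K.bary l).linear) e = 1 := by
    rw [LinearMap.neg_apply, hlin i b]
    cases b <;> simp [e]
  have hother : ∀ m : Fin d, m ≠ i → ∀ b', (K.bary ((m, b') : Fin d × Bool)).linear e = 0 := by
    intro m hm b'
    rw [hlin]
    cases b <;> cases b' <;> simp [e, hm.symm]
  obtain ⟨κ, -, hκ⟩ := exists_integral_slice (-(K.bary l).linear) e he o
  have hfield : ∀ x, (v.repr (x - a) i - if b then 0 else 1) • v i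
      = (-(K.bary l).linear) (x - o) • e := by
    intro x
    rw [LinearMap.neg_apply, hlin i b]
    cases b
    · simp only [o, e, Bool.false_eq_true, if_false, ← sub_sub, map_sub, Finsupp.sub_apply,
        Module.Basis.repr_self, Finsupp.single_eq_same, smul_neg, ← neg_smul]
      congr 1; ring
    · simp [o, e]
  refine ⟨κ, fun g hg => ?_⟩
  simp_rw [hfield]
  change _ = κ * ∫ x in K.face l, g x ∂(surf d)
  rw [← K.setIntegral_face hd l he ho g]
  have h01 : ∀ (t : ℝ) (w : LinearMap.ker (-(K.bary l).linear)), o + t • e + w ∈ K.carrier →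
      t ∈ Set.Icc (0 : ℝ) 1 := by
    intro t w h
    rw [mem_carrier_iff] at h
    have h1 := h l
    have h2 := h ((i, !b) : Fin d × Bool)
    have h3 : K.bary ((i, !b) : Fin d × Bool) (o + t • e + w) = 1 - K.bary l (o + t • e + w) :=
      box_bary_opposite a v i b _
    rw [h3] at h2
    rw [K.bary_slice l he ho] at h1 h2
    constructor <;> linarith
  refine integral_prism he hκ K.isCompact_carrier h01 (K.isCompact_face_slice l _) ?_ hg
  · intro t ht w
    have hl : K.bary l (o + e + (w : E d)) = 0 := by
      have := K.bary_slice l he ho 1 w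
      simpa using this
    change _ ↔ o + e + (w : E d) ∈ K.face l
    rw [mem_face_iff]
    have key : ∀ m : Fin d, m ≠ i → ∀ b', K.bary ((m, b') : Fin d × Bool) (o + e + (w : E d))
        = K.bary ((m, b') : Fin d × Bool) (o + t • e + w) := by
      intro m hm b'
      let M : K.FaceIdx := ((m, b') : Fin d × Bool)
      have hM : (K.bary M).linear e = 0 := hother m hm b'
      change K.bary M _ = K.bary M _
      rw [bary_add, bary_add, bary_add, bary_add, map_smul, hM, smul_zero]
    rw [mem_carrier_iff, mem_carrier_iff]
    have hcases : ∀ b', b' = b ∨ b' = !b := by intro b'; cases b <;> cases b' <;> simp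
    constructor
    · intro h
      refine ⟨?_, hl⟩
      rintro (⟨m, b'⟩ : Fin d × Bool)
      by_cases hm : m = i
      · subst hm
        rcases hcases b' with rfl | rfl
        · exact hl.ge
        · rw [show K.bary ((m, !b) : Fin d × Bool) (o + e + (w : E d))
            = 1 - K.bary l (o + e + (w : E d)) from box_bary_opposite a v m b _, hl]
          norm_num
      · rw [key m hm b']; exact h _
    · rintro ⟨h, -⟩ (⟨m, b'⟩ : Fin d × Bool)
      by_cases hm : m = i
      · subst hm
        have h4 := K.bary_slice l he ho t w
        rcases hcases b' with rfl | rfl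
        · exact le_of_le_of_eq (by linarith [ht.2]) h4.symm
        · rw [show K.bary ((m, !b) : Fin d × Bool) (o + t • e + (w : E d))
            = 1 - K.bary l (o + t • e + (w : E d)) from box_bary_opposite a v m b _, h4]
          linarith [ht.1]
      · rw [← key m hm b']; exact h _

/-- Green's formula for the lowest-order Raviart–Thomas shape functions. -/
lemma exists_rt0_divergence (hd : 1 ≤ d) (K : Cell d) (l : K.FaceIdx) :
    ∃ c : ℝ, ∀ v : E d → ℝ, ContDiff ℝ ∞ v →
      ∫ x in K.dom, (fderiv ℝ v x (K.rt0 l x) + (volume.real K.carrier)⁻¹ * v x)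
        = c * ∫ x in K.face l, v x ∂(surf d) := by
  have hK := K.volume_real_pos hd
  simp_rw [setIntegral_congr_set K.dom_ae_eq_carrier]
  cases K with
  | simplex s =>
    let j : Fin (d + 1) := l
    obtain ⟨c, hc⟩ := exists_rt0_divergence_simplex hd s j
    refine ⟨(d * volume.real (simplex s).carrier)⁻¹ * c, fun v hv => ?_⟩
    rw [mul_assoc, ← hc v hv, ← integral_const_mul]
    refine integral_congr_ae (Filter.Eventually.of_forall fun x => ?_)
    change fderiv ℝ v x ((d * volume.real (simplex s).carrier)⁻¹ • (x - s.points j)) + _ = _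
    have : (d : ℝ) ≠ 0 := by exact_mod_cast (by omega : d ≠ 0)
    rw [map_smul, smul_eq_mul]
    field_simp
  | box a v =>
    obtain ⟨i, b⟩ : Fin d × Bool := l
    obtain ⟨c, hc⟩ := exists_rt0_divergence_box hd a v i b
    refine ⟨(volume.real (box a v).carrier)⁻¹ * c, fun g hg => ?_⟩
    rw [mul_assoc, ← hc g hg, ← integral_const_mul]
    refine integral_congr_ae (Filter.Eventually.of_forall fun x => ?_)
    change fderiv ℝ g x (((v.repr (x - a) i - if b then 0 else 1) /
      volume.real (box a v).carrier) • v i) + _ = _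
    simp only [map_smul, smul_eq_mul]
    field_simp

/-- Green's formula with v = 1 decides this: if the face had infinite measure, the integral over it
would be zero by convention, while the volume side is |K|/|K|. -/
lemma surf_face_lt_top (hd : 1 ≤ d) (K : Cell d) (l : K.FaceIdx) : surf d (K.face l) < ⊤ := by
  obtain ⟨c, hc⟩ := K.exists_rt0_divergence hd l
  by_contra h
  rw [not_lt, top_le_iff] at h
  have h1 := hc (fun _ => 1) contDiff_const
  have hK := K.volume_real_pos hd
  simp [Measure.real, h, setIntegral_congr_set K.dom_ae_eq_carrier] at h1
  exact hK.ne' h1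

lemma surf_bdry_lt_top (hd : 1 ≤ d) (K : Cell d) : surf d K.bdry < ⊤ := by
  rw [K.bdry_eq_iUnion_face hd]
  exact (measure_iUnion_le _).trans_lt (by
    rw [tsum_fintype]
    exact ENNReal.sum_lt_top.2 fun l _ => K.surf_face_lt_top hd l)

/-- Near a point where the remaining inequalities are strict, the face coincides with its
hyperplane, whose relatively open nonempty pieces have positive measure. -/
lemma surf_face_inter_open_ne_zero (hd : 1 ≤ d) (K : Cell d) (l : K.FaceIdx) {x : E d}
    (hx : x ∈ K.face l) (hx' : ∀ m, m ≠ l → 0 < K.bary m x) {O : Set (E d)} (hO : IsOpen O)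
    (hxO : x ∈ O) : surf d (K.face l ∩ O) ≠ 0 := by
  obtain ⟨e, he⟩ := K.exists_transversal hd l
  let O' : Set (E d) := O ∩ ⋂ m : {m // m ≠ l}, {y | 0 < K.bary m y}
  have hO' : IsOpen O' := hO.inter <| isOpen_iInter_of_finite fun m =>
    isOpen_lt continuous_const (K.continuous_bary m)
  have hxO' : x ∈ O' := ⟨hxO, by simpa using hx'⟩
  intro h
  refine surf_pos _ e hd he x hO' hxO' (measure_mono_null ?_ h)
  rintro y ⟨⟨hyO, hy⟩, hyl⟩
  have hyl' : K.bary l y = 0 := by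
    have h3 := K.bary_add l x (y - x)
    have h4 : (-(K.bary l).linear) y = (-(K.bary l).linear) x := hyl
    rw [add_sub_cancel, ((K.mem_face_iff l x).1 hx).2, map_sub] at h3
    simp only [LinearMap.neg_apply] at h4
    linarith
  refine ⟨(K.mem_face_iff l y).2 ⟨(K.mem_carrier_iff y).2 fun m => ?_, hyl'⟩, hyO⟩
  by_cases hm : m = l
  · rw [hm, hyl']
  · exact (by simpa using hy : ∀ m, m ≠ l → 0 < K.bary m y) m hm |>.le

end Cell

/-! ### Square integrable functions -/

section L2

variable {F : Type*} [NormedAddCommGroup F]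

lemma memLp_restrict_of_continuous {X : Type*} [TopologicalSpace X] [MeasurableSpace X]
    [OpensMeasurableSpace X] {μ : Measure X} {f : X → F} (hf : Continuous f) {s S : Set X}
    (hS : IsCompact S) (hs : MeasurableSet s) (hsS : s ⊆ S) (hμ : μ s < ⊤) (p : ENNReal) :
    MemLp f p (μ.restrict s) := by
  obtain ⟨C, hC⟩ := hS.exists_bound_of_continuousOn hf.continuousOn
  have : IsFiniteMeasure (μ.restrict s) := ⟨by simpa using hμ⟩
  refine MemLp.of_bound ?_ C (ae_restrict_of_forall_mem hs fun x hx => hC x (hsS hx))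
  exact hf.continuousOn.aestronglyMeasurable_of_subset_isCompact hS hs hsS

lemma integrable_clm_apply [NormedSpace ℝ F] {Y : Type*} [MeasurableSpace Y] {μ : Measure Y} {A : Y → F →L[ℝ] ℝ}
    {w : Y → F} (hA : MemLp A 2 μ) (hw : MemLp w 2 μ) : Integrable (fun x => A x (w x)) μ :=
  memLp_one_iff_integrable.1
    (ContinuousLinearMap.memLp_of_bilin 1 (ContinuousLinearMap.id ℝ (F →L[ℝ] ℝ)) hA hw)

lemma integrable_mul_L2 {Y : Type*} [MeasurableSpace Y] {μ : Measure Y} {f g : Y → ℝ}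
    (hf : MemLp f 2 μ) (hg : MemLp g 2 μ) : Integrable (fun x => f x * g x) μ :=
  hf.integrable_mul hg

lemma integrable_inner_L2 {Y H : Type*} [MeasurableSpace Y] [NormedAddCommGroup H]
    [InnerProductSpace ℝ H] {μ : Measure Y} {f g : Y → H}
    (hf : MemLp f 2 μ) (hg : MemLp g 2 μ) : Integrable (fun x => inner ℝ (f x) (g x)) μ :=
  memLp_one_iff_integrable.1 (ContinuousLinearMap.memLp_of_bilin 1 (innerSL ℝ) hf hg)

end L2

/-! ### Weak divergence -/

section WeakDiv

variable {d : ℕ} {U : Set (E d)} {w w' : E d → E d} {δ δ' : E d → ℝ}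

lemma integrable_test_fderiv {v : E d → ℝ} (hv : ContDiff ℝ ∞ v) (hc : HasCompactSupport v)
    (hw : MemLp w 2 (volume.restrict U)) :
    IntegrableOn (fun x => fderiv ℝ v x (w x)) U :=
  integrable_clm_apply ((hv.continuous_fderiv (by simp)).memLp_of_hasCompactSupport
    (hc.fderiv ℝ)) hw

lemma integrable_test_mul {v : E d → ℝ} (hv : ContDiff ℝ ∞ v) (hc : HasCompactSupport v)
    (hδ : MemLp δ 2 (volume.restrict U)) : IntegrableOn (fun x => δ x * v x) U :=
  integrable_mul_L2 hδ (hv.continuous.memLp_of_hasCompactSupport hc)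

/-- The fundamental lemma of the calculus of variations. It makes the arbitrarily chosen
representative `wdiv` usable. -/
lemma IsWeakDiv.ae_eq (hU : IsOpen U) (h : IsWeakDiv U w δ) (h' : IsWeakDiv U w δ') :
    δ =ᵐ[volume.restrict U] δ' := by
  have hloc : LocallyIntegrableOn (fun x => δ x - δ' x) U volume := by
    have := (h.1.sub h'.1).locallyIntegrable (by norm_num)
    exact locallyIntegrableOn_of_locallyIntegrable_restrict this
  have := hU.ae_eq_zero_of_integral_contDiff_smul_eq_zero hloc fun g hg hc hs => by
    have h0 : ∀ x, x ∉ U → g x • (δ x - δ' x) = 0 := fun x hx => by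
      rw [image_eq_zero_of_notMem_tsupport fun h => hx (hs h), zero_smul]
    rw [← setIntegral_eq_integral_of_forall_compl_eq_zero h0]
    have h1 := h.2 g hg hc hs
    have h2 := h'.2 g hg hc hs
    have h3 : ∀ x, g x • (δ x - δ' x) = δ x * g x - δ' x * g x := fun x => by
      rw [smul_eq_mul]; ring
    simp_rw [h3]
    rw [integral_sub (integrable_test_mul hg hc h.1) (integrable_test_mul hg hc h'.1)]
    linarith
  filter_upwards [ae_restrict_of_ae this, ae_restrict_mem hU.measurableSet] with x hx hxU
  exact sub_eq_zero.1 (hx hxU)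

lemma MemHdiv.isWeakDiv (h : MemHdiv U w) : IsWeakDiv U w (wdiv U w) := by
  have := h.2
  rw [wdiv, dif_pos this]
  exact this.choose_spec

lemma IsWeakDiv.wdiv_ae_eq (hU : IsOpen U) (h : IsWeakDiv U w δ) :
    wdiv U w =ᵐ[volume.restrict U] δ := by
  have h' : ∃ δ, IsWeakDiv U w δ := ⟨δ, h⟩
  rw [wdiv, dif_pos h']
  exact h'.choose_spec.ae_eq hU h

lemma IsWeakDiv.mono {V : Set (E d)} (h : IsWeakDiv U w δ) (hVU : V ⊆ U) :
    IsWeakDiv V w δ := by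
  refine ⟨h.1.mono_measure (Measure.restrict_mono hVU le_rfl), fun v hv hc hs => ?_⟩
  have hz : ∀ x, x ∉ V → x ∉ tsupport v := fun x hx h => hx (hs h)
  have h1 : ∀ W : Set (E d), V ⊆ W → ∫ x in W, fderiv ℝ v x (w x) = ∫ x, fderiv ℝ v x (w x) := by
    refine fun W hW => setIntegral_eq_integral_of_forall_compl_eq_zero fun x hx => ?_
    have := hz x fun h => hx (hW h)
    rw [image_eq_zero_of_notMem_tsupport fun h => this (tsupport_fderiv_subset ℝ h)]
    simp
  have h2 : ∀ W : Set (E d), V ⊆ W → ∫ x in W, δ x * v x = ∫ x, δ x * v x := by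
    refine fun W hW => setIntegral_eq_integral_of_forall_compl_eq_zero fun x hx => ?_
    rw [image_eq_zero_of_notMem_tsupport (hz x fun h => hx (hW h)), mul_zero]
  rw [h1 V le_rfl, h2 V le_rfl, ← h1 U hVU, ← h2 U hVU]
  exact h.2 v hv hc (hs.trans hVU)

lemma MemHdiv.wdiv_ae_eq_mono {V : Set (E d)} (h : MemHdiv U w) (hV : IsOpen V) (hVU : V ⊆ U) :
    wdiv V w =ᵐ[volume.restrict V] wdiv U w :=
  (h.isWeakDiv.mono hVU).wdiv_ae_eq hV

end WeakDiv

/-! ### Green's formula on a cell -/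

/-- `w`, its divergence `δ` and its normal component `g` satisfy Green's formula on `K`. -/
structure HasGreen {d : ℕ} (K : Cell d) (w : E d → E d) (δ g : E d → ℝ) : Prop where
  field : MemLp w 2 (volume.restrict K.dom)
  div : MemLp δ 2 (volume.restrict K.dom)
  trace : MemLp g 2 ((surf d).restrict K.bdry)
  green : ∀ v : E d → ℝ, ContDiff ℝ ∞ v →
    ∫ x in K.dom, (fderiv ℝ v x (w x) + δ x * v x) = ∫ x in K.bdry, g x * v x ∂(surf d)

section Green

variable {d : ℕ} {K : Cell d} {w w' : E d → E d} {δ δ' g g' : E d → ℝ}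

lemma volume_dom_lt_top (K : Cell d) : volume K.dom < ⊤ :=
  (measure_mono K.dom_subset_carrier).trans_lt K.isCompact_carrier.measure_lt_top

instance (K : Cell d) : IsFiniteMeasure (volume.restrict K.dom) :=
  ⟨by simpa using volume_dom_lt_top K⟩

lemma isFiniteMeasure_surf (hd : 1 ≤ d) (K : Cell d) :
    IsFiniteMeasure ((surf d).restrict K.bdry) :=
  ⟨by simpa using K.surf_bdry_lt_top hd⟩

lemma memLp_dom_of_continuous {F : Type*} [NormedAddCommGroup F] (K : Cell d)
    {f : E d → F} (hf : Continuous f) (p : ENNReal) : MemLp f p (volume.restrict K.dom) :=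
  memLp_restrict_of_continuous hf K.isCompact_carrier K.isOpen_dom.measurableSet
    K.dom_subset_carrier (volume_dom_lt_top K) p

lemma memLp_bdry_of_continuous {F : Type*} [NormedAddCommGroup F] (hd : 1 ≤ d)
    (K : Cell d) {f : E d → F} (hf : Continuous f) (p : ENNReal) :
    MemLp f p ((surf d).restrict K.bdry) :=
  memLp_restrict_of_continuous hf K.isCompact_bdry K.isClosed_bdry.measurableSet
    le_rfl (K.surf_bdry_lt_top hd) p

lemma integrable_fderiv_dom {v : E d → ℝ} (hv : ContDiff ℝ ∞ v)
    (hw : MemLp w 2 (volume.restrict K.dom)) : IntegrableOn (fun x => fderiv ℝ v x (w x)) K.dom :=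
  integrable_clm_apply (memLp_dom_of_continuous K (hv.continuous_fderiv (by simp)) 2) hw

lemma integrable_mul_dom {v : E d → ℝ} (hv : Continuous v)
    (hδ : MemLp δ 2 (volume.restrict K.dom)) : IntegrableOn (fun x => δ x * v x) K.dom :=
  integrable_mul_L2 hδ (memLp_dom_of_continuous K hv 2)

lemma integrable_mul_bdry (hd : 1 ≤ d) {v : E d → ℝ} (hv : Continuous v)
    (hg : MemLp g 2 ((surf d).restrict K.bdry)) :
    IntegrableOn (fun x => g x * v x) K.bdry (surf d) :=
  integrable_mul_L2 hg (memLp_bdry_of_continuous hd K hv 2)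

namespace HasGreen

lemma isWeakDiv (h : HasGreen K w δ g) : IsWeakDiv K.dom w δ := by
  refine ⟨h.div, fun v hv hc hs => ?_⟩
  have h1 := h.green v hv
  rw [integral_add (integrable_fderiv_dom hv h.field) (integrable_mul_dom hv.continuous h.div)] at h1
  have h2 : ∫ x in K.bdry, g x * v x ∂(surf d) = 0 := by
    refine setIntegral_eq_zero_of_forall_eq_zero fun x hx => ?_
    rw [image_eq_zero_of_notMem_tsupport fun h => hx.2 (hs h), mul_zero]
  linarith

lemma memHdiv (h : HasGreen K w δ g) : MemHdiv K.dom w := ⟨h.field, δ, h.isWeakDiv⟩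

lemma wdiv_ae_eq (h : HasGreen K w δ g) : wdiv K.dom w =ᵐ[volume.restrict K.dom] δ :=
  h.isWeakDiv.wdiv_ae_eq K.isOpen_dom

lemma congr (h : HasGreen K w δ g) (hw : w =ᵐ[volume.restrict K.dom] w')
    (hδ : δ =ᵐ[volume.restrict K.dom] δ') (hg : g =ᵐ[(surf d).restrict K.bdry] g') :
    HasGreen K w' δ' g' := by
  refine ⟨h.field.ae_eq hw, h.div.ae_eq hδ, h.trace.ae_eq hg, fun v hv => ?_⟩
  rw [← integral_congr_ae (hg.mono fun x hx => by simp only [hx] :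
    (fun x => g x * v x) =ᵐ[_] fun x => g' x * v x), ← h.green v hv]
  refine integral_congr_ae ?_
  filter_upwards [hw, hδ] with x hx hx'
  rw [hx, hx']

lemma isNormalTrace (h : HasGreen K w δ g) : IsNormalTrace K w g :=
  ⟨h.memHdiv, h.trace, (h.congr (Filter.EventuallyEq.refl _ _) h.wdiv_ae_eq.symm
    (Filter.EventuallyEq.refl _ _)).green⟩

lemma hasNormalTrace (h : HasGreen K w δ g) : HasNormalTrace K w := ⟨g, h.isNormalTrace⟩

lemma div_ae_eq (h : HasGreen K w δ g) (h' : HasGreen K w δ' g') :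
    δ =ᵐ[volume.restrict K.dom] δ' := h.isWeakDiv.ae_eq K.isOpen_dom h'.isWeakDiv

/-- Both traces have the same integrals against smooth functions, because the volume terms agree by
`div_ae_eq`. The finite measure on the boundary makes the difference locally integrable, so it
vanishes almost everywhere. -/
lemma trace_ae_eq (hd : 1 ≤ d) (h : HasGreen K w δ g) (h' : HasGreen K w δ' g') :
    g =ᵐ[(surf d).restrict K.bdry] g' := by
  have := isFiniteMeasure_surf hd K
  have hloc : LocallyIntegrable (fun x => g x - g' x) ((surf d).restrict K.bdry) :=
    (h.trace.sub h'.trace).locallyIntegrable (by norm_num)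
  have := ae_eq_zero_of_integral_contDiff_smul_eq_zero hloc fun v hv _ => by
    have h3 : ∀ x, v x • (g x - g' x) = g x * v x - g' x * v x := fun x => by
      rw [smul_eq_mul]; ring
    simp_rw [h3]
    rw [integral_sub (integrable_mul_bdry hd hv.continuous h.trace)
      (integrable_mul_bdry hd hv.continuous h'.trace), ← h.green v hv, ← h'.green v hv, sub_eq_zero]
    refine integral_congr_ae ?_
    filter_upwards [h.div_ae_eq h'] with x hx
    rw [hx]
  filter_upwards [this] with x hx
  exact sub_eq_zero.1 hx

lemma zero : HasGreen K 0 0 0 := by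
  refine ⟨MemLp.zero, MemLp.zero, MemLp.zero, fun v hv => ?_⟩
  simp

lemma add (hd : 1 ≤ d) (h : HasGreen K w δ g) (h' : HasGreen K w' δ' g') :
    HasGreen K (w + w') (δ + δ') (g + g') := by
  refine ⟨h.field.add h'.field, h.div.add h'.div, h.trace.add h'.trace, fun v hv => ?_⟩
  have h1 := h.green v hv
  have h2 := h'.green v hv
  simp only [Pi.add_apply, add_mul, map_add]
  rw [integral_add (integrable_mul_bdry hd hv.continuous h.trace)
    (integrable_mul_bdry hd hv.continuous h'.trace), ← h1, ← h2, ← integral_add]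
  · congr 1; ext x; ring
  · exact (integrable_fderiv_dom hv h.field).add (integrable_mul_dom hv.continuous h.div)
  · exact (integrable_fderiv_dom hv h'.field).add (integrable_mul_dom hv.continuous h'.div)

lemma smul (c : ℝ) (h : HasGreen K w δ g) : HasGreen K (c • w) (c • δ) (c • g) := by
  refine ⟨h.field.const_smul c, h.div.const_smul c, h.trace.const_smul c, fun v hv => ?_⟩
  simp only [Pi.smul_apply, map_smul, smul_eq_mul, mul_assoc, ← mul_add]
  rw [integral_const_mul, integral_const_mul, h.green v hv]

lemma sub (hd : 1 ≤ d) (h : HasGreen K w δ g) (h' : HasGreen K w' δ' g') :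
    HasGreen K (w - w') (δ - δ') (g - g') := by
  have := h.add hd (h'.smul (-1))
  simpa only [neg_smul, one_smul, ← sub_eq_add_neg] using this

lemma sum (hd : 1 ≤ d) {κ : Type*} (s : Finset κ) {W : κ → E d → E d} {Δ G : κ → E d → ℝ}
    (h : ∀ i ∈ s, HasGreen K (W i) (Δ i) (G i)) :
    HasGreen K (∑ i ∈ s, W i) (∑ i ∈ s, Δ i) (∑ i ∈ s, G i) := by
  classical
  induction s using Finset.induction_on with
  | empty => simpa using HasGreen.zero
  | insert a s ha ih =>
    rw [Finset.sum_insert ha, Finset.sum_insert ha, Finset.sum_insert ha]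
    exact (h a (Finset.mem_insert_self _ _)).add hd
      (ih fun i hi => h i (Finset.mem_insert_of_mem hi))

lemma normalTrace_ae_eq (hd : 1 ≤ d) (h : HasGreen K w δ g) :
    normalTrace K w =ᵐ[(surf d).restrict K.bdry] g := by
  have h' : ∃ g, IsNormalTrace K w g := ⟨g, h.isNormalTrace⟩
  rw [normalTrace, dif_pos h']
  have h2 := h'.choose_spec
  refine trace_ae_eq hd (δ := wdiv K.dom w) (δ' := δ) ?_ h
  exact ⟨h2.1.1, h2.1.isWeakDiv.1, h2.2.1, h2.2.2⟩

lemma integral_trace (h : HasGreen K w δ g) :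
    ∫ x in K.bdry, g x ∂(surf d) = ∫ x in K.dom, δ x := by
  have := h.green (fun _ => 1) contDiff_const
  simpa using this.symm

end HasGreen

lemma IsNormalTrace.hasGreen (h : IsNormalTrace K w g) : HasGreen K w (wdiv K.dom w) g :=
  ⟨h.1.1, h.1.isWeakDiv.1, h.2.1, h.2.2⟩

lemma HasNormalTrace.hasGreen (h : HasNormalTrace K w) :
    HasGreen K w (wdiv K.dom w) (normalTrace K w) := by
  have h' : ∃ g, IsNormalTrace K w g := h
  rw [normalTrace, dif_pos h']
  exact h'.choose_spec.hasGreen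

lemma ae_face_of_ae_bdry (hd : 1 ≤ d) {p : E d → Prop} (h : ∀ᵐ x ∂(surf d).restrict K.bdry, p x)
    (l : K.FaceIdx) : ∀ᵐ x ∂(surf d).restrict (K.face l), p x :=
  ae_restrict_of_ae_restrict_of_subset (K.face_subset_bdry hd l) h

lemma ae_bdry_iff (hd : 1 ≤ d) {p : E d → Prop} :
    (∀ᵐ x ∂(surf d).restrict K.bdry, p x) ↔ ∀ l, ∀ᵐ x ∂(surf d).restrict (K.face l), p x := by
  rw [K.bdry_eq_iUnion_face hd, ae_restrict_iUnion_iff]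

/-! ### The Raviart–Thomas shape functions -/

/-- Green's formula for a shape function; its normal component is constant on its face. -/
lemma exists_hasGreen_rt0 (hd : 1 ≤ d) (K : Cell d) (l : K.FaceIdx) :
    ∃ c : ℝ, c * (surf d).real (K.face l) = 1 ∧
      HasGreen K (K.rt0 l) (fun _ => (volume.real K.carrier)⁻¹)
        ((K.face l).indicator fun _ => c) := by
  obtain ⟨c, hc⟩ := K.exists_rt0_divergence hd l
  have hfin := isFiniteMeasure_surf hd K
  refine ⟨c, ?_, ?_⟩
  · have h := hc (fun _ => 1) contDiff_const
    have hK := (K.volume_real_pos hd).ne'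
    simp only [fderiv_fun_const, Pi.zero_apply, zero_apply,
      mul_one, zero_add, setIntegral_const, smul_eq_mul] at h
    rw [measureReal_congr K.dom_ae_eq_carrier, mul_inv_cancel₀ hK] at h
    exact h.symm
  · have hm : MeasurableSet (K.face l) := (K.isClosed_face l).measurableSet
    refine ⟨memLp_dom_of_continuous K (K.continuous_rt0 l) 2, memLp_const _,
      (memLp_const _).indicator hm, fun v hv => ?_⟩
    rw [hc v hv]
    have : ∀ x, (K.face l).indicator (fun _ => c) x * v x
        = (K.face l).indicator (fun x => c * v x) x := by
      intro x
      by_cases hx : x ∈ K.face l <;> simp [hx]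
    simp_rw [this]
    rw [setIntegral_indicator hm, Set.inter_eq_right.2 (K.face_subset_bdry hd l),
      integral_const_mul]

/-- The constants with a Green formula form a subspace, and it contains rescaled differences of
shape functions of the same cell. For a simplex these are the edge vectors from vertex 0, for a
parallelepiped the vectors `v i` obtained from opposite faces; in both cases they span. -/
lemma hasGreen_const (hd : 1 ≤ d) (K : Cell d) (c : E d) :
    ∃ g, HasGreen K (fun _ => c) 0 g := by
  have hK := (K.volume_real_pos hd).ne'
  let S : Submodule ℝ (E d) :=
    { carrier := {c | ∃ g, HasGreen K (fun _ => c) 0 g}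
      zero_mem' := ⟨0, HasGreen.zero⟩
      add_mem' := by
        rintro a b ⟨g, hg⟩ ⟨g', hg'⟩
        refine ⟨g + g', ?_⟩
        simpa using! hg.add hd hg'
      smul_mem' := by
        rintro t a ⟨g, hg⟩
        refine ⟨t • g, ?_⟩
        simpa using! hg.smul t }
  have hdiff : ∀ (l m : K.FaceIdx) (a : E d) (t : ℝ), (∀ x, t • (K.rt0 l x - K.rt0 m x) = a) →
      a ∈ S := by
    intro l m a t h
    obtain ⟨_, -, hl⟩ := exists_hasGreen_rt0 hd K l
    obtain ⟨_, -, hm⟩ := exists_hasGreen_rt0 hd K m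
    refine ⟨_, ((hl.sub hd hm).smul t).congr ?_ ?_ (Filter.EventuallyEq.refl _ _)⟩
    · exact Filter.Eventually.of_forall fun x => h x
    · exact Filter.Eventually.of_forall fun x => by simp
  suffices S = ⊤ by
    have h : c ∈ S := this ▸ Submodule.mem_top
    exact h
  cases K with
  | simplex s =>
    have hd0 : (d : ℝ) ≠ 0 := by exact_mod_cast (by omega : d ≠ 0)
    have hspan := s.independent.vectorSpan_eq_top_of_card_eq_finrank_add_one (by simp)
    rw [eq_top_iff, ← hspan, vectorSpan_eq_span_vsub_set_right ℝ
      (Set.mem_range_self (f := s.points) 0), Submodule.span_le]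
    rintro _ ⟨_, ⟨j, rfl⟩, rfl⟩
    refine hdiff (0 : Fin (d + 1)) j _ (d * volume.real (Cell.simplex s).carrier) fun x => ?_
    rw [Cell.rt0_simplex, Cell.rt0_simplex, ← smul_sub, smul_inv_smul₀ (mul_ne_zero hd0 hK)]
    simp
  | box a v =>
    rw [eq_top_iff, ← v.span_eq, Submodule.span_le]
    rintro _ ⟨i, rfl⟩
    refine hdiff ((i, true) : Fin d × Bool) ((i, false) : Fin d × Bool) _
      (volume.real (Cell.box a v).carrier) fun x => ?_
    rw [Cell.rt0_box_true, Cell.rt0_box_false, ← sub_smul, smul_smul]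
    convert one_smul ℝ (v i) using 2
    field_simp
    ring

/-- The position field is a combination of shape functions plus a constant. It is needed as a field
of positive divergence in `Qh_eq_zero`. -/
lemma hasGreen_id (hd : 1 ≤ d) (K : Cell d) : ∃ g, HasGreen K id (fun _ => (d : ℝ)) g := by
  have hK := (K.volume_real_pos hd).ne'
  cases K with
  | simplex s =>
    have hd0 : (d : ℝ) ≠ 0 := by exact_mod_cast (by omega : d ≠ 0)
    obtain ⟨_, -, h1⟩ := exists_hasGreen_rt0 hd (Cell.simplex s) (0 : Fin (d + 1))
    obtain ⟨g, h2⟩ := hasGreen_const hd (Cell.simplex s) (s.points 0)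
    refine ⟨_, ((h1.smul (d * volume.real (Cell.simplex s).carrier)).add hd h2).congr ?_ ?_
      (Filter.EventuallyEq.refl _ _)⟩
    · refine Filter.Eventually.of_forall fun x => ?_
      simp only [Pi.add_apply, Pi.smul_apply, id]
      rw [Cell.rt0_simplex, smul_inv_smul₀ (mul_ne_zero hd0 hK), sub_add_cancel]
    · refine Filter.Eventually.of_forall fun x => ?_
      simp only [Pi.add_apply, Pi.smul_apply, smul_eq_mul, Pi.zero_apply, add_zero]
      field_simp
  | box a v =>
    have h1 := fun i : Fin d =>
      (exists_hasGreen_rt0 hd (Cell.box a v) ((i, true) : Fin d × Bool))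
    choose c hc h1 using h1
    obtain ⟨g, h2⟩ := hasGreen_const hd (Cell.box a v) a
    refine ⟨_, (((HasGreen.sum hd Finset.univ fun i _ => h1 i).smul
      (volume.real (Cell.box a v).carrier)).add hd h2).congr ?_ ?_
      (Filter.EventuallyEq.refl _ _)⟩
    · refine Filter.Eventually.of_forall fun x => ?_
      simp only [Pi.add_apply, Pi.smul_apply, id, Finset.sum_apply, Cell.rt0_box_true]
      rw [Finset.smul_sum]
      have : ∀ i, volume.real (Cell.box a v).carrier •
          (v.repr (x - a) i / volume.real (Cell.box a v).carrier) • v i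
          = v.repr (x - a) i • v i := by
        intro i
        rw [smul_smul]
        congr 1
        field_simp
      simp_rw [this]
      rw [v.sum_repr, sub_add_cancel]
    · refine Filter.Eventually.of_forall fun x => ?_
      simp only [Pi.add_apply, Pi.smul_apply, smul_eq_mul, Pi.zero_apply, add_zero,
        Finset.sum_apply]
      rw [Finset.sum_const, Finset.card_univ, Fintype.card_fin, nsmul_eq_mul]
      field_simp

end Green

/-! ### Trace and Poincaré inequalities -/

section Inequalities

variable {d : ℕ}

/-- Add the shape functions, each scaled to have normal component one on its own face. Where faces
meet, the indicators only add up. Such an outward field is what the trace inequality requires. -/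
lemma exists_hasGreen_one_le (hd : 1 ≤ d) (K : Cell d) : ∃ (W : E d → E d) (c : ℝ) (g : E d → ℝ),
    Continuous W ∧ HasGreen K W (fun _ => c) g ∧ ∀ x ∈ K.bdry, 1 ≤ g x := by
  choose c hc h using exists_hasGreen_rt0 hd K
  refine ⟨∑ l, (c l)⁻¹ • K.rt0 l, ∑ l, (c l)⁻¹ * (volume.real K.carrier)⁻¹,
    ∑ l, (c l)⁻¹ • (K.face l).indicator fun _ => c l, ?_, ?_, ?_⟩
  · have := K.continuous_rt0
    exact by
      simp only [Finset.sum_fn, Pi.smul_def]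
      fun_prop
  · have := HasGreen.sum hd Finset.univ fun l _ => (h l).smul (c l)⁻¹
    refine this.congr (Filter.EventuallyEq.refl _ _) ?_ (Filter.EventuallyEq.refl _ _)
    refine Filter.Eventually.of_forall fun x => ?_
    simp [Finset.sum_apply]
  · intro x hx
    rw [K.bdry_eq_iUnion_face hd, Set.mem_iUnion] at hx
    obtain ⟨l, hl⟩ := hx
    have hval : ∀ m, ((c m)⁻¹ • (K.face m).indicator fun _ => c m) x
        = (K.face m).indicator (fun _ => (1 : ℝ)) x := by
      intro m
      have hm : c m ≠ 0 := fun h0 => by simpa [h0] using hc m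
      by_cases hx : x ∈ K.face m <;> simp [hx, hm]
    rw [Finset.sum_apply]
    simp_rw [hval]
    calc (1 : ℝ) = (K.face l).indicator (fun _ => (1 : ℝ)) x := by simp [hl]
      _ ≤ _ := Finset.single_le_sum
        (f := fun m => (K.face m).indicator (fun _ => (1 : ℝ)) x)
        (fun m _ => Set.indicator_nonneg (fun _ _ => zero_le_one) _) (Finset.mem_univ l)

/-- The trace inequality. -/
lemma exists_trace_inequality (hd : 1 ≤ d) (K : Cell d) : ∃ C : ℝ, 0 ≤ C ∧
    ∀ v : E d → ℝ, ContDiff ℝ ∞ v → ∫ x in K.bdry, v x ^ 2 ∂(surf d)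
      ≤ C * ((∫ x in K.dom, ‖fderiv ℝ v x‖ ^ 2) + ∫ x in K.dom, v x ^ 2) := by
  obtain ⟨W, c, g, hW, hg, h1⟩ := exists_hasGreen_one_le hd K
  obtain ⟨M, hM⟩ := K.isCompact_carrier.exists_bound_of_continuousOn hW.continuousOn
  refine ⟨max 1 (M ^ 2 + |c|), le_max_of_le_left zero_le_one, fun v hv => ?_⟩
  have hv2 : ContDiff ℝ ∞ fun x => v x ^ 2 := hv.pow 2
  have hvc := hv.continuous
  have hDv : Continuous (fderiv ℝ v) := hv.continuous_fderiv (by simp)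
  have hi1 : IntegrableOn (fun x => ‖fderiv ℝ v x‖ ^ 2) K.dom :=
    memLp_one_iff_integrable.1 (memLp_dom_of_continuous K (by fun_prop) 1)
  have hi2 : IntegrableOn (fun x => v x ^ 2) K.dom :=
    memLp_one_iff_integrable.1 (memLp_dom_of_continuous K (by fun_prop) 1)
  -- Green's formula for `W`, tested with v², moves the boundary integral into the cell; the cross
  -- term 2v ∇v · W is absorbed by Young's inequality.
  calc ∫ x in K.bdry, v x ^ 2 ∂(surf d) ≤ ∫ x in K.bdry, g x * v x ^ 2 ∂(surf d) := by
        refine setIntegral_mono_on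
          (memLp_one_iff_integrable.1 (memLp_bdry_of_continuous hd K (by fun_prop) 1))
          (integrable_mul_bdry hd (by fun_prop) hg.trace) K.isClosed_bdry.measurableSet ?_
        intro x hx
        nlinarith [h1 x hx, sq_nonneg (v x)]
    _ = ∫ x in K.dom, (fderiv ℝ (fun x => v x ^ 2) x (W x) + c * v x ^ 2) := (hg.green _ hv2).symm
    _ ≤ ∫ x in K.dom, max 1 (M ^ 2 + |c|) * (‖fderiv ℝ v x‖ ^ 2 + v x ^ 2) := by
        refine setIntegral_mono_on ?_ ((hi1.add hi2).const_mul _) K.isOpen_dom.measurableSet ?_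
        · exact (integrable_fderiv_dom hv2 hg.field).add (hi2.const_mul c)
        intro x hx
        have hfd : fderiv ℝ (fun x => v x ^ 2) x (W x) = 2 * v x * fderiv ℝ v x (W x) := by
          have := ((hv.differentiable (by simp)) x).hasFDerivAt.pow 2
          rw [this.fderiv]
          simp
        rw [hfd]
        have hb : |fderiv ℝ v x (W x)| ≤ ‖fderiv ℝ v x‖ * M := by
          refine ((fderiv ℝ v x).le_opNorm (W x)).trans ?_
          exact mul_le_mul_of_nonneg_left (hM x (K.dom_subset_carrier hx)) (norm_nonneg _)
        have hab : 2 * v x * fderiv ℝ v x (W x) ≤ ‖fderiv ℝ v x‖ ^ 2 + M ^ 2 * v x ^ 2 := by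
          calc 2 * v x * fderiv ℝ v x (W x) ≤ |2 * v x * fderiv ℝ v x (W x)| := le_abs_self _
            _ = 2 * |v x| * |fderiv ℝ v x (W x)| := by rw [abs_mul, abs_mul, abs_two]
            _ ≤ 2 * |v x| * (‖fderiv ℝ v x‖ * M) :=
              mul_le_mul_of_nonneg_left hb (by positivity)
            _ ≤ _ := by
              have := sq_nonneg (‖fderiv ℝ v x‖ - M * |v x|)
              nlinarith [sq_abs (v x)]
        have hm1 : (1 : ℝ) ≤ max 1 (M ^ 2 + |c|) := le_max_left _ _
        have hm2 : M ^ 2 + |c| ≤ max 1 (M ^ 2 + |c|) := le_max_right _ _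
        have := mul_le_mul_of_nonneg_right hm1 (sq_nonneg ‖fderiv ℝ v x‖)
        have := mul_le_mul_of_nonneg_right hm2 (sq_nonneg (v x))
        have := mul_le_mul_of_nonneg_right (le_abs_self c) (sq_nonneg (v x))
        nlinarith
    _ = _ := by rw [integral_const_mul, integral_add hi1 hi2]

/-- Cauchy–Schwarz on an interval of length 1/2, from the nonnegative variance of `f`, whose mean is
twice its integral. -/
lemma sq_intervalIntegral_le {f : ℝ → ℝ} (hf : Continuous f) :
    (∫ t in (1 / 2 : ℝ)..1, f t) ^ 2 ≤ 2⁻¹ * ∫ t in (1 / 2 : ℝ)..1, f t ^ 2 := by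
  set c := ∫ t in (1 / 2 : ℝ)..1, f t with hc
  have h0 : 0 ≤ ∫ t in (1 / 2 : ℝ)..1, (f t - 2 * c) ^ 2 :=
    intervalIntegral.integral_nonneg (by norm_num) fun t _ => sq_nonneg _
  have h1 : ∀ t, (f t - 2 * c) ^ 2 = f t ^ 2 - 4 * c * f t + 4 * c ^ 2 := fun t => by ring
  simp_rw [h1] at h0
  rw [intervalIntegral.integral_add, intervalIntegral.integral_sub,
    intervalIntegral.integral_const_mul, intervalIntegral.integral_const, ← hc] at h0
  · simp only [smul_eq_mul] at h0
    nlinarith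
  all_goals exact Continuous.intervalIntegrable (by fun_prop) _ _

/-- The contraction towards `y` maps the convex set into itself and has Jacobian t^d, which is at
least 2^(-d) because t stays away from zero. -/
lemma setIntegral_dilation_le {S : Set (E d)} (hS : IsCompact S) (hc : Convex ℝ S)
    {h : E d → ℝ} (hh : Continuous h) (h0 : ∀ x, 0 ≤ h x) {y : E d} (hy : y ∈ S) {t : ℝ}
    (ht : t ∈ Set.Icc (1 / 2 : ℝ) 1) :
    ∫ x in S, h (y + t • (x - y)) ≤ 2 ^ d * ∫ x in S, h x := by
  have ht0 : 0 < t := lt_of_lt_of_le (by norm_num) ht.1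
  have hint : Integrable (S.indicator h) :=
    (hh.continuousOn.integrableOn_compact hS).integrable_indicator hS.measurableSet
  have hint' : Integrable fun x => S.indicator h (y + t • (x - y)) :=
    ((hint.comp_add_left y).comp_smul ht0.ne').comp_sub_right y
  have hnn : ∀ x, 0 ≤ S.indicator h x := fun x => Set.indicator_nonneg (fun x _ => h0 x) _
  calc ∫ x in S, h (y + t • (x - y)) = ∫ x in S, S.indicator h (y + t • (x - y)) := by
        refine setIntegral_congr_fun hS.measurableSet fun x hx => ?_
        have : y + t • (x - y) ∈ S := by
          have := hc hy hx (sub_nonneg.2 ht.2) ht0.le (by ring)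
          convert this using 1
          rw [smul_sub, sub_smul, one_smul]; abel
        simp only [Set.indicator_of_mem this]
    _ ≤ ∫ x, S.indicator h (y + t • (x - y)) :=
        setIntegral_le_integral hint' (Filter.Eventually.of_forall fun x => hnn _)
    _ = ∫ x, S.indicator h (y + t • x) :=
        integral_sub_right_eq_self (fun x => S.indicator h (y + t • x)) y
    _ = (t ^ d)⁻¹ * ∫ x in S, h x := by
        rw [Measure.integral_comp_smul volume (fun x => S.indicator h (y + x)),
          finrank_euclideanSpace_fin, integral_add_left_eq_self (S.indicator h) y,
          integral_indicator hS.measurableSet, abs_of_nonneg (by positivity), smul_eq_mul]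
    _ ≤ _ := by
        refine mul_le_mul_of_nonneg_right ?_ (integral_nonneg fun x => h0 x)
        rw [← inv_pow]
        refine pow_le_pow_left₀ (by positivity) ?_ d
        rw [inv_le_comm₀ ht0 (by norm_num)]
        linarith [ht.1]

/-- Integrate the gradient along the segment only from the midpoint to x, that is, for t between 1/2
and 1. On this half the contraction towards `y` is controlled by `setIntegral_dilation_le` after
exchanging the integrals. -/
lemma setIntegral_sq_sub_midpoint_le {S : Set (E d)} (hS : IsCompact S) (hc : Convex ℝ S) {D : ℝ}
    (hD : ∀ x ∈ S, ∀ y ∈ S, ‖x - y‖ ≤ D) {v : E d → ℝ} (hv : ContDiff ℝ ∞ v) {y : E d}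
    (hy : y ∈ S) :
    ∫ x in S, (v x - v (y + (1 / 2 : ℝ) • (x - y))) ^ 2
      ≤ D ^ 2 * 2 ^ d * ∫ x in S, ‖fderiv ℝ v x‖ ^ 2 := by
  have hvc := hv.continuous
  have hDv : Continuous (fderiv ℝ v) := hv.continuous_fderiv (by simp)
  have hpt : ∀ x ∈ S, (v x - v (y + (1 / 2 : ℝ) • (x - y))) ^ 2
      ≤ 2⁻¹ * D ^ 2 * ∫ t in (1 / 2 : ℝ)..1, ‖fderiv ℝ v (y + t • (x - y))‖ ^ 2 := by
    intro x hx
    have hder : ∀ t ∈ Set.uIcc (1 / 2 : ℝ) 1, HasDerivAt (fun t : ℝ => v (y + t • (x - y)))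
        (fderiv ℝ v (y + t • (x - y)) (x - y)) t := by
      intro t _
      have h1 : HasDerivAt (fun t : ℝ => y + t • (x - y)) (x - y) t := by
        simpa using ((hasDerivAt_id t).smul_const (x - y)).const_add y
      exact ((hv.differentiable (by simp)) _).hasFDerivAt.comp_hasDerivAt t h1
    have hftc := intervalIntegral.integral_eq_sub_of_hasDerivAt hder
      (Continuous.intervalIntegrable (by fun_prop) _ _)
    rw [one_smul, add_sub_cancel] at hftc
    rw [← hftc]
    refine (sq_intervalIntegral_le (by fun_prop)).trans ?_
    rw [mul_assoc, ← intervalIntegral.integral_const_mul (D ^ 2)]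
    refine mul_le_mul_of_nonneg_left ?_ (by norm_num)
    refine intervalIntegral.integral_mono_on (by norm_num)
      (Continuous.intervalIntegrable (by fun_prop) _ _)
      (Continuous.intervalIntegrable (by fun_prop) _ _) fun t _ => ?_
    rw [← mul_pow, ← sq_abs]
    refine pow_le_pow_left₀ (abs_nonneg _) ?_ 2
    refine ((fderiv ℝ v (y + t • (x - y))).le_opNorm (x - y)).trans ?_
    rw [mul_comm]
    exact mul_le_mul_of_nonneg_right (hD x hx y hy) (norm_nonneg _)
  have hint : Integrable (Function.uncurry fun (x : E d) (t : ℝ) =>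
      ‖fderiv ℝ v (y + t • (x - y))‖ ^ 2)
      ((volume.restrict S).prod (volume.restrict (Set.Ioc (1 / 2 : ℝ) 1))) := by
    rw [Measure.prod_restrict]
    refine IntegrableOn.mono_set (t := S ×ˢ Set.Icc (1 / 2 : ℝ) 1) ?_
      (Set.prod_mono le_rfl Set.Ioc_subset_Icc_self)
    refine ContinuousOn.integrableOn_compact (hS.prod isCompact_Icc) (Continuous.continuousOn ?_)
    unfold Function.uncurry
    fun_prop
  have hle : (1 / 2 : ℝ) ≤ 1 := by norm_num
  simp_rw [intervalIntegral.integral_of_le hle] at hpt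
  calc ∫ x in S, (v x - v (y + (1 / 2 : ℝ) • (x - y))) ^ 2
      ≤ ∫ x in S, 2⁻¹ * D ^ 2 * ∫ t in Set.Ioc (1 / 2 : ℝ) 1,
          ‖fderiv ℝ v (y + t • (x - y))‖ ^ 2 := by
        refine setIntegral_mono_on ?_ (hint.integral_prod_left.const_mul _) hS.measurableSet hpt
        exact ContinuousOn.integrableOn_compact hS (Continuous.continuousOn (by fun_prop))
    _ = 2⁻¹ * D ^ 2 * ∫ t in Set.Ioc (1 / 2 : ℝ) 1, ∫ x in S,
          ‖fderiv ℝ v (y + t • (x - y))‖ ^ 2 := by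
        rw [integral_const_mul, integral_integral_swap hint]
    _ ≤ 2⁻¹ * D ^ 2 * ∫ t in Set.Ioc (1 / 2 : ℝ) 1, 2 ^ d * ∫ x in S, ‖fderiv ℝ v x‖ ^ 2 := by
        refine mul_le_mul_of_nonneg_left ?_ (by positivity)
        refine setIntegral_mono_on hint.integral_prod_right (integrable_const _)
          measurableSet_Ioc fun t ht => ?_
        exact setIntegral_dilation_le hS hc (h := fun x => ‖fderiv ℝ v x‖ ^ 2) (by fun_prop)
          (fun x => sq_nonneg _) hy (Set.Ioc_subset_Icc_self ht)
    _ ≤ _ := by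
        have : 0 ≤ ∫ x in S, ‖fderiv ℝ v x‖ ^ 2 := integral_nonneg fun x => sq_nonneg _
        rw [setIntegral_const, smul_eq_mul, Real.volume_real_Ioc_of_le (by norm_num)]
        have h2 : 0 ≤ D ^ 2 * (2 ^ d * ∫ x in S, ‖fderiv ℝ v x‖ ^ 2) := by positivity
        nlinarith

/-- For mean zero, the double integral of (v(x) - v(y))² is 2|S| times the integral of v². Inserting
the midpoint of x and y bounds it by two half-segment terms, which are exchanged by swapping x and
y. -/
lemma poincare_convex {S : Set (E d)} (hS : IsCompact S) (hc : Convex ℝ S) {D : ℝ}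
    (hD : ∀ x ∈ S, ∀ y ∈ S, ‖x - y‖ ≤ D) {v : E d → ℝ} (hv : ContDiff ℝ ∞ v)
    (hmean : ∫ x in S, v x = 0) :
    volume.real S * ∫ x in S, v x ^ 2
      ≤ volume.real S * (2 * D ^ 2 * 2 ^ d * ∫ x in S, ‖fderiv ℝ v x‖ ^ 2) := by
  have hvc := hv.continuous
  have : IsFiniteMeasure (volume.restrict S) := ⟨by simpa using hS.measure_lt_top⟩
  have hprod : ∀ F : E d × E d → ℝ, Continuous F →
      Integrable F ((volume.restrict S).prod (volume.restrict S)) := by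
    intro F hF
    rw [Measure.prod_restrict]
    exact hF.continuousOn.integrableOn_compact (hS.prod hS)
  have hcomp : ∀ F : E d → ℝ, Continuous F → IntegrableOn F S := fun F hF =>
    hF.continuousOn.integrableOn_compact hS
  have h1 : ∫ p, (v p.1 - v p.2) ^ 2 ∂(volume.restrict S).prod (volume.restrict S)
      = 2 * (volume.real S * ∫ x in S, v x ^ 2) := by
    rw [integral_prod _ (hprod _ (by fun_prop))]
    have : ∀ x, ∫ y in S, (v x - v y) ^ 2
        = volume.real S * v x ^ 2 + ∫ y in S, v y ^ 2 := by
      intro x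
      have : ∀ y, (v x - v y) ^ 2 = v x ^ 2 - 2 * v x * v y + v y ^ 2 := fun y => by ring
      simp_rw [this]
      rw [integral_add, integral_sub, integral_const_mul, hmean, setIntegral_const]
      · simp
      all_goals exact hcomp _ (by fun_prop)
    simp_rw [this]
    rw [integral_add, integral_const_mul, setIntegral_const, smul_eq_mul]
    · ring
    all_goals exact hcomp _ (by fun_prop)
  let F : E d × E d → ℝ := fun p => (v p.1 - v (p.2 + (1 / 2 : ℝ) • (p.1 - p.2))) ^ 2
  have hF : Continuous F := by fun_prop
  have h2 : ∫ p, F p ∂(volume.restrict S).prod (volume.restrict S)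
      ≤ volume.real S * (D ^ 2 * 2 ^ d * ∫ x in S, ‖fderiv ℝ v x‖ ^ 2) := by
    rw [integral_prod_symm _ (hprod _ hF)]
    rw [← smul_eq_mul (volume.real S), ← setIntegral_const (μ := volume)]
    refine setIntegral_mono_on (hprod _ hF).integral_prod_right (integrable_const _)
      hS.measurableSet fun y hy => ?_
    exact setIntegral_sq_sub_midpoint_le hS hc hD hv hy
  have h3 : ∫ p, F p.swap ∂(volume.restrict S).prod (volume.restrict S)
      = ∫ p, F p ∂(volume.restrict S).prod (volume.restrict S) := integral_prod_swap F
  have h4 : ∫ p, (v p.1 - v p.2) ^ 2 ∂(volume.restrict S).prod (volume.restrict S)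
      ≤ ∫ p, (2 * F p + 2 * F p.swap) ∂(volume.restrict S).prod (volume.restrict S) := by
    refine integral_mono (hprod _ (by fun_prop)) (hprod _ (by fun_prop)) fun p => ?_
    have hm : p.1 + (1 / 2 : ℝ) • (p.2 - p.1) = p.2 + (1 / 2 : ℝ) • (p.1 - p.2) := by
      module
    simp only [F, Prod.fst_swap, Prod.snd_swap]
    rw [hm]
    nlinarith [sq_nonneg ((v p.1 - v (p.2 + (1 / 2 : ℝ) • (p.1 - p.2)))
      + (v p.2 - v (p.2 + (1 / 2 : ℝ) • (p.1 - p.2))))]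
  rw [integral_add (hprod _ (by fun_prop)) (hprod _ (by fun_prop)), integral_const_mul,
    integral_const_mul, h3, h1] at h4
  linarith

/-- The Poincaré inequality for functions of mean zero on a cell. -/
lemma exists_poincare_inequality (hd : 1 ≤ d) (K : Cell d) : ∃ C : ℝ, 0 ≤ C ∧
    ∀ v : E d → ℝ, ContDiff ℝ ∞ v → ∫ x in K.dom, v x = 0 →
      ∫ x in K.dom, v x ^ 2 ≤ C * ∫ x in K.dom, ‖fderiv ℝ v x‖ ^ 2 := by
  refine ⟨2 * Metric.diam K.carrier ^ 2 * 2 ^ d, by positivity, fun v hv hm => ?_⟩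
  simp_rw [setIntegral_congr_set K.dom_ae_eq_carrier] at hm ⊢
  refine le_of_mul_le_mul_left ?_ (K.volume_real_pos hd)
  refine poincare_convex K.isCompact_carrier K.convex_carrier (fun x hx y hy => ?_) hv hm
  rw [← dist_eq_norm]
  exact Metric.dist_le_diam_of_mem K.isCompact_carrier.isBounded hx hy

end Inequalities

/-! ### The coefficient -/

section Coefficient

variable {d : ℕ} {Ω S : Set (E d)} {k : E d → Matrix (Fin d) (Fin d) ℝ}

/-- Evaluate the nonnegative form at x - M⁻¹Ax. With the upper bound at Ax this gives ‖Ax‖² ≤ M⟨x,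
Ax⟩, and the upper bound at x finishes. -/
lemma norm_le_of_quadratic_bounds {H : Type*} [NormedAddCommGroup H] [InnerProductSpace ℝ H]
    {A : H →L[ℝ] H} (hA : ∀ x y, inner ℝ (A x) y = inner ℝ x (A y)) {M : ℝ} (hM : 0 < M)
    (h0 : ∀ x, 0 ≤ inner ℝ x (A x)) (h1 : ∀ x, inner ℝ x (A x) ≤ M * ‖x‖ ^ 2) (x : H) :
    ‖A x‖ ≤ M * ‖x‖ := by
  have h2 := h0 (x - M⁻¹ • A x)
  rw [map_sub, map_smul, inner_sub_left, inner_sub_right, inner_sub_right, inner_smul_left,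
    inner_smul_left, inner_smul_right, inner_smul_right, ← hA x (A x), real_inner_self_eq_norm_sq] at h2
  simp only [conj_trivial] at h2
  have h3 := h1 x
  have h4 := h1 (A x)
  refine le_of_sq_le_sq ?_ (by positivity)
  have h5 : M⁻¹ * (M⁻¹ * inner ℝ (A x) (A (A x))) ≤ M⁻¹ * ‖A x‖ ^ 2 := by
    refine mul_le_mul_of_nonneg_left ?_ (by positivity)
    rw [inv_mul_le_iff₀ hM]
    exact h4
  have h6 : M⁻¹ * ‖A x‖ ^ 2 ≤ M * ‖x‖ ^ 2 := by linarith
  rw [inv_mul_le_iff₀ hM] at h6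
  nlinarith

lemma IsCoefficient.exists_bounds (hk : IsCoefficient Ω k) : ∃ α M : ℝ, 0 < α ∧ 0 < M ∧
    ∀ x ∈ Ω, ∀ ζ : E d, α * ‖ζ‖ ^ 2 ≤ inner ℝ (Matrix.toEuclideanCLM (𝕜 := ℝ) (k x) ζ) ζ ∧
      ‖Matrix.toEuclideanCLM (𝕜 := ℝ) (k x) ζ‖ ≤ M * ‖ζ‖ := by
  obtain ⟨α, β, hα, h⟩ := hk.bounds
  -- The upper constant in `bounds` is not assumed positive; the maximum with the lower one is.
  refine ⟨α, max α β, hα, lt_max_of_lt_left hα, fun x hx ζ => ⟨?_, ?_⟩⟩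
  · rw [real_inner_comm]; exact (h x hx ζ).1
  · refine norm_le_of_quadratic_bounds ?_ (lt_max_of_lt_left hα) ?_ ?_ ζ
    · intro y z
      have hs : star (Matrix.toEuclideanCLM (𝕜 := ℝ) (k x)) = Matrix.toEuclideanCLM (𝕜 := ℝ) (k x) := by
        rw [← map_star, Matrix.star_eq_conjTranspose, Matrix.conjTranspose_eq_transpose_of_trivial,
          (hk.symm x hx).eq]
      conv_lhs => rw [← hs]
      rw [ContinuousLinearMap.star_eq_adjoint, ContinuousLinearMap.adjoint_inner_left]
    · exact fun y => le_trans (by positivity) (h x hx y).1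
    · exact fun y => (h x hx y).2.trans
        (mul_le_mul_of_nonneg_right (le_max_right _ _) (by positivity))

lemma app_add (k : E d → Matrix (Fin d) (Fin d) ℝ) (ζ ζ' : E d → E d) :
    app k (ζ + ζ') = app k ζ + app k ζ' := by
  ext1 x; exact map_add _ _ _

lemma app_smul (k : E d → Matrix (Fin d) (Fin d) ℝ) (c : ℝ) (ζ : E d → E d) :
    app k (c • ζ) = c • app k ζ := by
  ext1 x; exact map_smul (Matrix.toEuclideanCLM (𝕜 := ℝ) (k x)) c (ζ x)

lemma app_congr {μ : Measure (E d)} {ζ ζ' : E d → E d} (h : ζ =ᵐ[μ] ζ') :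
    app k ζ =ᵐ[μ] app k ζ' := h.mono fun x hx => by simp only [app, hx]

lemma IsCoefficient.aestronglyMeasurable_app (hk : IsCoefficient Ω k) (hS : S ⊆ Ω) {ζ : E d → E d}
    (hζ : AEStronglyMeasurable ζ (volume.restrict S)) :
    AEStronglyMeasurable (app k ζ) (volume.restrict S) := by
  refine AEMeasurable.aestronglyMeasurable ?_
  have h1 : ∀ i, AEMeasurable (fun x => ∑ j, k x i j * ζ x j) (volume.restrict S) := by
    intro i
    refine Finset.aemeasurable_fun_sum _ fun j _ => AEMeasurable.mul ?_ ?_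
    · exact (hk.measurable i j).mono_measure (Measure.restrict_mono hS le_rfl)
    · exact (EuclideanSpace.proj (𝕜 := ℝ) j).continuous.measurable.comp_aemeasurable hζ.aemeasurable
  have h2 : AEMeasurable (fun x i => ∑ j, k x i j * ζ x j) (volume.restrict S) :=
    aemeasurable_pi_lambda _ h1
  exact (PiLp.continuous_toLp 2 (fun _ : Fin d => ℝ)).measurable.comp_aemeasurable h2

lemma IsCoefficient.memLp_app (hk : IsCoefficient Ω k) (hS : S ⊆ Ω) (hm : MeasurableSet S)
    {ζ : E d → E d} (hζ : MemLp ζ 2 (volume.restrict S)) :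
    MemLp (app k ζ) 2 (volume.restrict S) := by
  obtain ⟨α, M, -, -, h⟩ := hk.exists_bounds
  exact hζ.of_le_mul (hk.aestronglyMeasurable_app hS hζ.1) (c := M)
    (ae_restrict_of_forall_mem hm fun x hx => (h x (hS hx) (ζ x)).2)

/-- Multiplication by the coefficient is a bounded coercive operator on `[L²(S)]^d`. -/
lemma IsCoefficient.exists_operator (hk : IsCoefficient Ω k) (hS : S ⊆ Ω) (hm : MeasurableSet S) :
    ∃ (T : L2v S →L[ℝ] L2v S) (α : ℝ), 0 < α ∧
      (∀ ζ : L2v S, T ζ =ᵐ[volume.restrict S] app k ζ) ∧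
      ∀ ζ : L2v S, α * ‖ζ‖ ^ 2 ≤ inner ℝ (T ζ) ζ := by
  obtain ⟨α, M, hα, -, h⟩ := hk.exists_bounds
  let T₀ : L2v S →ₗ[ℝ] L2v S :=
    { toFun := fun ζ => (hk.memLp_app hS hm (Lp.memLp ζ)).toLp
      map_add' := fun ζ ζ' => by
        rw [← MemLp.toLp_add, MemLp.toLp_eq_toLp_iff, ← app_add]
        exact app_congr (Lp.coeFn_add ζ ζ')
      map_smul' := fun c ζ => by
        rw [RingHom.id_apply, ← MemLp.toLp_const_smul, MemLp.toLp_eq_toLp_iff, ← app_smul]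
        exact app_congr (Lp.coeFn_smul c ζ) }
  have hT₀ : ∀ ζ : L2v S, T₀ ζ =ᵐ[volume.restrict S] app k ζ := fun ζ =>
    MemLp.coeFn_toLp (hk.memLp_app hS hm (Lp.memLp ζ))
  refine ⟨T₀.mkContinuous M fun ζ => Lp.norm_le_mul_norm_of_ae_le_mul ?_, α, hα, hT₀, fun ζ => ?_⟩
  · filter_upwards [hT₀ ζ, ae_restrict_mem hm] with x hx hxS
    rw [hx]
    exact (h x (hS hxS) (ζ x)).2
  · rw [← real_inner_self_eq_norm_sq, L2.inner_def, L2.inner_def, ← integral_const_mul]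
    refine integral_mono_ae ((integrable_inner_L2 (Lp.memLp ζ) (Lp.memLp ζ)).const_mul α)
      (integrable_inner_L2 (Lp.memLp _) (Lp.memLp ζ)) ?_
    filter_upwards [hT₀ ζ, ae_restrict_mem hm] with x hx hxS
    change _ ≤ inner ℝ (T₀ ζ x) (ζ x)
    rw [hx, real_inner_self_eq_norm_sq]
    exact (h x (hS hxS) (ζ x)).1

lemma IsCoefficient.ae_eq_zero (hk : IsCoefficient Ω k) (hS : S ⊆ Ω) (hm : MeasurableSet S)
    {ζ : E d → E d} (hζ : MemLp ζ 2 (volume.restrict S))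
    (h0 : ∫ x in S, inner ℝ (app k ζ x) (ζ x) ≤ 0) : ζ =ᵐ[volume.restrict S] 0 := by
  obtain ⟨α, M, hα, -, h⟩ := hk.exists_bounds
  have hle : ∀ᵐ x ∂volume.restrict S, α * ‖ζ x‖ ^ 2 ≤ inner ℝ (app k ζ x) (ζ x) :=
    ae_restrict_of_forall_mem hm fun x hx => (h x (hS hx) (ζ x)).1
  have hnn : 0 ≤ᵐ[volume.restrict S] fun x => inner ℝ (app k ζ x) (ζ x) :=
    hle.mono fun x hx => le_trans (by positivity) hx
  have h1 := (integral_eq_zero_iff_of_nonneg_ae hnn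
    (integrable_inner_L2 (hk.memLp_app hS hm hζ) hζ)).1
    (le_antisymm h0 (integral_nonneg_of_ae hnn))
  filter_upwards [hle, h1] with x hx hx'
  rw [hx'] at hx
  have h2 : ‖ζ x‖ ^ 2 ≤ 0 := by
    by_contra hn
    push Not at hn
    exact absurd hx (not_le.2 (mul_pos hα hn))
  simpa using le_antisymm h2 (sq_nonneg _)

end Coefficient

/-! ### The Neumann problem on a cell -/

section Neumann

/-- Solvability of a coercive problem on the closure of a space of pairs whose second component
is controlled by the first. -/
lemma exists_weak_solution {H Q : Type*} [NormedAddCommGroup H] [InnerProductSpace ℝ H]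
    [CompleteSpace H] [NormedAddCommGroup Q] [InnerProductSpace ℝ Q] [CompleteSpace Q]
    (D : Submodule ℝ (WithLp 2 (H × Q))) {C : ℝ} (hD : ∀ p ∈ D, ‖p.snd‖ ^ 2 ≤ C * ‖p.fst‖ ^ 2)
    (T : H →L[ℝ] H) {α : ℝ} (hα : 0 < α) (hT : ∀ h, α * ‖h‖ ^ 2 ≤ inner ℝ (T h) h) (F : Q) :
    ∃ u ∈ D.topologicalClosure, ∀ p ∈ D, inner ℝ (T u.fst) p.fst = inner ℝ F p.snd := by
  let W := D.topologicalClosure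
  have : CompleteSpace W := D.isClosed_topologicalClosure.completeSpace_coe
  let P1 : W →L[ℝ] H := (WithLp.fstL 2 ℝ H Q).comp W.subtypeL
  let P2 : W →L[ℝ] Q := (WithLp.sndL 2 ℝ H Q).comp W.subtypeL
  -- The bound is a closed condition and so passes to the closure. It makes the form, which sees
  -- only the first component, coercive in the full product norm, as Lax–Milgram requires.
  have hW : ∀ p ∈ W, ‖p.snd‖ ^ 2 ≤ C * ‖p.fst‖ ^ 2 := by
    have hcl : IsClosed {p : WithLp 2 (H × Q) | ‖p.snd‖ ^ 2 ≤ C * ‖p.fst‖ ^ 2} := by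
      have h1 : Continuous fun p : WithLp 2 (H × Q) => p.fst := (WithLp.fstL 2 ℝ H Q).continuous
      have h2 : Continuous fun p : WithLp 2 (H × Q) => p.snd := (WithLp.sndL 2 ℝ H Q).continuous
      exact isClosed_le (by fun_prop) (by fun_prop)
    intro p hp
    exact closure_minimal (fun p hp => hD p hp) hcl hp
  let B : W →L[ℝ] W →L[ℝ] ℝ := (innerSL ℝ).bilinearComp (T.comp P1) P1
  have hB : ∀ u w : W, B u w = inner ℝ (T (u : WithLp 2 (H × Q)).fst) (w : WithLp 2 (H × Q)).fst :=
    fun u w => rfl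
  have hco : IsCoercive B := by
    have hC : 0 < 1 + |C| := by positivity
    refine ⟨α / (1 + |C|), div_pos hα hC, fun u => ?_⟩
    rw [hB]
    refine le_trans ?_ (hT _)
    have h1 := hW u u.2
    have h2 : ‖u‖ ^ 2 = ‖(u : WithLp 2 (H × Q)).fst‖ ^ 2 + ‖(u : WithLp 2 (H × Q)).snd‖ ^ 2 :=
      WithLp.prod_norm_sq_eq_of_L2 _
    rw [mul_assoc, ← sq, div_mul_eq_mul_div, div_le_iff₀ hC, mul_assoc]
    refine mul_le_mul_of_nonneg_left ?_ hα.le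
    rw [h2]
    nlinarith [mul_le_mul_of_nonneg_right (le_abs_self C)
      (sq_nonneg ‖(u : WithLp 2 (H × Q)).fst‖)]
  let f : W := (InnerProductSpace.toDual ℝ W).symm ((innerSL ℝ F).comp P2)
  let u := hco.continuousLinearEquivOfBilin.symm f
  refine ⟨u, u.2, fun p hp => ?_⟩
  let p' : W := ⟨p, D.le_topologicalClosure hp⟩
  have h1 := hco.continuousLinearEquivOfBilin_apply u p'
  rw [ContinuousLinearEquiv.apply_symm_apply] at h1
  have h2 : inner ℝ f p' = inner ℝ F p.snd := InnerProductSpace.toDual_symm_apply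
  rw [← h2, h1]
  rfl

variable {d : ℕ}

lemma continuous_gradient {v : E d → ℝ} (hv : ContDiff ℝ ∞ v) : Continuous (gradient v) :=
  (LinearIsometryEquiv.continuous _).comp (hv.continuous_fderiv (by simp))

lemma inner_gradient (v : E d → ℝ) (x w : E d) :
    inner ℝ (gradient v x) w = fderiv ℝ v x w := InnerProductSpace.toDual_symm_apply

lemma norm_gradient (v : E d → ℝ) (x : E d) : ‖gradient v x‖ = ‖fderiv ℝ v x‖ :=
  LinearIsometryEquiv.norm_map _ _

lemma norm_toLp_sq {X F : Type*} [MeasurableSpace X] [NormedAddCommGroup F] [InnerProductSpace ℝ F]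
    {μ : Measure X} {f : X → F} (hf : MemLp f 2 μ) :
    ‖hf.toLp‖ ^ 2 = ∫ x, ‖f x‖ ^ 2 ∂μ := by
  rw [← real_inner_self_eq_norm_sq, L2.inner_def]
  refine integral_congr_ae ?_
  filter_upwards [hf.coeFn_toLp] with x hx
  rw [hx, real_inner_self_eq_norm_sq]

lemma inner_toLp_right {X F : Type*} [MeasurableSpace X] [NormedAddCommGroup F]
    [InnerProductSpace ℝ F] {μ : Measure X} {f : X → F} (hf : MemLp f 2 μ) (g : Lp F 2 μ) :
    inner ℝ g hf.toLp = ∫ x, inner ℝ (g x) (f x) ∂μ := by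
  rw [L2.inner_def]
  refine integral_congr_ae ?_
  filter_upwards [hf.coeFn_toLp] with x hx
  rw [hx]

lemma inner_toLp_toLp {X F : Type*} [MeasurableSpace X] [NormedAddCommGroup F]
    [InnerProductSpace ℝ F] {μ : Measure X} {f g : X → F} (hf : MemLp f 2 μ) (hg : MemLp g 2 μ) :
    inner ℝ hf.toLp hg.toLp = ∫ x, inner ℝ (f x) (g x) ∂μ := by
  rw [inner_toLp_right]
  refine integral_congr_ae ?_
  filter_upwards [hf.coeFn_toLp] with x hx
  rw [hx]

/-- `L²(∂K)`. -/
abbrev L2bdry (K : Cell d) := Lp ℝ 2 ((surf d).restrict K.bdry)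

/-- The space of triples of a gradient, a function and its trace. -/
abbrev TripleSpace (K : Cell d) := WithLp 2 (L2v K.dom × WithLp 2 (L2 K.dom × L2bdry K))

lemma memLp_gradient (K : Cell d) {v : E d → ℝ} (hv : ContDiff ℝ ∞ v) :
    MemLp (gradient v) 2 (volume.restrict K.dom) :=
  memLp_dom_of_continuous K (continuous_gradient hv) 2

lemma gradient_add' {v v' : E d → ℝ} (hv : ContDiff ℝ ∞ v) (hv' : ContDiff ℝ ∞ v') :
    gradient (v + v') = gradient v + gradient v' := by
  ext1 x
  simp only [gradient, Pi.add_apply]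
  rw [fderiv_add (hv.differentiable (by simp) x) (hv'.differentiable (by simp) x), map_add]

lemma gradient_smul' {v : E d → ℝ} (hv : ContDiff ℝ ∞ v) (c : ℝ) :
    gradient (c • v) = c • gradient v := by
  ext1 x
  simp only [gradient, Pi.smul_apply]
  rw [fderiv_const_smul (hv.differentiable (by simp) x), map_smul]

/-- The smooth functions whose mean value on the cell is zero. -/
def smoothMeanZero (K : Cell d) : Submodule ℝ (E d → ℝ) where
  carrier := {v | ContDiff ℝ ∞ v ∧ ∫ x in K.dom, v x = 0}
  zero_mem' := ⟨contDiff_const, by simp⟩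
  add_mem' := by
    rintro v v' ⟨hv, h0⟩ ⟨hv', h0'⟩
    refine ⟨hv.add hv', ?_⟩
    simp only [Pi.add_apply]
    rw [integral_add, h0, h0', add_zero]
    · exact memLp_one_iff_integrable.1 (memLp_dom_of_continuous K hv.continuous 1)
    · exact memLp_one_iff_integrable.1 (memLp_dom_of_continuous K hv'.continuous 1)
  smul_mem' := by
    rintro c v ⟨hv, h0⟩
    refine ⟨contDiff_const.smul hv, ?_⟩
    simp only [Pi.smul_apply]
    rw [integral_smul, h0, smul_zero]

/-- The gradient as an element of `[L²(K)]^d`. -/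
def gradMap (K : Cell d) : smoothMeanZero K →ₗ[ℝ] L2v K.dom where
  toFun v := (memLp_gradient K v.2.1).toLp
  map_add' v v' := by
    rw [← MemLp.toLp_add, MemLp.toLp_eq_toLp_iff, ← gradient_add' v.2.1 v'.2.1]
    rfl
  map_smul' c v := by
    rw [RingHom.id_apply, ← MemLp.toLp_const_smul, MemLp.toLp_eq_toLp_iff,
      ← gradient_smul' v.2.1 c]
    rfl

/-- The restriction to the cell as an element of `L²(K)`. -/
def valueMap (K : Cell d) : smoothMeanZero K →ₗ[ℝ] L2 K.dom where
  toFun v := (memLp_dom_of_continuous K v.2.1.continuous 2).toLp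
  map_add' v v' := MemLp.toLp_add (memLp_dom_of_continuous K v.2.1.continuous 2)
    (memLp_dom_of_continuous K v'.2.1.continuous 2)
  map_smul' c v := MemLp.toLp_const_smul c (memLp_dom_of_continuous K v.2.1.continuous 2)

/-- The boundary values as an element of `L²(∂K)`. -/
def boundaryMap (hd : 1 ≤ d) (K : Cell d) : smoothMeanZero K →ₗ[ℝ] L2bdry K where
  toFun v := (memLp_bdry_of_continuous hd K v.2.1.continuous 2).toLp
  map_add' v v' := MemLp.toLp_add (memLp_bdry_of_continuous hd K v.2.1.continuous 2)
    (memLp_bdry_of_continuous hd K v'.2.1.continuous 2)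
  map_smul' c v := MemLp.toLp_const_smul c (memLp_bdry_of_continuous hd K v.2.1.continuous 2)

/-- The triple of the gradient, the restriction and the boundary values of a smooth function. -/
def tripleMap (hd : 1 ≤ d) (K : Cell d) : smoothMeanZero K →ₗ[ℝ] TripleSpace K :=
  (WithLp.linearEquiv 2 ℝ _).symm.toLinearMap ∘ₗ (gradMap K).prod
    ((WithLp.linearEquiv 2 ℝ _).symm.toLinearMap ∘ₗ (valueMap K).prod (boundaryMap hd K))

lemma tripleMap_fst (hd : 1 ≤ d) (K : Cell d) (v : smoothMeanZero K) :
    (tripleMap hd K v).fst = (memLp_gradient K v.2.1).toLp := rfl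

lemma tripleMap_snd_fst (hd : 1 ≤ d) (K : Cell d) (v : smoothMeanZero K) :
    (tripleMap hd K v).snd.fst = (memLp_dom_of_continuous K v.2.1.continuous 2).toLp := rfl

lemma tripleMap_snd_snd (hd : 1 ≤ d) (K : Cell d) (v : smoothMeanZero K) :
    (tripleMap hd K v).snd.snd = (memLp_bdry_of_continuous hd K v.2.1.continuous 2).toLp := rfl

/-- The Poincaré inequality bounds the values by the gradient, and the trace inequality then bounds
the boundary values. This is the hypothesis of `exists_weak_solution`. -/
lemma exists_tripleMap_bound (hd : 1 ≤ d) (K : Cell d) : ∃ C : ℝ,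
    ∀ p ∈ (tripleMap hd K).range, ‖p.snd‖ ^ 2 ≤ C * ‖p.fst‖ ^ 2 := by
  obtain ⟨C1, hC1, h1⟩ := exists_trace_inequality hd K
  obtain ⟨C2, hC2, h2⟩ := exists_poincare_inequality hd K
  refine ⟨C2 + C1 * (1 + C2), ?_⟩
  rintro _ ⟨⟨v, hv, h0⟩, rfl⟩
  rw [WithLp.prod_norm_sq_eq_of_L2]
  simp only [tripleMap_fst, tripleMap_snd_fst, tripleMap_snd_snd, norm_toLp_sq, norm_gradient, Real.norm_eq_abs, sq_abs]
  have h3 := h1 v hv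
  have h4 := h2 v hv h0
  have := mul_le_mul_of_nonneg_left h4 hC1
  nlinarith

/-- Solvability of the Neumann problem `-div (k η) = δ`, `η = ∇φ`, `-k η · n = g`. -/
lemma exists_neumann (hd : 1 ≤ d) {Ω : Set (E d)} {k : E d → Matrix (Fin d) (Fin d) ℝ}
    (hk : IsCoefficient Ω k) {K : Cell d} (hK : K.dom ⊆ Ω) {δ g : E d → ℝ}
    (hδ : MemLp δ 2 (volume.restrict K.dom)) (hg : MemLp g 2 ((surf d).restrict K.bdry))
    (hc : ∫ x in K.bdry, g x ∂(surf d) = ∫ x in K.dom, δ x) :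
    ∃ (η : E d → E d) (φ : E d → ℝ), MemLp η 2 (volume.restrict K.dom) ∧
      MemLp φ 2 (volume.restrict K.dom) ∧ HasGreen K (-app k η) δ g ∧
      ∀ τ : E d → E d, MemHdiv0 K τ →
        (∫ x in K.dom, inner ℝ (η x) (τ x)) + ∫ x in K.dom, φ x * wdiv K.dom τ x = 0 := by
  have hm := K.isOpen_dom.measurableSet
  obtain ⟨T, α, hα, hT, hTco⟩ := hk.exists_operator hK hm
  obtain ⟨C, hC⟩ := exists_tripleMap_bound hd K
  -- The source encodes the weak form (kη, ∇v) = (δ, v) - ⟨g, v⟩; the minus sign makes `g` the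
  -- normal component of -kη.
  obtain ⟨u, hu, hsol⟩ := exists_weak_solution (tripleMap hd K).range hC T hα hTco
    (WithLp.toLp 2 (hδ.toLp, -hg.toLp))
  refine ⟨u.fst, u.snd.fst, Lp.memLp _, Lp.memLp _, ?_, ?_⟩
  · have hη : MemLp (app k u.fst) 2 (volume.restrict K.dom) := hk.memLp_app hK hm (Lp.memLp _)
    refine ⟨hη.neg, hδ, hg, fun v hv => ?_⟩
    have hfin := isFiniteMeasure_surf hd K
    -- The weak equation is known only for mean-zero test functions. Subtracting the mean costs
    -- nothing because the compatibility condition `hc` cancels the two constant terms.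
    let m : ℝ := (volume.real K.dom)⁻¹ * ∫ x in K.dom, v x
    have hvol : volume.real K.dom ≠ 0 := by
      rw [measureReal_congr K.dom_ae_eq_carrier]
      exact (K.volume_real_pos hd).ne'
    have hvm : ContDiff ℝ ∞ fun x => v x - m := hv.sub contDiff_const
    have hvi : IntegrableOn v K.dom :=
      memLp_one_iff_integrable.1 (memLp_dom_of_continuous K hv.continuous 1)
    have hmean : ∫ x in K.dom, (v x - m) = 0 := by
      rw [integral_sub hvi (integrable_const _), setIntegral_const, smul_eq_mul]
      simp only [m]
      rw [mul_inv_cancel_left₀ hvol, sub_self]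
    have h1 := hsol _ ⟨⟨_, hvm, hmean⟩, rfl⟩
    rw [WithLp.prod_inner_apply] at h1
    change inner ℝ (T u.fst) (memLp_gradient K hvm).toLp
      = inner ℝ hδ.toLp (memLp_dom_of_continuous K hvm.continuous 2).toLp
        + inner ℝ (-hg.toLp) (memLp_bdry_of_continuous hd K hvm.continuous 2).toLp at h1
    rw [inner_neg_left, inner_toLp_toLp, inner_toLp_toLp, inner_toLp_right] at h1
    have hgrad : (gradient fun x => v x - m) = gradient v := by
      ext1 x
      simp only [gradient]
      rw [fderiv_sub_const]
    have h2 : ∫ x in K.dom, inner ℝ (T u.fst x) (gradient (fun x => v x - m) x)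
        = ∫ x in K.dom, fderiv ℝ v x (app k u.fst x) := by
      refine integral_congr_ae ?_
      filter_upwards [hT u.fst] with x hx
      rw [hx, hgrad, real_inner_comm, inner_gradient]
    have hmul : ∀ a b : ℝ, inner ℝ a b = a * b := fun a b => by
      simp [mul_comm]
    simp_rw [h2, hmul, mul_sub] at h1
    rw [integral_sub (integrable_mul_dom hv.continuous hδ) ((hδ.integrable (by norm_num)).mul_const m),
      integral_sub (integrable_mul_bdry hd hv.continuous hg) ((hg.integrable (by norm_num)).mul_const m),
      integral_mul_const, integral_mul_const, hc] at h1
    rw [integral_add (integrable_fderiv_dom hv hη.neg) (integrable_mul_dom hv.continuous hδ)]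
    simp only [Pi.neg_apply, map_neg]
    rw [integral_neg]
    linarith
  · intro τ hτ
    have hG := hτ.hasGreen
    -- The gradient equation is the vanishing of a continuous functional. It holds on smooth triples
    -- by Green's formula, since `τ` has no normal component, and extends to the closure containing
    -- the solution.
    let L : TripleSpace K →L[ℝ] ℝ :=
      (innerSL ℝ hG.field.toLp).comp (WithLp.fstL 2 ℝ _ _) +
      (innerSL ℝ hG.div.toLp).comp ((WithLp.fstL 2 ℝ _ _).comp (WithLp.sndL 2 ℝ _ _))
    have hL : ∀ p : TripleSpace K, L p = (∫ x in K.dom, inner ℝ (p.fst x) (τ x))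
        + ∫ x in K.dom, p.snd.fst x * wdiv K.dom τ x := by
      intro p
      have h1 : L p = inner ℝ hG.field.toLp p.fst + inner ℝ hG.div.toLp p.snd.fst := rfl
      rw [h1, real_inner_comm, inner_toLp_right, real_inner_comm, inner_toLp_right]
      simp [mul_comm]
    have hker : (tripleMap hd K).range ≤ LinearMap.ker (L : TripleSpace K →ₗ[ℝ] ℝ) := by
      rintro _ ⟨⟨v, hv, h0⟩, rfl⟩
      rw [LinearMap.mem_ker]
      change inner ℝ hG.field.toLp (memLp_gradient K hv).toLp
        + inner ℝ hG.div.toLp (memLp_dom_of_continuous K hv.continuous 2).toLp = 0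
      rw [inner_toLp_toLp, inner_toLp_toLp]
      have h1 := hG.green v hv
      rw [integral_add (integrable_fderiv_dom hv hG.field)
        (integrable_mul_dom hv.continuous hG.div)] at h1
      simp only [Pi.zero_apply, zero_mul, integral_zero] at h1
      rw [← h1]
      congr 1
      · congr 1; ext x; rw [real_inner_comm, inner_gradient]
      · congr 1; ext x; simp [mul_comm]
    have := Submodule.topologicalClosure_minimal _ hker L.isClosed_ker hu
    rw [← hL]
    exact this

end Neumann

/-! ### The multiscale basis on a cell -/

section Basis

variable {d : ℕ} {K : Cell d}

/-- The faces of a cell meet in sets of zero surface measure. -/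
def FacesAEDisjoint (K : Cell d) : Prop :=
  ∀ l l' : K.FaceIdx, l ≠ l' → surf d (K.face l ∩ K.face l') = 0

lemma ae_notMem_face (hF : FacesAEDisjoint K) {l l' : K.FaceIdx} (h : l ≠ l') :
    ∀ᵐ x ∂(surf d).restrict (K.face l'), x ∉ K.face l := by
  rw [ae_iff, Measure.restrict_apply₀']
  · simpa using hF l l' h
  · exact (K.isClosed_face l').measurableSet.nullMeasurableSet

lemma normalTrace_rt0_of_ne (hd : 1 ≤ d) (hF : FacesAEDisjoint K) {l l' : K.FaceIdx}
    (h : l ≠ l') : normalTrace K (K.rt0 l) =ᵐ[(surf d).restrict (K.face l')] 0 := by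
  obtain ⟨c, -, hg⟩ := exists_hasGreen_rt0 hd K l
  filter_upwards [ae_face_of_ae_bdry hd (hg.normalTrace_ae_eq hd) l', ae_notMem_face hF h]
    with x hx hx'
  rw [hx, Set.indicator_of_notMem hx']
  rfl

lemma integral_normalTrace_rt0_of_ne (hd : 1 ≤ d) (hF : FacesAEDisjoint K) {l l' : K.FaceIdx}
    (h : l ≠ l') : ∫ x in K.face l', normalTrace K (K.rt0 l) x ∂(surf d) = 0 :=
  integral_eq_zero_of_ae (normalTrace_rt0_of_ne hd hF h)

lemma integral_normalTrace_rt0_self (hd : 1 ≤ d) (l : K.FaceIdx) :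
    ∫ x in K.face l, normalTrace K (K.rt0 l) x ∂(surf d) = 1 := by
  obtain ⟨c, hc, hg⟩ := exists_hasGreen_rt0 hd K l
  rw [integral_congr_ae (ae_face_of_ae_bdry hd (hg.normalTrace_ae_eq hd) l),
    setIntegral_indicator (K.isClosed_face l).measurableSet, Set.inter_self, setIntegral_const,
    smul_eq_mul, mul_comm, hc]

/-- The flux through one face, with unit mean, that is proportional to the flux of `V`. -/
def faceFlux (K : Cell d) (V : E d → E d) (l : K.FaceIdx) : E d → ℝ :=
  (K.face l).indicator fun x =>
    (∫ y in K.face l, normalTrace K V y ∂(surf d))⁻¹ * normalTrace K V x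

variable {V : E d → E d}

lemma memLp_faceFlux (hV : HasNormalTrace K V) (l : K.FaceIdx) :
    MemLp (faceFlux K V l) 2 ((surf d).restrict K.bdry) :=
  (hV.hasGreen.trace.const_mul _).indicator (K.isClosed_face l).measurableSet

lemma integral_faceFlux (hd : 1 ≤ d) (l : K.FaceIdx)
    (h0 : ∫ y in K.face l, normalTrace K V y ∂(surf d) ≠ 0) :
    ∫ x in K.bdry, faceFlux K V l x ∂(surf d) = 1 := by
  rw [faceFlux, setIntegral_indicator (K.isClosed_face l).measurableSet,
    Set.inter_eq_right.2 (K.face_subset_bdry hd l), integral_const_mul, inv_mul_cancel₀ h0]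

/-- A shape function has total flux one through its own face and zero through the others, so the
prescribed boundary data reduce to the normalised flux of `V` on a single face. -/
lemma faceFlux_ae_eq (hd : 1 ≤ d) (hF : FacesAEDisjoint K) (l l' : K.FaceIdx) :
    faceFlux K V l =ᵐ[(surf d).restrict (K.face l')] fun x =>
      ((∫ y in K.face l', normalTrace K (K.rt0 l) y ∂(surf d)) /
        (∫ y in K.face l', normalTrace K V y ∂(surf d))) * normalTrace K V x := by
  by_cases h : l = l'
  · subst h
    filter_upwards [ae_restrict_mem (K.isClosed_face l).measurableSet] with x hx
    rw [faceFlux, Set.indicator_of_mem hx, integral_normalTrace_rt0_self hd, one_div]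
  · filter_upwards [ae_notMem_face hF h] with x hx
    rw [faceFlux, Set.indicator_of_notMem hx, integral_normalTrace_rt0_of_ne hd hF h]
    simp

variable {Ω : Set (E d)} {k : E d → Matrix (Fin d) (Fin d) ℝ}

/-- Existence of the multiscale basis functions. -/
lemma exists_isMsBasis (hd : 1 ≤ d) (hk : IsCoefficient Ω k) (hK : K.dom ⊆ Ω)
    (hF : FacesAEDisjoint K) (hV : HasNormalTrace K V) (l : K.FaceIdx)
    (h0 : ∫ y in K.face l, normalTrace K V y ∂(surf d) ≠ 0) :
    ∃ η ψ φ, IsMsBasis k K (K.rt0 l) V η ψ φ := by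
  obtain ⟨c, -, hrt⟩ := exists_hasGreen_rt0 hd K l
  have hm := K.isOpen_dom.measurableSet
  have hvol : volume.real K.dom * (volume.real K.carrier)⁻¹ = 1 := by
    rw [measureReal_congr K.dom_ae_eq_carrier, mul_inv_cancel₀ (K.volume_real_pos hd).ne']
  -- The data are compatible: the normalised face flux and the constant divergence 1/|K| both have
  -- integral one.
  obtain ⟨η, φ, hη, hφ, hG, hgrad⟩ := exists_neumann hd hk hK
    (δ := fun _ => (volume.real K.carrier)⁻¹) (g := faceFlux K V l) (memLp_const _)
    (memLp_faceFlux hV l) (by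
      rw [integral_faceFlux hd l h0, setIntegral_const, smul_eq_mul, hvol])
  refine ⟨η, -app k η, φ, hη, hG.memHdiv, hφ, fun ξ hξ => ?_, hgrad, fun q hq => ?_,
    hG.hasNormalTrace, fun l' => ?_⟩
  · simp only [Pi.neg_apply, inner_neg_left]
    rw [integral_neg, add_neg_cancel]
  · refine integral_congr_ae ?_
    filter_upwards [hG.wdiv_ae_eq, hrt.wdiv_ae_eq] with x hx hx'
    rw [hx, hx']
  · have hb : normalTrace K (-app k η) =ᵐ[(surf d).restrict (K.face l')] faceFlux K V l :=
      ae_face_of_ae_bdry hd (hG.normalTrace_ae_eq hd) l'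
    exact hb.trans (faceFlux_ae_eq hd hF l l')

variable {η η' ψ ψ' : E d → E d} {φ φ' : E d → ℝ} {l : K.FaceIdx}

/-- Testing the divergence equation with the difference of the two divergences shows that they
agree. Divergence and flux thus depend only on the face and on `V`, not on the chosen solution. -/
lemma IsMsBasis.hasGreen (hd : 1 ≤ d) (hF : FacesAEDisjoint K)
    (h : IsMsBasis k K (K.rt0 l) V η ψ φ) :
    HasGreen K ψ (fun _ => (volume.real K.carrier)⁻¹) (faceFlux K V l) := by
  obtain ⟨c, -, hrt⟩ := exists_hasGreen_rt0 hd K l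
  refine h.trace.hasGreen.congr (Filter.EventuallyEq.refl _ _) ?_ ?_
  · have hL : MemLp (fun x => wdiv K.dom ψ x - wdiv K.dom (K.rt0 l) x) 2
        (volume.restrict K.dom) :=
      h.psi_mem.isWeakDiv.1.sub hrt.memHdiv.isWeakDiv.1
    have h1 := h.divergence _ hL
    rw [← sub_eq_zero, ← integral_sub (integrable_mul_L2 h.psi_mem.isWeakDiv.1 hL)
      (integrable_mul_L2 hrt.memHdiv.isWeakDiv.1 hL)] at h1
    simp_rw [← sub_mul] at h1
    have h2 := (integral_eq_zero_iff_of_nonneg (fun x => mul_self_nonneg _)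
      (integrable_mul_L2 hL hL)).1 h1
    filter_upwards [h2, hrt.wdiv_ae_eq] with x hx hx'
    rw [← hx']
    exact sub_eq_zero.1 (mul_self_eq_zero.1 hx)
  · exact (ae_bdry_iff hd).2 fun l' => (h.boundary l').trans (faceFlux_ae_eq hd hF l l').symm

/-- The flux equation holds against every square-integrable field, in particular against kη + ψ.
This identity later makes multiplication by k surjective from X₁ to the velocities. -/
lemma IsMsBasis.psi_ae_eq {χ : E d → E d} (hk : IsCoefficient Ω k) (hK : K.dom ⊆ Ω)
    (h : IsMsBasis k K χ V η ψ φ) : ψ =ᵐ[volume.restrict K.dom] -app k η := by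
  have hη := hk.memLp_app hK K.isOpen_dom.measurableSet h.eta_mem
  have hL : MemLp (fun x => app k η x + ψ x) 2 (volume.restrict K.dom) := hη.add h.psi_mem.1
  have h1 := h.flux _ hL
  rw [← integral_add (integrable_inner_L2 hη hL) (integrable_inner_L2 h.psi_mem.1 hL)] at h1
  simp_rw [← inner_add_left] at h1
  have h2 := (integral_eq_zero_iff_of_nonneg (fun x => real_inner_self_nonneg)
    (integrable_inner_L2 hL hL)).1 h1
  filter_upwards [h2] with x hx
  have := inner_self_eq_zero.1 hx
  rw [Pi.neg_apply]
  exact eq_neg_of_add_eq_zero_right this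

/-- The difference of the two fluxes has zero divergence and zero normal component, so it is
admissible in both gradient equations; coercivity does the rest. The spans range over all solutions
as functions, and only this uniqueness makes them finite-dimensional modulo null sets. -/
lemma IsMsBasis.eta_ae_eq (hd : 1 ≤ d) (hk : IsCoefficient Ω k) (hK : K.dom ⊆ Ω)
    (hF : FacesAEDisjoint K) (h : IsMsBasis k K (K.rt0 l) V η ψ φ)
    (h' : IsMsBasis k K (K.rt0 l) V η' ψ' φ') : η =ᵐ[volume.restrict K.dom] η' := by
  have hG : HasGreen K (ψ - ψ') 0 0 := by
    refine ((h.hasGreen hd hF).sub hd (h'.hasGreen hd hF)).congr (Filter.EventuallyEq.refl _ _)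
      ?_ ?_ <;> exact Filter.Eventually.of_forall fun x => by simp
  have h0 : ∀ φ : E d → ℝ, ∫ x in K.dom, φ x * wdiv K.dom (ψ - ψ') x = 0 := by
    intro φ
    refine integral_eq_zero_of_ae ?_
    filter_upwards [hG.wdiv_ae_eq] with x hx
    rw [hx]; simp
  have h1 := h.gradient _ hG.isNormalTrace
  have h2 := h'.gradient _ hG.isNormalTrace
  rw [h0, add_zero] at h1 h2
  have hL := h.eta_mem.sub h'.eta_mem
  have hle : ∫ x in K.dom, inner ℝ (app k (η - η') x) ((η - η') x) ≤ 0 := by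
    have h3 : ∫ x in K.dom, inner ℝ (app k (η - η') x) ((η - η') x)
        = -((∫ x in K.dom, inner ℝ (η x) ((ψ - ψ') x))
          - ∫ x in K.dom, inner ℝ (η' x) ((ψ - ψ') x)) := by
      rw [← integral_sub (integrable_inner_L2 h.eta_mem hG.field)
        (integrable_inner_L2 h'.eta_mem hG.field), ← integral_neg]
      refine integral_congr_ae ?_
      filter_upwards [h.psi_ae_eq hk hK, h'.psi_ae_eq hk hK] with x hx hx'
      have h4 : app k (η - η') x = app k η x - app k η' x := map_sub _ _ _
      rw [h4, Pi.sub_apply, Pi.sub_apply, hx, hx', Pi.neg_apply, Pi.neg_apply, ← inner_sub_left,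
        real_inner_comm, ← inner_neg_right]
      congr 1
      abel
    rw [h3, h1, h2]; simp
  filter_upwards [hk.ae_eq_zero hK K.isOpen_dom.measurableSet hL hle] with x hx
  exact sub_eq_zero.1 hx

lemma IsMsBasis.psi_ae_unique (hd : 1 ≤ d) (hk : IsCoefficient Ω k) (hK : K.dom ⊆ Ω)
    (hF : FacesAEDisjoint K) (h : IsMsBasis k K (K.rt0 l) V η ψ φ)
    (h' : IsMsBasis k K (K.rt0 l) V η' ψ' φ') : ψ =ᵐ[volume.restrict K.dom] ψ' := by
  filter_upwards [h.psi_ae_eq hk hK, h'.psi_ae_eq hk hK,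
    app_congr (k := k) (h.eta_ae_eq hd hk hK hF h')] with x h1 h2 h3
  rw [h1, h2, Pi.neg_apply, Pi.neg_apply, h3]

variable {N : ℕ} {U : Fin N → E d → E d}

lemma memLp_of_mem_etaSpan {s : E d → E d} (hs : s ∈ etaSpan k U K) :
    MemLp s 2 (volume.restrict K.dom) := by
  refine Submodule.span_induction ?_ MemLp.zero (fun _ _ _ _ h h' => h.add h')
    (fun c _ _ h => h.const_smul c) hs
  rintro η ⟨i, l, ψ, φ, h⟩
  exact h.eta_mem

/-- The flux of a potential gradient in the span is in the span of the multiscale fluxes. -/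
lemma exists_psiSpan_of_etaSpan (hk : IsCoefficient Ω k) (hK : K.dom ⊆ Ω) {s : E d → E d}
    (hs : s ∈ etaSpan k U K) :
    ∃ t ∈ psiSpan k U K, t =ᵐ[volume.restrict K.dom] -app k s := by
  refine Submodule.span_induction ?_ ?_ ?_ ?_ hs
  · rintro η ⟨i, l, ψ, φ, h⟩
    exact ⟨ψ, Submodule.subset_span ⟨i, l, η, φ, h⟩, h.psi_ae_eq hk hK⟩
  · refine ⟨0, zero_mem _, Filter.Eventually.of_forall fun x => ?_⟩
    simp [app]
  · rintro s s' - - ⟨t, ht, h⟩ ⟨t', ht', h'⟩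
    refine ⟨t + t', add_mem ht ht', ?_⟩
    rw [app_add, neg_add]
    exact h.add h'
  · rintro c s - ⟨t, ht, h⟩
    refine ⟨c • t, Submodule.smul_mem _ c ht, ?_⟩
    rw [app_smul, ← smul_neg]
    exact h.const_smul c

lemma exists_etaSpan_of_psiSpan (hk : IsCoefficient Ω k) (hK : K.dom ⊆ Ω) {t : E d → E d}
    (ht : t ∈ psiSpan k U K) :
    ∃ s ∈ etaSpan k U K, t =ᵐ[volume.restrict K.dom] -app k s := by
  refine Submodule.span_induction ?_ ?_ ?_ ?_ ht
  · rintro ψ ⟨i, l, η, φ, h⟩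
    exact ⟨η, Submodule.subset_span ⟨i, l, ψ, φ, h⟩, h.psi_ae_eq hk hK⟩
  · refine ⟨0, zero_mem _, Filter.Eventually.of_forall fun x => ?_⟩
    simp [app]
  · rintro t t' - - ⟨s, hs, h⟩ ⟨s', hs', h'⟩
    refine ⟨s + s', add_mem hs hs', ?_⟩
    rw [app_add, neg_add]
    exact h.add h'
  · rintro c t - ⟨s, hs, h⟩
    refine ⟨c • s, Submodule.smul_mem _ c hs, ?_⟩
    rw [app_smul, ← smul_neg]
    exact h.const_smul c

/-- A field in the span of the multiscale fluxes is almost everywhere a combination of a fixed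
basis. -/
lemma exists_coeff_of_psiSpan (hd : 1 ≤ d) (hk : IsCoefficient Ω k) (hK : K.dom ⊆ Ω)
    (hF : FacesAEDisjoint K) {Ψ : Fin N × K.FaceIdx → E d → E d}
    (hΨ : ∀ p, ∃ η φ, IsMsBasis k K (K.rt0 p.2) (U p.1) η (Ψ p) φ) {t : E d → E d}
    (ht : t ∈ psiSpan k U K) :
    ∃ c : Fin N × K.FaceIdx → ℝ, t =ᵐ[volume.restrict K.dom] ∑ p, c p • Ψ p := by
  classical
  refine Submodule.span_induction ?_ ?_ ?_ ?_ ht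
  · rintro ψ ⟨i, l, η, φ, h⟩
    obtain ⟨η', φ', h'⟩ := hΨ (i, l)
    refine ⟨Pi.single (i, l) 1, ?_⟩
    have : ∑ p, (Pi.single (i, l) (1 : ℝ) : Fin N × K.FaceIdx → ℝ) p • Ψ p = Ψ (i, l) := by
      rw [Finset.sum_eq_single (i, l)]
      · simp
      · intro b _ hb
        rw [Pi.single_eq_of_ne hb, zero_smul]
      · simp
    rw [this]
    exact h.psi_ae_unique hd hk hK hF h'
  · exact ⟨0, by simp⟩
  · rintro t t' - - ⟨c, h⟩ ⟨c', h'⟩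
    refine ⟨c + c', ?_⟩
    simp only [Pi.add_apply, add_smul, Finset.sum_add_distrib]
    exact h.add h'
  · rintro a t - ⟨c, h⟩
    refine ⟨a • c, ?_⟩
    simp only [Pi.smul_apply, smul_assoc, ← Finset.smul_sum]
    exact h.const_smul a

end Basis

/-! ### Geometry of the mesh -/

section Mesh

variable {d : ℕ} {ι : Type*} {Ω : Set (E d)} {cell : ι → Cell d}

lemma IsMesh.carrier_subset (hmesh : IsMesh Ω cell) (K : ι) : (cell K).carrier ⊆ closure Ω := by
  rw [← hmesh.cover]; exact Set.subset_iUnion (fun K => (cell K).carrier) K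

lemma IsMesh.dom_subset (hΩ : interior (closure Ω) = Ω) (hmesh : IsMesh Ω cell) (K : ι) :
    (cell K).dom ⊆ Ω := by
  rw [← hΩ]
  exact interior_mono (hmesh.carrier_subset K)

lemma isOpen_of_interior_closure (hΩ : interior (closure Ω) = Ω) : IsOpen Ω := by
  rw [← hΩ]; exact isOpen_interior

lemma IsMesh.facesAEDisjoint (hd : 1 ≤ d) (hmesh : IsMesh Ω cell) (K : ι) :
    FacesAEDisjoint (cell K) := fun l l' h =>
  (hmesh.faceToFace K K l l').resolve_left fun h' => h ((cell K).face_injective hd h')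

/-- The cell `K'` has the set `F` as one of its faces. -/
def HasFace (K : Cell d) (F : Set (E d)) : Prop := ∃ l, K.face l = F

lemma hasFace_face (K : Cell d) (l : K.FaceIdx) : HasFace K (K.face l) := ⟨l, rfl⟩

lemma HasFace.subset_bdry (hd : 1 ≤ d) {K : Cell d} {F : Set (E d)} (h : HasFace K F) :
    F ⊆ K.bdry := by
  obtain ⟨l, rfl⟩ := h
  exact K.face_subset_bdry hd l

lemma IsMesh.surf_face_inter_bdry (hd : 1 ≤ d) (hmesh : IsMesh Ω cell) (K : ι)
    (l : (cell K).FaceIdx) (K' : ι) (h : ¬ HasFace (cell K') ((cell K).face l)) :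
    surf d ((cell K).face l ∩ (cell K').bdry) = 0 := by
  rw [(cell K').bdry_eq_iUnion_face hd, Set.inter_iUnion, measure_iUnion_null_iff]
  exact fun l' => (hmesh.faceToFace K K' l l').resolve_left fun h' => h ⟨l', h'.symm⟩

/-- Almost every point of a face is in its relative interior. -/
lemma ae_bary_pos (hF : ∀ K, FacesAEDisjoint (cell K)) (K : ι) (l : (cell K).FaceIdx) :
    ∀ᵐ x ∂(surf d).restrict ((cell K).face l), ∀ m, m ≠ l → 0 < (cell K).bary m x := by
  have h1 : ∀ᵐ x ∂(surf d).restrict ((cell K).face l), ∀ m, m ≠ l → x ∉ (cell K).face m := by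
    rw [ae_all_iff]
    intro m
    by_cases hm : m = l
    · exact Filter.Eventually.of_forall fun x h => absurd hm h
    · filter_upwards [ae_notMem_face (hF K) hm] with x hx _ using hx
  filter_upwards [h1, ae_restrict_mem ((cell K).isClosed_face l).measurableSet] with x hx hxl m hm
  have hc := (cell K).face_subset_carrier l hxl
  refine lt_of_le_of_ne (((cell K).mem_carrier_iff x).1 hc m) fun h => ?_
  exact hx m hm (((cell K).mem_face_iff m x).2 ⟨hc, h.symm⟩)

lemma disjoint_dom_carrier (hd : 1 ≤ d) (hmesh : IsMesh Ω cell) {K K' : ι} (h : K ≠ K') :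
    Disjoint (cell K).dom (cell K').carrier := by
  rw [← (cell K').closure_dom hd]
  exact (hmesh.disjoint h).closure_right (cell K).isOpen_dom

/-- Two cells with disjoint interiors fill a neighbourhood of a point in the relative interior of
a face of both. -/
lemma union_carrier_mem_nhds (hd : 1 ≤ d) {K K' : Cell d} (hdisj : Disjoint K.dom K'.dom)
    {l : K.FaceIdx} {l' : K'.FaceIdx} {x : E d} (hx : K.bary l x = 0)
    (hx1 : ∀ m, m ≠ l → 0 < K.bary m x) (hx' : K'.bary l' x = 0)
    (hx1' : ∀ m, m ≠ l' → 0 < K'.bary m x) : K.carrier ∪ K'.carrier ∈ nhds x := by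
  have h1 : ∀ᶠ y in nhds x, ∀ m, m ≠ l → 0 < K.bary m y := by
    rw [Filter.eventually_all]
    intro m
    by_cases hm : m = l
    · exact Filter.Eventually.of_forall fun x h => absurd hm h
    · filter_upwards [(K.continuous_bary m).continuousAt.eventually (lt_mem_nhds (hx1 m hm))]
        with y hy _ using hy
  have h2 : ∀ᶠ y in nhds x, ∀ m, m ≠ l' → 0 < K'.bary m y := by
    rw [Filter.eventually_all]
    intro m
    by_cases hm : m = l'
    · exact Filter.Eventually.of_forall fun x h => absurd hm h
    · filter_upwards [(K'.continuous_bary m).continuousAt.eventually (lt_mem_nhds (hx1' m hm))]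
        with y hy _ using hy
  -- Reflection through x changes the sign of the face functions vanishing at x. A nearby point y
  -- outside both cells violates only those two inequalities, so its reflection would lie in both
  -- open cells, which are disjoint.
  have hr : Filter.Tendsto (fun y : E d => (2 : ℝ) • x - y) (nhds x) (nhds x) := by
    have hc : Continuous fun y : E d => (2 : ℝ) • x - y := by fun_prop
    have h := hc.tendsto x
    have e : (2 : ℝ) • x - x = x := by module
    simpa only [e] using h
  filter_upwards [h1, h2, hr.eventually h1, hr.eventually h2] with y a1 a2 a3 a4
  by_contra hn
  rw [Set.mem_union, not_or, K.mem_carrier_iff, K'.mem_carrier_iff] at hn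
  have hrefl : ∀ (M : Cell d) (m : M.FaceIdx), M.bary m x = 0 →
      M.bary m ((2 : ℝ) • x - y) = -M.bary m y := by
    intro M m h0
    have e1 := M.bary_add m x (y - x)
    have e2 := M.bary_add m x (x - y)
    rw [add_sub_cancel, h0, map_sub] at e1
    rw [h0, map_sub, show x + (x - y) = (2 : ℝ) • x - y by module] at e2
    linarith
  have hneg : ∀ (M : Cell d) (m₀ : M.FaceIdx), (∀ m, m ≠ m₀ → 0 < M.bary m y) →
      (¬ ∀ m, 0 ≤ M.bary m y) → M.bary m₀ y < 0 := by
    intro M m₀ h h'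
    by_contra h0
    refine h' fun m => ?_
    by_cases hm : m = m₀
    · rw [hm]; exact not_lt.1 h0
    · exact (h m hm).le
  have b1 : (2 : ℝ) • x - y ∈ K.dom := by
    rw [K.mem_dom_iff hd]
    intro m
    by_cases hm : m = l
    · rw [hm, hrefl K l hx]; linarith [hneg K l a1 hn.1]
    · exact a3 m hm
  have b2 : (2 : ℝ) • x - y ∈ K'.dom := by
    rw [K'.mem_dom_iff hd]
    intro m
    by_cases hm : m = l'
    · rw [hm, hrefl K' l' hx']; linarith [hneg K' l' a2 hn.2]
    · exact a4 m hm
  exact Set.disjoint_left.1 hdisj b1 b2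

lemma ae_union_mem_nhds (hd : 1 ≤ d) (hmesh : IsMesh Ω cell) {K K' : ι} (hne : K ≠ K')
    {l : (cell K).FaceIdx} (h : HasFace (cell K') ((cell K).face l)) :
    ∀ᵐ x ∂(surf d).restrict ((cell K).face l),
      (cell K).carrier ∪ (cell K').carrier ∈ nhds x := by
  obtain ⟨l', hl'⟩ := h
  have h1 := ae_bary_pos (fun K => hmesh.facesAEDisjoint hd K) K l
  have h2 := ae_bary_pos (fun K => hmesh.facesAEDisjoint hd K) K' l'
  rw [hl'] at h2
  filter_upwards [h1, h2, ae_restrict_mem ((cell K).isClosed_face l).measurableSet] with x a1 a2 a3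
  have a4 := a3
  rw [← hl'] at a4
  exact union_carrier_mem_nhds hd (hmesh.disjoint hne) (((cell K).mem_face_iff l x).1 a3).2 a1
    (((cell K').mem_face_iff l' x).1 a4).2 a2

lemma surf_face_ne_zero (hd : 1 ≤ d) (K : Cell d) (l : K.FaceIdx) : surf d (K.face l) ≠ 0 := by
  obtain ⟨c, hc, -⟩ := exists_hasGreen_rt0 hd K l
  intro h
  rw [Measure.real, h] at hc
  simp at hc

lemma ae_face_neBot (hd : 1 ≤ d) (K : Cell d) (l : K.FaceIdx) :
    (ae ((surf d).restrict (K.face l))).NeBot := by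
  rw [ae_neBot]
  intro h
  refine surf_face_ne_zero hd K l ?_
  rw [← Measure.restrict_apply_self, h]
  rfl

/-- A face belongs to at most two cells. -/
lemma eq_of_hasFace (hd : 1 ≤ d) (hmesh : IsMesh Ω cell) {K K' K'' : ι} (hne : K ≠ K')
    {l : (cell K).FaceIdx} (h : HasFace (cell K') ((cell K).face l))
    (h' : HasFace (cell K'') ((cell K).face l)) : K'' = K ∨ K'' = K' := by
  by_contra hn
  rw [not_or] at hn
  have := ae_face_neBot hd (cell K) l
  obtain ⟨x, hx, hxl⟩ := ((ae_union_mem_nhds hd hmesh hne h).and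
    (ae_restrict_mem ((cell K).isClosed_face l).measurableSet)).exists
  obtain ⟨l'', hl''⟩ := h'
  rw [← hl''] at hxl
  have hxc := (cell K'').face_subset_carrier l'' hxl
  -- The point is a limit of interior points of the third cell, yet a whole neighbourhood of it is
  -- filled by the first two.
  rw [← (cell K'').closure_dom hd] at hxc
  obtain ⟨y, hy, hy'⟩ := mem_closure_iff_nhds.1 hxc _ hx
  rcases hy with hy | hy
  · exact Set.disjoint_left.1 (disjoint_dom_carrier hd hmesh hn.1) hy' hy
  · exact Set.disjoint_left.1 (disjoint_dom_carrier hd hmesh hn.2) hy' hy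

lemma ae_mem_of_hasFace (hd : 1 ≤ d) (hΩ : interior (closure Ω) = Ω) (hmesh : IsMesh Ω cell)
    {K K' : ι} (hne : K ≠ K') {l : (cell K).FaceIdx} (h : HasFace (cell K') ((cell K).face l)) :
    ∀ᵐ x ∂(surf d).restrict ((cell K).face l), x ∈ Ω := by
  filter_upwards [ae_union_mem_nhds hd hmesh hne h] with x hx
  rw [← hΩ, mem_interior_iff_mem_nhds]
  exact Filter.mem_of_superset hx
    (Set.union_subset (hmesh.carrier_subset K) (hmesh.carrier_subset K'))

/-- Every point of the face inside Ω is a limit of points of Ω outside the cell, hence lies on the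
boundary of one of finitely many other cells. If none of them had this face, the part of the face in
Ω would be null; but it contains a relatively open piece. -/
lemma exists_hasFace (hd : 1 ≤ d) [Finite ι] (hΩ : interior (closure Ω) = Ω)
    (hmesh : IsMesh Ω cell) (K : ι) (l : (cell K).FaceIdx)
    (h : ¬ (cell K).face l ⊆ frontier Ω) :
    ∃ K', K ≠ K' ∧ HasFace (cell K') ((cell K).face l) := by
  have hΩo := isOpen_of_interior_closure hΩ
  obtain ⟨x, hxF, hxΩ⟩ : ∃ x ∈ (cell K).face l, x ∈ Ω := by
    rw [Set.not_subset] at h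
    obtain ⟨x, hx, hx'⟩ := h
    refine ⟨x, hx, ?_⟩
    rw [frontier, hΩo.interior_eq] at hx'
    by_contra hn
    exact hx' ⟨hmesh.carrier_subset K ((cell K).face_subset_carrier l hx), hn⟩
  obtain ⟨y, hy0, hy⟩ := (cell K).exists_bary_eq_zero hd l
  have hx0 := (((cell K).mem_face_iff l x).1 hxF).2
  have hxc := ((cell K).mem_carrier_iff x).1 ((cell K).face_subset_carrier l hxF)
  obtain ⟨z, hzF, hz, hzΩ⟩ : ∃ z ∈ (cell K).face l, (∀ m, m ≠ l → 0 < (cell K).bary m z) ∧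
      z ∈ Ω := by
    -- The given point may lie on an edge of the face; a slight move towards the centre reaches the
    -- relative interior without leaving the open set Ω.
    have hc : Continuous fun t : ℝ => (1 - t) • x + t • y := by fun_prop
    have ht : Filter.Tendsto (fun t : ℝ => (1 - t) • x + t • y) (nhdsWithin 0 (Set.Ioi 0))
        (nhds x) := by
      have := (hc.tendsto 0).mono_left (nhdsWithin_le_nhds (s := Set.Ioi 0))
      simpa using this
    obtain ⟨t, htΩ, ht0, ht1⟩ := ((ht.eventually (hΩo.mem_nhds hxΩ)).and
      (Ioo_mem_nhdsGT (zero_lt_one' ℝ))).exists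
    have hb : ∀ m, (cell K).bary m ((1 - t) • x + t • y)
        = (1 - t) * (cell K).bary m x + t * (cell K).bary m y :=
      fun m => (cell K).bary_combo m (by ring)
    have hl0 : (cell K).bary l ((1 - t) • x + t • y) = 0 := by rw [hb, hx0, hy0]; ring
    have hpos : ∀ m, m ≠ l → 0 < (cell K).bary m ((1 - t) • x + t • y) := by
      intro m hm
      rw [hb]
      exact add_pos_of_nonneg_of_pos (mul_nonneg (by linarith) (hxc m)) (mul_pos ht0 (hy m hm))
    refine ⟨_, ((cell K).mem_face_iff l _).2 ⟨((cell K).mem_carrier_iff _).2 fun m => ?_, hl0⟩,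
      hpos, htΩ⟩
    by_cases hm : m = l
    · rw [hm, hl0]
    · exact (hpos m hm).le
  by_contra hno
  push Not at hno
  refine (cell K).surf_face_inter_open_ne_zero hd l hzF hz hΩo hzΩ ?_
  have hsub : (cell K).face l ∩ Ω ⊆ ⋃ K' : {K' // K ≠ K'}, (cell K).face l ∩ (cell K').bdry := by
    rintro p ⟨hpF, hpΩ⟩
    have hcl : IsClosed (⋃ K' : {K' // K ≠ K'}, (cell K').carrier) :=
      isClosed_iUnion_of_finite fun K' => (cell K').isClosed_carrier
    have hp : p ∈ closure (Ω \ (cell K).carrier) := by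
      have hpb : p ∈ closure ((cell K).carrier)ᶜ := by
        have h := (cell K).face_subset_bdry hd l hpF
        rw [Cell.bdry, frontier_eq_closure_inter_closure] at h
        exact h.2
      rw [Set.sdiff_eq, Set.inter_comm]
      exact mem_closure_iff_nhds.2 fun t ht => by
        obtain ⟨q, hq, hq'⟩ := mem_closure_iff_nhds.1 hpb _ (Filter.inter_mem ht (hΩo.mem_nhds hpΩ))
        exact ⟨q, hq.1, hq', hq.2⟩
    have hsub' : Ω \ (cell K).carrier ⊆ ⋃ K' : {K' // K ≠ K'}, (cell K').carrier := by
      rintro q ⟨hq, hqK⟩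
      have hq' : q ∈ ⋃ K, (cell K).carrier := hmesh.cover ▸ subset_closure hq
      obtain ⟨K', hK'⟩ := Set.mem_iUnion.1 hq'
      refine Set.mem_iUnion.2 ⟨⟨K', fun h => hqK (h ▸ hK')⟩, hK'⟩
    obtain ⟨⟨K', hK'⟩, hpK'⟩ := Set.mem_iUnion.1 (closure_minimal hsub' hcl hp)
    refine Set.mem_iUnion.2 ⟨⟨K', hK'⟩, hpF, ?_⟩
    rw [Cell.bdry, frontier, (cell K').isClosed_carrier.closure_eq]
    exact ⟨hpK', fun hpd => Set.disjoint_left.1 (disjoint_dom_carrier hd hmesh hK'.symm) hpd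
      ((cell K).face_subset_carrier l hpF)⟩
  refine measure_mono_null hsub (measure_iUnion_null fun K' => ?_)
  exact hmesh.surf_face_inter_bdry hd K l K' (hno K' K'.2)

/-- A face is either contained in the boundary of the domain, and then belongs to one cell only,
or it is interior up to a null set, and then belongs to exactly two cells. -/
lemma face_cases (hd : 1 ≤ d) [Finite ι] (hΩ : interior (closure Ω) = Ω)
    (hmesh : IsMesh Ω cell) (K : ι) (l : (cell K).FaceIdx) :
    ((cell K).face l ⊆ frontier Ω ∧ ∀ K', HasFace (cell K') ((cell K).face l) → K' = K) ∨
    (¬ (cell K).face l ⊆ frontier Ω ∧ (∀ᵐ x ∂(surf d).restrict ((cell K).face l), x ∈ Ω) ∧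
      ∃ K', K' ≠ K ∧ HasFace (cell K') ((cell K).face l) ∧
        ∀ K'', HasFace (cell K'') ((cell K).face l) → K'' = K ∨ K'' = K') := by
  by_cases h : (cell K).face l ⊆ frontier Ω
  · refine Or.inl ⟨h, fun K' hK' => ?_⟩
    by_contra hne
    have := ae_face_neBot hd (cell K) l
    obtain ⟨x, hx, hxl⟩ := ((ae_mem_of_hasFace hd hΩ hmesh (Ne.symm hne) hK').and
      (ae_restrict_mem ((cell K).isClosed_face l).measurableSet)).exists
    have h1 := h hxl
    rw [frontier, (isOpen_of_interior_closure hΩ).interior_eq] at h1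
    exact h1.2 hx
  · obtain ⟨K', hne, hK'⟩ := exists_hasFace hd hΩ hmesh K l h
    exact Or.inr ⟨h, ae_mem_of_hasFace hd hΩ hmesh hne hK', K', hne.symm, hK',
      fun K'' hK'' => eq_of_hasFace hd hmesh hne hK' hK''⟩

/-! ### Integrals over the cells and over the skeleton -/

lemma ae_dom_iUnion [Finite ι] (hΩ : interior (closure Ω) = Ω) (hmesh : IsMesh Ω cell) :
    (⋃ K, (cell K).dom : Set (E d)) =ᵐ[volume] Ω := by
  have h1 : (⋃ K, (cell K).dom : Set (E d)) ⊆ Ω := Set.iUnion_subset fun K => hmesh.dom_subset hΩ K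
  refine Filter.EventuallyLE.antisymm (LE.le.eventuallyLE h1) ?_
  have h2 : volume (⋃ K, (cell K).bdry) = 0 := measure_iUnion_null fun K => (cell K).volume_bdry
  have h3 : ∀ᵐ x, x ∉ ⋃ K, (cell K).bdry := measure_eq_zero_iff_ae_notMem.1 h2
  filter_upwards [h3] with x hx hxΩ
  have hx' : x ∈ ⋃ K, (cell K).carrier := hmesh.cover ▸ subset_closure hxΩ
  obtain ⟨K, hK⟩ := Set.mem_iUnion.1 hx'
  refine Set.mem_iUnion.2 ⟨K, ?_⟩
  by_contra hn
  refine hx (Set.mem_iUnion.2 ⟨K, ?_⟩)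
  rw [Cell.bdry, frontier, (cell K).isClosed_carrier.closure_eq]
  exact ⟨hK, hn⟩

lemma ae_domain_iff [Finite ι] (hΩ : interior (closure Ω) = Ω) (hmesh : IsMesh Ω cell)
    {p : E d → Prop} : (∀ᵐ x ∂volume.restrict Ω, p x) ↔
      ∀ K, ∀ᵐ x ∂volume.restrict (cell K).dom, p x := by
  rw [← Measure.restrict_congr_set (ae_dom_iUnion hΩ hmesh), ae_restrict_iUnion_iff]

lemma setIntegral_domain [Fintype ι] (hΩ : interior (closure Ω) = Ω) (hmesh : IsMesh Ω cell)
    {f : E d → ℝ} (hf : IntegrableOn f Ω) :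
    ∫ x in Ω, f x = ∑ K, ∫ x in (cell K).dom, f x := by
  rw [← setIntegral_congr_set (ae_dom_iUnion hΩ hmesh), integral_iUnion_fintype
    (fun K => (cell K).isOpen_dom.measurableSet) (fun K K' h => hmesh.disjoint h)]
  exact fun K => hf.mono_set (hmesh.dom_subset hΩ K)

/-- Gluing functions given on the cells. -/
def glue {F : Type*} [NormedAddCommGroup F] [Fintype ι] (cell : ι → Cell d) (s : ι → E d → F)
    (x : E d) : F := ∑ K, (cell K).dom.indicator (s K) x

lemma memLp_glue {F : Type*} [NormedAddCommGroup F] [Fintype ι] (hΩ : interior (closure Ω) = Ω)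
    (hmesh : IsMesh Ω cell) {s : ι → E d → F}
    (hs : ∀ K, MemLp (s K) 2 (volume.restrict (cell K).dom)) :
    MemLp (glue cell s) 2 (volume.restrict Ω) := by
  refine memLp_finsetSum _ fun K _ => ?_
  rw [memLp_indicator_iff_restrict (cell K).isOpen_dom.measurableSet,
    Measure.restrict_restrict (cell K).isOpen_dom.measurableSet,
    Set.inter_eq_left.2 (hmesh.dom_subset hΩ K)]
  exact hs K

lemma glue_apply {F : Type*} [NormedAddCommGroup F] [Fintype ι] (hmesh : IsMesh Ω cell)
    (s : ι → E d → F) {K : ι} {x : E d} (hx : x ∈ (cell K).dom) : glue cell s x = s K x := by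
  rw [glue, Finset.sum_eq_single K]
  · exact Set.indicator_of_mem hx _
  · intro K' _ hne
    exact Set.indicator_of_notMem (fun h => Set.disjoint_left.1 (hmesh.disjoint hne) h hx) _
  · simp

lemma glue_ae_eq {F : Type*} [NormedAddCommGroup F] [Fintype ι] (hmesh : IsMesh Ω cell)
    (s : ι → E d → F) (K : ι) : glue cell s =ᵐ[volume.restrict (cell K).dom] s K :=
  ae_restrict_of_forall_mem (cell K).isOpen_dom.measurableSet fun _ hx => glue_apply hmesh s hx

lemma bdry_subset_skeleton (cell : ι → Cell d) (K : ι) : (cell K).bdry ⊆ skeleton cell :=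
  Set.subset_iUnion (fun K => (cell K).bdry) K

lemma isFiniteMeasure_skeleton (hd : 1 ≤ d) [Fintype ι] (cell : ι → Cell d) :
    IsFiniteMeasure ((surf d).restrict (skeleton cell)) := by
  refine ⟨?_⟩
  rw [Measure.restrict_apply_univ]
  refine (measure_iUnion_le _).trans_lt ?_
  rw [tsum_fintype]
  exact ENNReal.sum_lt_top.2 fun K _ => (cell K).surf_bdry_lt_top hd

lemma ae_skeleton_iff (hd : 1 ≤ d) [Finite ι] (cell : ι → Cell d) {p : E d → Prop} :
    (∀ᵐ x ∂(surf d).restrict (skeleton cell), p x) ↔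
      ∀ K (l : (cell K).FaceIdx), ∀ᵐ x ∂(surf d).restrict ((cell K).face l), p x := by
  rw [skeleton, ae_restrict_iUnion_iff]
  exact forall_congr' fun K => ae_bdry_iff hd

/-- The sum over the cells of functions given on the boundaries of the cells. -/
def jump [Fintype ι] (cell : ι → Cell d) (g : ι → E d → ℝ) (x : E d) : ℝ :=
  ∑ K, (cell K).bdry.indicator (g K) x

lemma memLp_indicator_skeleton [Finite ι] {cell : ι → Cell d} {K : ι} {g : E d → ℝ}
    (hg : MemLp g 2 ((surf d).restrict (cell K).bdry)) :
    MemLp ((cell K).bdry.indicator g) 2 ((surf d).restrict (skeleton cell)) := by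
  have hm := (cell K).isClosed_bdry.measurableSet
  rw [memLp_indicator_iff_restrict hm, Measure.restrict_restrict hm,
    Set.inter_eq_left.2 (bdry_subset_skeleton cell K)]
  exact hg

lemma memLp_jump [Fintype ι] {cell : ι → Cell d} {g : ι → E d → ℝ}
    (hg : ∀ K, MemLp (g K) 2 ((surf d).restrict (cell K).bdry)) :
    MemLp (jump cell g) 2 ((surf d).restrict (skeleton cell)) :=
  memLp_finsetSum _ fun K _ => memLp_indicator_skeleton (hg K)

lemma integral_jump_mul [Fintype ι] {cell : ι → Cell d} {g : ι → E d → ℝ}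
    (hg : ∀ K, MemLp (g K) 2 ((surf d).restrict (cell K).bdry)) {π : E d → ℝ}
    (hπ : MemLp π 2 ((surf d).restrict (skeleton cell))) :
    ∫ x in skeleton cell, jump cell g x * π x ∂(surf d)
      = ∑ K, ∫ x in (cell K).bdry, g K x * π x ∂(surf d) := by
  simp_rw [jump, Finset.sum_mul]
  rw [integral_finsetSum _ fun K _ => integrable_mul_L2 (memLp_indicator_skeleton (hg K)) hπ]
  refine Finset.sum_congr rfl fun K _ => ?_
  have hm := (cell K).isClosed_bdry.measurableSet
  rw [← Set.inter_eq_right.2 (bdry_subset_skeleton cell K), ← setIntegral_indicator hm,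
    Set.inter_eq_right.2 (bdry_subset_skeleton cell K)]
  congr 1
  ext x
  by_cases hx : x ∈ (cell K).bdry <;> simp [hx]

open Classical in
/-- On a face, only the cells that have this face contribute to the jump. -/
lemma jump_ae_eq_sum (hd : 1 ≤ d) [Fintype ι] (hmesh : IsMesh Ω cell) (K : ι)
    (l : (cell K).FaceIdx) (g : ι → E d → ℝ) :
    ∀ᵐ x ∂(surf d).restrict ((cell K).face l),
      jump cell g x = ∑ K', if HasFace (cell K') ((cell K).face l) then g K' x else 0 := by
  have h1 : ∀ᵐ x ∂(surf d).restrict ((cell K).face l), ∀ K',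
      ¬ HasFace (cell K') ((cell K).face l) → x ∉ (cell K').bdry := by
    rw [ae_all_iff]
    intro K'
    by_cases h : HasFace (cell K') ((cell K).face l)
    · exact Filter.Eventually.of_forall fun x h' => absurd h h'
    · have h0 := hmesh.surf_face_inter_bdry hd K l K' h
      have h2 : ∀ᵐ x ∂(surf d).restrict ((cell K).face l), x ∉ (cell K').bdry := by
        rw [ae_iff, Measure.restrict_apply₀']
        · simpa [Set.inter_comm] using h0
        · exact ((cell K).isClosed_face l).measurableSet.nullMeasurableSet
      filter_upwards [h2] with x hx _ using hx
  filter_upwards [h1, ae_restrict_mem ((cell K).isClosed_face l).measurableSet] with x hx hxl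
  refine Finset.sum_congr rfl fun K' _ => ?_
  by_cases h : HasFace (cell K') ((cell K).face l)
  · rw [if_pos h, Set.indicator_of_mem (h.subset_bdry hd hxl)]
  · rw [if_neg h, Set.indicator_of_notMem (hx K' h)]

lemma jump_ae_eq_of_boundary (hd : 1 ≤ d) [Fintype ι] (hmesh : IsMesh Ω cell) (K : ι)
    (l : (cell K).FaceIdx) (g : ι → E d → ℝ)
    (h : ∀ K', HasFace (cell K') ((cell K).face l) → K' = K) :
    jump cell g =ᵐ[(surf d).restrict ((cell K).face l)] g K := by
  classical
  filter_upwards [jump_ae_eq_sum hd hmesh K l g] with x hx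
  rw [hx, Finset.sum_eq_single K]
  · exact if_pos (hasFace_face _ _)
  · intro K' _ hne
    exact if_neg fun h' => hne (h K' h')
  · simp

lemma jump_ae_eq_of_interior (hd : 1 ≤ d) [Fintype ι] (hmesh : IsMesh Ω cell) {K K' : ι}
    (l : (cell K).FaceIdx) (g : ι → E d → ℝ) (hne : K' ≠ K)
    (hK' : HasFace (cell K') ((cell K).face l))
    (h : ∀ K'', HasFace (cell K'') ((cell K).face l) → K'' = K ∨ K'' = K') :
    jump cell g =ᵐ[(surf d).restrict ((cell K).face l)] fun x => g K x + g K' x := by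
  classical
  filter_upwards [jump_ae_eq_sum hd hmesh K l g] with x hx
  rw [hx, Finset.sum_eq_add K K' hne.symm]
  · rw [if_pos (hasFace_face _ _), if_pos hK']
  · intro K'' _ hn
    exact if_neg fun h' => (h K'' h').elim hn.1 hn.2
  · simp
  · simp

end Mesh

/-! ### Normal continuity -/

section Jump

variable {d : ℕ} {ι : Type*} [Fintype ι] {Ω : Set (E d)} {cell : ι → Cell d} {u : E d → E d}
  {δ g : ι → E d → ℝ}

/-- The normal component of a field in `H(div, Ω)` does not jump. -/
lemma jump_ae_eq_zero (hd : 1 ≤ d) (hΩ : interior (closure Ω) = Ω) (hmesh : IsMesh Ω cell)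
    (hu : MemHdiv Ω u) (hG : ∀ K, HasGreen (cell K) u (δ K) (g K)) :
    ∀ᵐ x ∂(surf d).restrict (skeleton cell), x ∈ Ω → jump cell g x = 0 := by
  have := isFiniteMeasure_skeleton hd cell
  refine (isOpen_of_interior_closure hΩ).ae_eq_zero_of_integral_contDiff_smul_eq_zero ?_ ?_
  · exact ((memLp_jump fun K => (hG K).trace).locallyIntegrable (by norm_num)).locallyIntegrableOn _
  · intro v hv hc hs
    -- Summing Green's formula over the cells rewrites the moments of the jump as the identity
    -- defining the weak divergence on Ω.
    have h1 : ∫ x in skeleton cell, v x • jump cell g x ∂(surf d)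
        = ∑ K, ∫ x in (cell K).bdry, g K x * v x ∂(surf d) := by
      rw [← integral_jump_mul (fun K => (hG K).trace)
        (hv.continuous.memLp_of_hasCompactSupport hc)]
      simp only [smul_eq_mul, mul_comm]
    have h2 : ∀ K, ∫ x in (cell K).bdry, g K x * v x ∂(surf d)
        = ∫ x in (cell K).dom, (fderiv ℝ v x (u x) + wdiv Ω u x * v x) := by
      intro K
      rw [← (hG K).green v hv]
      refine integral_congr_ae ?_
      filter_upwards [(hG K).wdiv_ae_eq,
        hu.wdiv_ae_eq_mono (cell K).isOpen_dom (hmesh.dom_subset hΩ K)] with x h h'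
      rw [← h, h']
    have hi1 := integrable_test_fderiv hv hc hu.1
    have hi2 := integrable_test_mul hv hc hu.isWeakDiv.1
    have hi : IntegrableOn (fun x => fderiv ℝ v x (u x) + wdiv Ω u x * v x) Ω := hi1.add hi2
    rw [h1, Finset.sum_congr rfl fun K _ => h2 K, ← setIntegral_domain hΩ hmesh hi,
      integral_add hi1 hi2, hu.isWeakDiv.2 v hv hc hs, neg_add_cancel]

/-- A piecewise `H(div)` field whose normal component does not jump is in `H(div, Ω)`. -/
lemma isWeakDiv_of_jump (hΩ : interior (closure Ω) = Ω) (hd : 1 ≤ d) (hmesh : IsMesh Ω cell)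
    (hu : MemLp u 2 (volume.restrict Ω)) (hG : ∀ K, HasGreen (cell K) u (δ K) (g K))
    (hj : ∀ᵐ x ∂(surf d).restrict (skeleton cell), x ∈ Ω → jump cell g x = 0) :
    IsWeakDiv Ω u (glue cell δ) := by
  have := isFiniteMeasure_skeleton hd cell
  refine ⟨memLp_glue hΩ hmesh fun K => (hG K).div, fun v hv hc hs => ?_⟩
  have hi1 := integrable_test_fderiv hv hc hu
  have hi2 := integrable_test_mul hv hc (memLp_glue hΩ hmesh fun K => (hG K).div)
  have hi : IntegrableOn (fun x => fderiv ℝ v x (u x) + glue cell δ x * v x) Ω := hi1.add hi2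
  rw [← add_eq_zero_iff_eq_neg, ← integral_add hi1 hi2, setIntegral_domain hΩ hmesh hi]
  have h2 : ∀ K, ∫ x in (cell K).dom, (fderiv ℝ v x (u x) + glue cell δ x * v x)
      = ∫ x in (cell K).bdry, g K x * v x ∂(surf d) := by
    intro K
    rw [← (hG K).green v hv]
    refine integral_congr_ae ?_
    filter_upwards [glue_ae_eq hmesh δ K] with x h
    rw [h]
  rw [Finset.sum_congr rfl fun K _ => h2 K, ← integral_jump_mul (fun K => (hG K).trace)
        (hv.continuous.memLp_of_hasCompactSupport hc)]
  refine integral_eq_zero_of_ae ?_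
  filter_upwards [hj] with x hx
  by_cases h : x ∈ Ω
  · rw [hx h, zero_mul, Pi.zero_apply]
  · rw [image_eq_zero_of_notMem_tsupport fun h' => h (hs h'), mul_zero, Pi.zero_apply]

end Jump

/-! ### Fluxes of the multiscale fields on a cell -/

section CellFlux

variable {d N : ℕ} {K : Cell d} {Ω : Set (E d)} {k : E d → Matrix (Fin d) (Fin d) ℝ}
  {U : Fin N → E d → E d}

lemma HasGreen.combo (hd : 1 ≤ d) {κ : Type*} [Fintype κ] {Ψ : κ → E d → E d} {G : κ → E d → ℝ}
    {m : ℝ} (h : ∀ p, HasGreen K (Ψ p) (fun _ => m) (G p)) (c : κ → ℝ) :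
    HasGreen K (∑ p, c p • Ψ p) (fun _ => (∑ p, c p) * m) (∑ p, c p • G p) := by
  refine (HasGreen.sum hd Finset.univ fun p _ => (h p).smul (c p)).congr
    (Filter.EventuallyEq.refl _ _) ?_ (Filter.EventuallyEq.refl _ _)
  refine Filter.Eventually.of_forall fun x => ?_
  simp [Finset.sum_apply, Finset.sum_mul]

/-- A basis of the multiscale fields on a cell. -/
lemma exists_psi_basis (hd : 1 ≤ d) (hk : IsCoefficient Ω k) (hK : K.dom ⊆ Ω)
    (hF : FacesAEDisjoint K) (hV : ∀ i, HasNormalTrace K (U i))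
    (h0 : ∀ i l, ∫ y in K.face l, normalTrace K (U i) y ∂(surf d) ≠ 0) :
    ∃ Ψ : Fin N × K.FaceIdx → E d → E d, (∀ p, Ψ p ∈ psiSpan k U K) ∧
      (∀ p, HasGreen K (Ψ p) (fun _ => (volume.real K.carrier)⁻¹) (faceFlux K (U p.1) p.2)) ∧
      ∀ t ∈ psiSpan k U K, ∃ c : Fin N × K.FaceIdx → ℝ,
        t =ᵐ[volume.restrict K.dom] ∑ p, c p • Ψ p := by
  choose η Ψ φ h using fun p : Fin N × K.FaceIdx =>
    exists_isMsBasis hd hk hK hF (hV p.1) p.2 (h0 p.1 p.2)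
  exact ⟨Ψ, fun p => Submodule.subset_span ⟨p.1, p.2, η p, φ p, h p⟩,
    fun p => (h p).hasGreen hd hF,
    fun t ht => exists_coeff_of_psiSpan hd hk hK hF (fun p => ⟨η p, φ p, h p⟩) ht⟩

/-- On a face, the fluxes of the multiscale fields are combinations of the global fluxes. -/
lemma sum_faceFlux_ae_eq (hF : FacesAEDisjoint K) (c : Fin N × K.FaceIdx → ℝ) (l : K.FaceIdx) :
    (∑ p, c p • faceFlux K (U p.1) p.2) =ᵐ[(surf d).restrict (K.face l)] fun x =>
      ∑ i, (c (i, l) * (∫ y in K.face l, normalTrace K (U i) y ∂(surf d))⁻¹) *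
        normalTrace K (U i) x := by
  have h1 : ∀ᵐ x ∂(surf d).restrict (K.face l), ∀ l', l' ≠ l → x ∉ K.face l' := by
    rw [ae_all_iff]
    intro l'
    by_cases h : l' = l
    · exact Filter.Eventually.of_forall fun x h' => absurd h h'
    · filter_upwards [ae_notMem_face hF h] with x hx _ using hx
  filter_upwards [h1, ae_restrict_mem (K.isClosed_face l).measurableSet] with x hx hxl
  rw [Finset.sum_apply, Fintype.sum_prod_type]
  refine Finset.sum_congr rfl fun i _ => ?_
  rw [Finset.sum_eq_single l]
  · rw [Pi.smul_apply, faceFlux, Set.indicator_of_mem hxl, smul_eq_mul, mul_assoc]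
  · intro l' _ hne
    rw [Pi.smul_apply, faceFlux, Set.indicator_of_notMem (hx l' hne), smul_zero]
  · simp

end CellFlux

/-! ### Fields of the discontinuous velocity space -/

/-- The assumptions on the domain, the partition, the coefficient and the global fields. -/
structure Setting {d N : ℕ} {ι : Type*} (Ω : Set (E d)) (cell : ι → Cell d)
    (k : E d → Matrix (Fin d) (Fin d) ℝ) (U : Fin N → E d → E d) : Prop where
  pos : 1 ≤ d
  domain : interior (closure Ω) = Ω
  mesh : IsMesh Ω cell
  coeff : IsCoefficient Ω k
  fields : IsGlobalFields Ω cell U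

namespace Setting

variable {d N : ℕ} {ι : Type*} {Ω : Set (E d)} {cell : ι → Cell d}
  {k : E d → Matrix (Fin d) (Fin d) ℝ} {U : Fin N → E d → E d}

lemma exists_psi_basis (S : Setting Ω cell k U) (K : ι) :
    ∃ Ψ : Fin N × (cell K).FaceIdx → E d → E d, (∀ p, Ψ p ∈ psiSpan k U (cell K)) ∧
      (∀ p, HasGreen (cell K) (Ψ p) (fun _ => (volume.real (cell K).carrier)⁻¹)
        (faceFlux (cell K) (U p.1) p.2)) ∧
      ∀ t ∈ psiSpan k U (cell K), ∃ c : Fin N × (cell K).FaceIdx → ℝ,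
        t =ᵐ[volume.restrict (cell K).dom] ∑ p, c p • Ψ p :=
  MsFEM.exists_psi_basis S.pos S.coeff (S.mesh.dom_subset S.domain K)
    (S.mesh.facesAEDisjoint S.pos K) (fun i => S.fields.trace i K)
    fun i l => S.fields.flux_ne_zero i K l

lemma exists_hasGreen (S : Setting Ω cell k U) {u : E d → E d} {K : ι}
    (hu : ∃ s ∈ psiSpan k U (cell K), u =ᵐ[volume.restrict (cell K).dom] s) :
    ∃ (c : Fin N × (cell K).FaceIdx → ℝ) (a : ℝ), HasGreen (cell K) u (fun _ => a)
      (∑ p, c p • faceFlux (cell K) (U p.1) p.2) := by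
  obtain ⟨Ψ, -, h1, h2⟩ := S.exists_psi_basis K
  obtain ⟨s, hs, hus⟩ := hu
  obtain ⟨c, hc⟩ := h2 s hs
  have hcu : (∑ p, c p • Ψ p) =ᵐ[volume.restrict (cell K).dom] u := (hus.trans hc).symm
  exact ⟨c, _, (HasGreen.combo S.pos h1 c).congr hcu (Filter.EventuallyEq.refl _ _)
    (Filter.EventuallyEq.refl _ _)⟩

lemma exists_normalTrace_face (S : Setting Ω cell k U) {u : E d → E d} {K : ι}
    (hu : ∃ s ∈ psiSpan k U (cell K), u =ᵐ[volume.restrict (cell K).dom] s)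
    (l : (cell K).FaceIdx) : ∃ γ : Fin N → ℝ,
      normalTrace (cell K) u =ᵐ[(surf d).restrict ((cell K).face l)]
        fun x => ∑ i, γ i * normalTrace (cell K) (U i) x := by
  obtain ⟨c, a, h⟩ := S.exists_hasGreen hu
  have h1 : ∀ᵐ x ∂(surf d).restrict ((cell K).face l), normalTrace (cell K) u x = _ :=
    ae_face_of_ae_bdry S.pos (h.normalTrace_ae_eq S.pos) l
  exact ⟨_, Filter.EventuallyEq.trans h1
    (sum_faceFlux_ae_eq (S.mesh.facesAEDisjoint S.pos K) c l)⟩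

variable [Fintype ι]

/-- No continuity is imposed between cells, so the coefficients may be chosen independently on each
cell and the fields glued. -/
lemma exists_field (S : Setting Ω cell k U) (c : ∀ K, Fin N × (cell K).FaceIdx → ℝ) :
    ∃ u ∈ X2tilde Ω cell k U, ∀ K, ∃ a : ℝ, HasGreen (cell K) u (fun _ => a)
      (∑ p, c K p • faceFlux (cell K) (U p.1) p.2) := by
  choose Ψ h1 h2 _ using S.exists_psi_basis
  have hG := fun K => HasGreen.combo S.pos (h2 K) (c K)
  have hm := memLp_glue S.domain S.mesh fun K => (hG K).field
  have hae : ∀ K, hm.toLp =ᵐ[volume.restrict (cell K).dom] ∑ p, c K p • Ψ K p := fun K =>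
    Filter.EventuallyEq.trans ((ae_domain_iff S.domain S.mesh).1 hm.coeFn_toLp K)
      (glue_ae_eq S.mesh _ K)
  exact ⟨hm.toLp, fun K => ⟨_, Submodule.sum_mem _ fun p _ => Submodule.smul_mem _ _ (h1 K p),
    hae K⟩, fun K => ⟨_, (hG K).congr (hae K).symm (Filter.EventuallyEq.refl _ _)
    (Filter.EventuallyEq.refl _ _)⟩⟩

/-- There is a discontinuous velocity whose flux is concentrated on one face, where it is a
given multiple of a combination of the global fluxes, seen from each of the cells. -/
lemma exists_face_field (S : Setting Ω cell k U) (K₀ : ι) (l₀ : (cell K₀).FaceIdx) (a : ι → ℝ)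
    (γ : Fin N → ℝ) : ∃ u ∈ X2tilde Ω cell k U, ∀ K, ∃ b : ℝ, HasGreen (cell K) u (fun _ => b)
      (((cell K₀).face l₀).indicator fun x => a K * ∑ i, γ i * normalTrace (cell K) (U i) x) := by
  classical
  -- Multiplying by the total global flux undoes the unit normalisation in `faceFlux`. Faces are
  -- compared as sets, so that all cells sharing the face are treated at once.
  let c : ∀ K, Fin N × (cell K).FaceIdx → ℝ := fun K p =>
    if (cell K).face p.2 = (cell K₀).face l₀ then
      a K * γ p.1 * ∫ y in (cell K).face p.2, normalTrace (cell K) (U p.1) y ∂(surf d) else 0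
  obtain ⟨u, hu, h⟩ := S.exists_field c
  refine ⟨u, hu, fun K => ?_⟩
  obtain ⟨b, hb⟩ := h K
  refine ⟨b, hb.congr (Filter.EventuallyEq.refl _ _) (Filter.EventuallyEq.refl _ _) ?_⟩
  refine (ae_bdry_iff S.pos).2 fun l => ?_
  by_cases hl : (cell K).face l = (cell K₀).face l₀
  · filter_upwards [sum_faceFlux_ae_eq (S.mesh.facesAEDisjoint S.pos K) (c K) l,
      ae_restrict_mem ((cell K).isClosed_face l).measurableSet] with x hx hxl
    rw [hx, Set.indicator_of_mem (hl ▸ hxl), Finset.mul_sum]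
    refine Finset.sum_congr rfl fun i _ => ?_
    simp only [c, if_pos hl]
    rw [mul_assoc (a K * γ i), mul_inv_cancel₀ (S.fields.flux_ne_zero i K l), mul_one, mul_assoc]
  · have h2 : ∀ᵐ x ∂(surf d).restrict ((cell K).face l), x ∉ (cell K₀).face l₀ := by
      rw [ae_iff, Measure.restrict_apply₀' ((cell K).isClosed_face l).measurableSet.nullMeasurableSet]
      have := (S.mesh.faceToFace K K₀ l l₀).resolve_left hl
      simpa [Set.inter_comm] using this
    filter_upwards [sum_faceFlux_ae_eq (S.mesh.facesAEDisjoint S.pos K) (c K) l, h2] with x hx hxl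
    rw [hx, Set.indicator_of_notMem hxl]
    refine Finset.sum_eq_zero fun i _ => ?_
    simp only [c, if_neg hl, zero_mul]

lemma mem_X2_of_jump (S : Setting Ω cell k U) {u : L2v Ω} (hu : u ∈ X2tilde Ω cell k U)
    {δ g : ι → E d → ℝ} (hG : ∀ K, HasGreen (cell K) u (δ K) (g K))
    (hj : ∀ᵐ x ∂(surf d).restrict (skeleton cell), x ∈ Ω → jump cell g x = 0) :
    u ∈ X2 Ω cell k U :=
  ⟨⟨Lp.memLp u, _, isWeakDiv_of_jump S.domain S.pos S.mesh (Lp.memLp u) hG hj⟩, hu⟩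

lemma jump_fields (S : Setting Ω cell k U) (i : Fin N) :
    ∀ᵐ x ∂(surf d).restrict (skeleton cell), x ∈ Ω →
      jump cell (fun K => normalTrace (cell K) (U i)) x = 0 :=
  jump_ae_eq_zero S.pos S.domain S.mesh (S.fields.mem i) fun K => (S.fields.trace i K).hasGreen

/-- A face field that is normally continuous. -/
lemma exists_face_field_X2 (S : Setting Ω cell k U) (K₀ : ι) (l₀ : (cell K₀).FaceIdx)
    (γ : Fin N → ℝ) : ∃ u ∈ X2 Ω cell k U, ∀ K, ∃ b : ℝ, HasGreen (cell K) u (fun _ => b)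
      (((cell K₀).face l₀).indicator fun x => ∑ i, γ i * normalTrace (cell K) (U i) x) := by
  obtain ⟨u, hu, h⟩ := S.exists_face_field K₀ l₀ (fun _ => 1) γ
  simp only [one_mul] at h
  choose b hb using h
  refine ⟨u, S.mem_X2_of_jump hu hb ?_, fun K => ⟨b K, hb K⟩⟩
  -- With equal weights on all cells, the jump on the face is a combination of the jumps of the
  -- global fields, which vanish in Ω; off the face there is no flux.
  filter_upwards [ae_all_iff.2 S.jump_fields] with x hx hxΩ
  by_cases hxF : x ∈ (cell K₀).face l₀
  · have : ∀ K, (cell K).bdry.indicator (((cell K₀).face l₀).indicator fun x =>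
        ∑ i, γ i * normalTrace (cell K) (U i) x) x
        = ∑ i, γ i * (cell K).bdry.indicator (normalTrace (cell K) (U i)) x := by
      intro K
      by_cases hK : x ∈ (cell K).bdry <;> simp [hK, hxF]
    rw [jump, Finset.sum_congr rfl fun K _ => this K, Finset.sum_comm]
    refine Finset.sum_eq_zero fun i _ => ?_
    rw [← Finset.mul_sum]
    exact mul_eq_zero_of_right _ (hx i hxΩ)
  · refine Finset.sum_eq_zero fun K _ => ?_
    simp [Set.indicator, hxF]

/-- On an interior face the fluxes seen from the two sides are opposite. -/
lemma normalTrace_fields_add (S : Setting Ω cell k U) {K K' : ι} (l : (cell K).FaceIdx)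
    (hne : K' ≠ K) (hK' : HasFace (cell K') ((cell K).face l))
    (h : ∀ K'', HasFace (cell K'') ((cell K).face l) → K'' = K ∨ K'' = K')
    (hin : ∀ᵐ x ∂(surf d).restrict ((cell K).face l), x ∈ Ω) (i : Fin N) :
    ∀ᵐ x ∂(surf d).restrict ((cell K).face l),
      normalTrace (cell K) (U i) x + normalTrace (cell K') (U i) x = 0 := by
  filter_upwards [hin, (ae_skeleton_iff S.pos cell).1 (S.jump_fields i) K l,
    jump_ae_eq_of_interior S.pos S.mesh l (fun K => normalTrace (cell K) (U i)) hne hK' h]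
    with x h1 h2 h3
  rw [← h3, h2 h1]

end Setting

/-! ### The position field as an element of H(div, Ω) -/

lemma integral_fderiv_self {d : ℕ} {v : E d → ℝ} (hv : ContDiff ℝ ∞ v) (hc : HasCompactSupport v) :
    ∫ x, fderiv ℝ v x x = - ∫ x, (d : ℝ) * v x := by
  let e : Fin d → E d := fun j => EuclideanSpace.single j 1
  have hint : ∀ (j : Fin d), Integrable (fun x : E d => x j * fderiv ℝ v x (e j)) := fun j => by
    have h1 : Continuous fun x : E d => x j * fderiv ℝ v x (e j) := by
      have := hv.continuous_fderiv (by simp)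
      fun_prop
    refine h1.integrable_of_hasCompactSupport ?_
    exact (hc.fderiv_apply ℝ (e j)).mul_left
  have h1 : ∀ x : E d, fderiv ℝ v x x = ∑ j, x j * fderiv ℝ v x (e j) := by
    intro x
    have hx : x = ∑ j, x j • e j := by
      ext i
      simp [e, Pi.single_apply]
    conv_lhs => arg 2; rw [hx]
    rw [map_sum]
    simp
  simp_rw [h1]
  rw [integral_finsetSum _ fun j _ => hint j]
  have h2 : ∀ j : Fin d, ∫ x : E d, x j * fderiv ℝ v x (e j) = - ∫ x, v x := by
    intro j
    have hp : ∀ x : E d, fderiv ℝ (fun x : E d => x j) x (e j) = 1 := fun x => by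
      rw [show (fun x : E d => x j) = EuclideanSpace.proj (𝕜 := ℝ) j from rfl,
        ContinuousLinearMap.fderiv]
      simp [e]
    have hcont := hv.continuous
    rw [integral_mul_fderiv_eq_neg_fderiv_mul_of_integrable (g := v)]
    · simp_rw [hp, one_mul]
    · simp_rw [hp, one_mul]
      exact hcont.integrable_of_hasCompactSupport hc
    · exact hint j
    · refine Continuous.integrable_of_hasCompactSupport (by fun_prop) hc.mul_left
    · exact fun x _ => (EuclideanSpace.proj (𝕜 := ℝ) j).differentiableAt
    · exact fun x _ => hv.differentiable (by simp) x
  rw [Finset.sum_congr rfl fun j _ => h2 j, integral_const_mul]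
  simp

/-- Boundedness makes the field and its divergence d square integrable. Consequently its normal
component does not jump across interior faces. -/
lemma memHdiv_id {d : ℕ} {Ω : Set (E d)} (hΩ : IsOpen Ω) (hb : Bornology.IsBounded Ω) :
    MemHdiv Ω id := by
  have : IsFiniteMeasure (volume.restrict Ω) := ⟨by simpa using hb.measure_lt_top⟩
  obtain ⟨C, hC⟩ := hb.exists_norm_le
  refine ⟨MemLp.of_bound continuous_id.aestronglyMeasurable C
    (ae_restrict_of_forall_mem hΩ.measurableSet hC), fun _ => (d : ℝ), memLp_const _,
    fun v hv hc hs => ?_⟩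
  have hz : ∀ x, x ∉ Ω → x ∉ tsupport v := fun x hx h => hx (hs h)
  rw [setIntegral_eq_integral_of_forall_compl_eq_zero,
    setIntegral_eq_integral_of_forall_compl_eq_zero]
  · exact integral_fderiv_self hv hc
  · intro x hx
    rw [image_eq_zero_of_notMem_tsupport (hz x hx), mul_zero]
  · intro x hx
    have h : fderiv ℝ v x = 0 := by
      by_contra h
      exact hz x hx (support_fderiv_subset ℝ h)
    simp [h]

/-! ### Multipliers, normal continuity and piecewise constants -/

namespace Setting

variable {d N : ℕ} {ι : Type*} {Ω : Set (E d)} {cell : ι → Cell d}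
  {k : E d → Matrix (Fin d) (Fin d) ℝ} {U : Fin N → E d → E d}

lemma hasGreen_X2tilde (S : Setting Ω cell k U) {u : L2v Ω} (hu : u ∈ X2tilde Ω cell k U) (K : ι) :
    ∃ a : ℝ, HasGreen (cell K) u (fun _ => a) (normalTrace (cell K) u) := by
  obtain ⟨c, a, h⟩ := S.exists_hasGreen (hu K)
  exact ⟨a, h.congr (Filter.EventuallyEq.refl _ _) (Filter.EventuallyEq.refl _ _)
    (h.normalTrace_ae_eq S.pos).symm⟩

lemma exists_Pih_face (S : Setting Ω cell k U) {π : L2skel cell} (hπ : π ∈ Pih Ω cell k U) (K : ι)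
    (l : (cell K).FaceIdx) : ∃ γ : Fin N → ℝ, π =ᵐ[(surf d).restrict ((cell K).face l)]
      fun x => ∑ i, γ i * normalTrace (cell K) (U i) x := by
  by_cases h : (cell K).face l ⊆ frontier Ω
  · exact ⟨0, Filter.EventuallyEq.trans ((hπ K l).2 h)
      (Filter.Eventually.of_forall fun x => by simp)⟩
  · obtain ⟨u, hu, h1⟩ := (hπ K l).1 h
    obtain ⟨γ, hγ⟩ := S.exists_normalTrace_face (hu.2 K) l
    exact ⟨γ, h1.trans hγ⟩

variable [Fintype ι]

lemma Ch_eq (S : Setting Ω cell k U) {u : E d → E d} {δ g : ι → E d → ℝ}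
    (hG : ∀ K, HasGreen (cell K) u (δ K) (g K)) {π : E d → ℝ}
    (hπ : MemLp π 2 ((surf d).restrict (skeleton cell))) :
    Ch cell u π = ∫ x in skeleton cell, jump cell g x * π x ∂(surf d) := by
  rw [integral_jump_mul (fun K => (hG K).trace) hπ]
  refine Finset.sum_congr rfl fun K _ => integral_congr_ae ?_
  filter_upwards [(hG K).normalTrace_ae_eq S.pos] with x hx
  rw [hx]

lemma ae_mem_or_Pih_eq_zero (S : Setting Ω cell k U) {π : L2skel cell}
    (hπ : π ∈ Pih Ω cell k U) :
    ∀ᵐ x ∂(surf d).restrict (skeleton cell), x ∈ Ω ∨ π x = 0 := by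
  refine (ae_skeleton_iff S.pos cell).2 fun K l => ?_
  rcases face_cases S.pos S.domain S.mesh K l with h | h
  · exact ((hπ K l).2 h.1).mono fun x hx => Or.inr hx
  · exact h.2.1.mono fun x hx => Or.inl hx

/-- Almost everywhere on the skeleton one factor vanishes: the jump inside Ω, the multiplier on
faces in the boundary. -/
lemma Ch_eq_zero (S : Setting Ω cell k U) {u : L2v Ω} (hu : u ∈ X2 Ω cell k U) {π : L2skel cell}
    (hπ : π ∈ Pih Ω cell k U) : Ch cell u π = 0 := by
  choose a ha using S.hasGreen_X2tilde (u := u) hu.2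
  rw [S.Ch_eq ha (Lp.memLp π)]
  refine integral_eq_zero_of_ae ?_
  filter_upwards [S.ae_mem_or_Pih_eq_zero hπ, jump_ae_eq_zero S.pos S.domain S.mesh hu.1 ha]
    with x h1 h2
  rcases h1 with h1 | h1
  · rw [h2 h1, zero_mul, Pi.zero_apply]
  · rw [h1, mul_zero, Pi.zero_apply]

/-- Every combination of global fluxes on a face is realised by a normally continuous face field.
Membership in the multiplier space is therefore a linear condition on each face separately. -/
lemma mem_Pih_of_ae (S : Setting Ω cell k U) {π : L2skel cell}
    (h1 : ∀ K (l : (cell K).FaceIdx), ¬ (cell K).face l ⊆ frontier Ω → ∃ γ : Fin N → ℝ,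
      π =ᵐ[(surf d).restrict ((cell K).face l)] fun x => ∑ i, γ i * normalTrace (cell K) (U i) x)
    (h2 : ∀ K (l : (cell K).FaceIdx), (cell K).face l ⊆ frontier Ω →
      π =ᵐ[(surf d).restrict ((cell K).face l)] fun _ => 0) : π ∈ Pih Ω cell k U := by
  refine fun K l => ⟨fun h => ?_, h2 K l⟩
  obtain ⟨γ, hγ⟩ := h1 K l h
  obtain ⟨u, hu, h3⟩ := S.exists_face_field_X2 K l γ
  obtain ⟨b, hb⟩ := h3 K
  refine ⟨u, hu, ?_⟩
  filter_upwards [hγ, ae_face_of_ae_bdry S.pos (hb.normalTrace_ae_eq S.pos) l,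
    ae_restrict_mem ((cell K).isClosed_face l).measurableSet] with x hx1 hx2 hx3
  rw [hx1, hx2, Set.indicator_of_mem hx3]

/-- The multipliers control the jumps of the discontinuous velocities. -/
lemma mem_X2_of_Ch (S : Setting Ω cell k U) {u : L2v Ω} (hu : u ∈ X2tilde Ω cell k U)
    (h : ∀ π ∈ Pih Ω cell k U, Ch cell u π = 0) : u ∈ X2 Ω cell k U := by
  choose a ha using S.hasGreen_X2tilde hu
  have hΩm := (isOpen_of_interior_closure S.domain).measurableSet
  have hj := memLp_jump fun K => (ha K).trace
  -- The test multiplier is the jump itself, set to zero off Ω so that it vanishes on boundary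
  -- faces.
  have hm : MemLp (Ω.indicator (jump cell fun K => normalTrace (cell K) u)) 2
      ((surf d).restrict (skeleton cell)) := hj.indicator hΩm
  have hmem : hm.toLp ∈ Pih Ω cell k U := by
    have hco := (ae_skeleton_iff S.pos cell).1 hm.coeFn_toLp
    refine S.mem_Pih_of_ae (fun K l hl => ?_) fun K l hl => ?_
    · obtain ⟨-, hin, K', hne, ⟨l', hl'⟩, hK'⟩ :=
        (face_cases S.pos S.domain S.mesh K l).resolve_left fun h => hl h.1
      obtain ⟨γ, hγ⟩ := S.exists_normalTrace_face (hu K) l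
      obtain ⟨γ', hγ'⟩ := S.exists_normalTrace_face (hu K') l'
      rw [hl'] at hγ'
      -- The global fluxes seen from the two sides are opposite, so the sum of the two traces has
      -- the difference of the coefficients.
      refine ⟨fun i => γ i - γ' i, ?_⟩
      filter_upwards [hco K l, hin, hγ, hγ', jump_ae_eq_of_interior S.pos S.mesh l
        (fun K => normalTrace (cell K) u) hne ⟨l', hl'⟩ hK',
        ae_all_iff.2 fun i => S.normalTrace_fields_add l hne ⟨l', hl'⟩ hK' hin i]
        with x e1 e2 e3 e4 e5 e6
      rw [e1, Set.indicator_of_mem e2, e5, e3, e4, ← Finset.sum_add_distrib]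
      refine Finset.sum_congr rfl fun i _ => ?_
      linear_combination γ' i * e6 i
    · filter_upwards [hco K l, ae_restrict_mem ((cell K).isClosed_face l).measurableSet]
        with x e1 e2
      rw [e1, Set.indicator_of_notMem]
      intro hx
      have := hl e2
      rw [(isOpen_of_interior_closure S.domain).frontier_eq] at this
      exact this.2 hx
  refine S.mem_X2_of_jump hu ha ?_
  have h0 := h _ hmem
  rw [S.Ch_eq ha (Lp.memLp _)] at h0
  have h1 : ∫ x in skeleton cell, (Ω.indicator (jump cell fun K => normalTrace (cell K) u) x)
      * (Ω.indicator (jump cell fun K => normalTrace (cell K) u) x) ∂(surf d) = 0 := by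
    rw [← h0]
    refine integral_congr_ae ?_
    filter_upwards [hm.coeFn_toLp] with x hx
    rw [hx]
    by_cases hxΩ : x ∈ Ω <;> simp [hxΩ]
  have h2 := (integral_eq_zero_iff_of_nonneg (fun x => mul_self_nonneg _)
    (integrable_mul_L2 hm hm)).1 h1
  filter_upwards [h2] with x hx hxΩ
  simpa [hxΩ] using hx

/-- A multiplier is determined by its pairing with the discontinuous velocities. -/
lemma Pih_eq_zero (S : Setting Ω cell k U) {π : L2skel cell} (hπ : π ∈ Pih Ω cell k U)
    (h : ∀ τ ∈ X2tilde Ω cell k U, Ch cell τ π = 0) : π = 0 := by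
  classical
  refine (Lp.eq_zero_iff_ae_eq_zero).2 ((ae_skeleton_iff S.pos cell).2 fun K l => ?_)
  obtain ⟨γ, hγ⟩ := S.exists_Pih_face hπ K l
  -- This velocity has flux equal to the multiplier on the face, seen from one cell only, so the
  -- pairing is the integral of its square.
  obtain ⟨u, hu, h1⟩ := S.exists_face_field K l (fun K' => if K' = K then 1 else 0) γ
  choose b hb using h1
  have hF := (cell K).face_subset_bdry S.pos l
  have hFm := ((cell K).isClosed_face l).measurableSet
  have hπF : MemLp π 2 ((surf d).restrict ((cell K).face l)) := (Lp.memLp π).mono_measure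
    (Measure.restrict_mono (hF.trans (bdry_subset_skeleton cell K)) le_rfl)
  have h0 := h u hu
  have h2 : ∫ x in (cell K).face l, π x * π x ∂(surf d) = 0 := by
    rw [← h0, S.Ch_eq hb (Lp.memLp π), integral_jump_mul (fun K => (hb K).trace) (Lp.memLp π),
      Finset.sum_eq_single K]
    · rw [← Set.inter_eq_right.2 hF, ← setIntegral_indicator hFm, Set.inter_eq_right.2 hF,
        ← integral_indicator ((cell K).isClosed_bdry.measurableSet),
        ← integral_indicator ((cell K).isClosed_bdry.measurableSet)]
      have hγ' := (ae_restrict_iff' hFm).1 hγ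
      refine integral_congr_ae ?_
      filter_upwards [hγ'] with x hx
      by_cases hxF : x ∈ (cell K).face l
      · simp [hxF, hF hxF, hx hxF]
      · simp [Set.indicator, hxF]
    · intro K' _ hne
      simp [Set.indicator, hne]
    · simp
  have h3 := (integral_eq_zero_iff_of_nonneg (fun x => mul_self_nonneg _)
    (integrable_mul_L2 hπF hπF)).1 h2
  exact h3.mono fun x hx => mul_self_eq_zero.1 hx

lemma brokenDiv_eq {u : E d → E d} {a : ι → ℝ} {g : ι → E d → ℝ}
    (hG : ∀ K, HasGreen (cell K) u (fun _ => a K) (g K)) {p : E d → ℝ} {c : ι → ℝ}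
    (hp : ∀ K, p =ᵐ[volume.restrict (cell K).dom] fun _ => c K) :
    brokenDiv cell u p = ∑ K, c K * ∫ x in (cell K).bdry, g K x ∂(surf d) := by
  refine Finset.sum_congr rfl fun K _ => ?_
  rw [(hG K).integral_trace, ← integral_const_mul]
  refine integral_congr_ae ?_
  filter_upwards [hp K, (hG K).wdiv_ae_eq] with x h1 h2
  rw [h1, h2, mul_comm]

lemma sum_mul_integral (hd : 1 ≤ d) (c : ι → ℝ) {g : ι → E d → ℝ}
    (hg : ∀ K, MemLp (g K) 2 ((surf d).restrict (cell K).bdry)) :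
    ∑ K, c K * ∫ x in (cell K).bdry, g K x ∂(surf d)
      = ∫ x in skeleton cell, jump cell (fun K x => c K * g K x) x ∂(surf d) := by
  have := isFiniteMeasure_skeleton hd cell
  have h := integral_jump_mul (g := fun K x => c K * g K x) (π := fun _ => 1)
    (fun K => (hg K).const_mul (c K)) (memLp_const 1)
  simp only [mul_one] at h
  rw [h]
  exact Finset.sum_congr rfl fun K _ => (integral_const_mul _ _).symm

lemma sum_mul_integral_face (S : Setting Ω cell k U) (c : ι → ℝ) {g : ι → E d → ℝ} (K₀ : ι)
    (l : (cell K₀).FaceIdx)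
    (hg : ∀ K, MemLp (((cell K₀).face l).indicator (g K)) 2 ((surf d).restrict (cell K).bdry)) :
    ∑ K, c K * ∫ x in (cell K).bdry, ((cell K₀).face l).indicator (g K) x ∂(surf d)
      = ∫ x in (cell K₀).face l, jump cell (fun K x => c K * g K x) x ∂(surf d) := by
  have hFm := ((cell K₀).isClosed_face l).measurableSet
  have hF := ((cell K₀).face_subset_bdry S.pos l).trans (bdry_subset_skeleton cell K₀)
  rw [sum_mul_integral S.pos c hg, ← Set.inter_eq_right.2 hF, ← setIntegral_indicator hFm,
    Set.inter_eq_right.2 hF]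
  congr 1
  ext x
  by_cases hx : x ∈ (cell K₀).face l <;> simp [jump, Set.indicator, hx]

/-- Piecewise constants are controlled by the divergences of the velocities. -/
lemma Qh_eq_zero (S : Setting Ω cell k U) (hN : 1 ≤ N) {p : L2 Ω} (hp : p ∈ Qh Ω cell)
    (h : ∀ τ ∈ X2 Ω cell k U, brokenDiv cell τ p = 0) : p = 0 := by
  choose c hc using hp
  have hΩo := isOpen_of_interior_closure S.domain
  let i₀ : Fin N := ⟨0, hN⟩
  have hface : ∀ K (l : (cell K).FaceIdx), ∫ x in (cell K).face l,
      jump cell (fun K x => c K * normalTrace (cell K) (U i₀) x) x ∂(surf d) = 0 := by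
    intro K l
    -- One global field suffices: its face field is admissible, and its nonzero total flux is what
    -- permits cancelling it below.
    obtain ⟨u, hu, h1⟩ := S.exists_face_field_X2 K l (Pi.single i₀ 1)
    choose b hb using h1
    simp only [Pi.single_apply, ite_mul, one_mul, zero_mul, Finset.sum_ite_eq', Finset.mem_univ,
      if_true] at hb
    rw [← S.sum_mul_integral_face c K l fun K => (hb K).trace, ← brokenDiv_eq hb hc, h u hu]
  have hbd : ∀ K (l : (cell K).FaceIdx),
      (∀ K', HasFace (cell K') ((cell K).face l) → K' = K) → c K = 0 := by
    intro K l hl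
    have h1 := hface K l
    rw [integral_congr_ae (jump_ae_eq_of_boundary S.pos S.mesh K l _ hl), integral_const_mul] at h1
    exact (mul_eq_zero.1 h1).resolve_right (S.fields.flux_ne_zero i₀ K l)
  have hint : ∀ K K' (l : (cell K).FaceIdx), K' ≠ K → HasFace (cell K') ((cell K).face l) →
      (∀ K'', HasFace (cell K'') ((cell K).face l) → K'' = K ∨ K'' = K') →
      (∀ᵐ x ∂(surf d).restrict ((cell K).face l), x ∈ Ω) → c K' = c K := by
    intro K K' l hne hK' hall hin
    have h1 := hface K l
    rw [integral_congr_ae (jump_ae_eq_of_interior S.pos S.mesh l _ hne hK' hall)] at h1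
    have h2 : ∫ x in (cell K).face l, (c K * normalTrace (cell K) (U i₀) x
        + c K' * normalTrace (cell K') (U i₀) x) ∂(surf d)
        = ∫ x in (cell K).face l, (c K - c K') * normalTrace (cell K) (U i₀) x ∂(surf d) := by
      refine integral_congr_ae ?_
      filter_upwards [S.normalTrace_fields_add l hne hK' hall hin i₀] with x hx
      linear_combination c K' * hx
    rw [h2, integral_const_mul] at h1
    exact (sub_eq_zero.1 ((mul_eq_zero.1 h1).resolve_right (S.fields.flux_ne_zero i₀ K l))).symm
  -- Replaces an argument along chains of cells. The values c_K² match across interior faces and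
  -- vanish at boundary faces, so c² times the flux of the position field has zero jump; yet each
  -- cell contributes c_K² d |K|.
  choose g hg using fun K => hasGreen_id S.pos (cell K)
  have hbdd : Bornology.IsBounded Ω := by
    have h1 : IsCompact (closure Ω) := by
      rw [← S.mesh.cover]
      exact isCompact_iUnion fun K => (cell K).isCompact_carrier
    exact h1.isBounded.subset subset_closure
  have hid := jump_ae_eq_zero S.pos S.domain S.mesh (memHdiv_id hΩo hbdd) hg
  have hsum : ∑ K, c K ^ 2 * ∫ x in (cell K).bdry, g K x ∂(surf d) = 0 := by
    rw [sum_mul_integral S.pos _ fun K => (hg K).trace]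
    refine integral_eq_zero_of_ae ((ae_skeleton_iff S.pos cell).2 fun K l => ?_)
    rcases face_cases S.pos S.domain S.mesh K l with ⟨-, hl⟩ | ⟨-, hin, K', hne, hK', hall⟩
    · filter_upwards [jump_ae_eq_of_boundary S.pos S.mesh K l
        (fun K x => c K ^ 2 * g K x) hl] with x hx
      rw [hx, hbd K l hl]
      simp
    · filter_upwards [jump_ae_eq_of_interior S.pos S.mesh l (fun K x => c K ^ 2 * g K x) hne hK'
        hall, jump_ae_eq_of_interior S.pos S.mesh l g hne hK' hall, hin,
        (ae_skeleton_iff S.pos cell).1 hid K l] with x e1 e2 e3 e4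
      rw [e1, hint K K' l hne hK' hall hin, ← mul_add, ← e2, e4 e3, mul_zero, Pi.zero_apply]
  have hpos : ∀ K, 0 < ∫ x in (cell K).bdry, g K x ∂(surf d) := by
    intro K
    rw [(hg K).integral_trace, setIntegral_const, smul_eq_mul,
      measureReal_congr (cell K).dom_ae_eq_carrier]
    exact mul_pos ((cell K).volume_real_pos S.pos) (by exact_mod_cast S.pos)
  have hc0 : ∀ K, c K = 0 := by
    intro K
    have := (Finset.sum_eq_zero_iff_of_nonneg
      (fun K _ => mul_nonneg (sq_nonneg (c K)) (hpos K).le)).1 hsum K (Finset.mem_univ K)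
    exact pow_eq_zero_iff two_ne_zero |>.1 ((mul_eq_zero.1 this).resolve_right (hpos K).ne')
  refine (Lp.eq_zero_iff_ae_eq_zero).2 ((ae_domain_iff S.domain S.mesh).2 fun K => ?_)
  filter_upwards [hc K] with x hx
  rw [hx, hc0, Pi.zero_apply]

end Setting

/-! ### Abstract hybridized expanded mixed problems -/

/-- The structural properties of a hybridized expanded mixed problem in Hilbert spaces: the
operator `T` is coercive and maps the space `X₁` onto the velocity space `X`, the divergence `D`
maps into the pressure space `M` and controls it on the kernel of the constraint, and the jump `J`
controls the multiplier space `P`. -/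
structure IsHybridSystem {H Q L : Type*} [NormedAddCommGroup H] [InnerProductSpace ℝ H]
    [NormedAddCommGroup Q] [InnerProductSpace ℝ Q] [NormedAddCommGroup L] [InnerProductSpace ℝ L]
    (X₁ X : Submodule ℝ H) (M : Submodule ℝ Q) (P : Submodule ℝ L) (T : H →L[ℝ] H)
    (D : X →ₗ[ℝ] Q) (J : X →ₗ[ℝ] L) : Prop where
  coercive : ∃ α : ℝ, 0 < α ∧ ∀ ζ, α * ‖ζ‖ ^ 2 ≤ inner ℝ (T ζ) ζ
  finite : FiniteDimensional ℝ X
  map_mem : ∀ θ ∈ X₁, T θ ∈ X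
  exists_map : ∀ u ∈ X, ∃ θ ∈ X₁, T θ = u
  div_mem : ∀ τ, D τ ∈ M
  pressure : ∀ p ∈ M, (∀ τ, (∀ π ∈ P, inner ℝ (J τ) π = 0) → inner ℝ (D τ) p = 0) → p = 0
  multiplier : ∀ π ∈ P, (∀ τ, inner ℝ (J τ) π = 0) → π = 0

namespace IsHybridSystem

variable {H Q L : Type*} [NormedAddCommGroup H] [InnerProductSpace ℝ H]
  [NormedAddCommGroup Q] [InnerProductSpace ℝ Q] [NormedAddCommGroup L] [InnerProductSpace ℝ L]
  {X₁ X : Submodule ℝ H} {M : Submodule ℝ Q} {P : Submodule ℝ L} {T : H →L[ℝ] H}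
  {D : X →ₗ[ℝ] Q} {J : X →ₗ[ℝ] L}

lemma eq_zero_of_inner (h : IsHybridSystem X₁ X M P T D J) {ζ : H} (h0 : inner ℝ (T ζ) ζ = 0) :
    ζ = 0 := by
  obtain ⟨α, hα, hc⟩ := h.coercive
  have h1 := hc ζ
  rw [h0] at h1
  by_contra hn
  have : 0 < ‖ζ‖ := norm_pos_iff.2 hn
  have : 0 < α * ‖ζ‖ ^ 2 := by positivity
  linarith

/-- The constrained problem with zero source has only the zero solution. -/
lemma eq_zero (h : IsHybridSystem X₁ X M P T D J) {θ : H} {u : X} {p : Q} (hθ : θ ∈ X₁)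
    (hu : ∀ π ∈ P, inner ℝ (J u) π = 0) (hp : p ∈ M)
    (h1 : ∀ ξ ∈ X₁, inner ℝ (T θ) ξ + inner ℝ (u : H) ξ = 0)
    (h2 : ∀ τ : X, (∀ π ∈ P, inner ℝ (J τ) π = 0) → inner ℝ θ (τ : H) + inner ℝ (D τ) p = 0)
    (h3 : ∀ q ∈ M, inner ℝ (D u) q = 0) : θ = 0 ∧ u = 0 ∧ p = 0 := by
  -- The divergence of a velocity is an admissible pressure and may be used as its own test
  -- function.
  have hDu : D u = 0 := inner_self_eq_zero.1 (h3 _ (h.div_mem u))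
  have e2 := h2 u hu
  rw [hDu, inner_zero_left, add_zero] at e2
  have e1 := h1 θ hθ
  rw [real_inner_comm, real_inner_comm θ, e2, add_zero, real_inner_comm] at e1
  have hθ0 : θ = 0 := h.eq_zero_of_inner e1
  subst hθ0
  -- Once θ = 0, the first equation makes u orthogonal to X₁. Writing u as the image of an element
  -- of X₁ and testing with that element invokes coercivity again.
  obtain ⟨ζ, hζ, hζu⟩ := h.exists_map u u.2
  have e3 := h1 ζ hζ
  rw [map_zero, inner_zero_left, zero_add, ← hζu] at e3
  have hu0 : u = 0 := by
    ext
    rw [← hζu, h.eq_zero_of_inner e3, map_zero, Submodule.coe_zero]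
  refine ⟨rfl, hu0, h.pressure p hp fun τ hτ => ?_⟩
  have := h2 τ hτ
  rwa [inner_zero_left, zero_add] at this

/-- The hybridized problem has a solution. -/
lemma exists_solution (h : IsHybridSystem X₁ X M P T D J) (F : Q) :
    ∃ θ ∈ X₁, ∃ u : X, ∃ p ∈ M, ∃ μ ∈ P,
      (∀ ξ ∈ X₁, inner ℝ (T θ) ξ + inner ℝ (u : H) ξ = 0) ∧
      (∀ τ : X, inner ℝ θ (τ : H) + inner ℝ (D τ) p = inner ℝ (J τ) μ) ∧
      (∀ q ∈ M, inner ℝ (D u) q = inner ℝ F q) ∧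
      ∀ π ∈ P, inner ℝ (J u) π = 0 := by
  have := h.finite
  -- The other three spaces inherit finite dimension from the velocity space: X₁ embeds in it by
  -- coercivity, pressures and multipliers embed in its dual by the two injectivity properties.
  have : FiniteDimensional ℝ X₁ := by
    let A : X₁ →ₗ[ℝ] X := (T.toLinearMap.domRestrict X₁).codRestrict X fun θ => h.map_mem θ θ.2
    refine Module.Finite.of_injective A ((injective_iff_map_eq_zero A).2 fun θ hθ => ?_)
    have hT : T θ = 0 := congrArg Subtype.val hθ
    ext
    exact h.eq_zero_of_inner (by rw [hT, inner_zero_left])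
  have : FiniteDimensional ℝ M := by
    let A : M →ₗ[ℝ] X →ₗ[ℝ] ℝ := LinearMap.mk₂ ℝ (fun p τ => inner ℝ (D τ) (p : Q))
      (by intros; simp [inner_add_right]) (by intros; simp [inner_smul_right])
      (by intros; simp [inner_add_left]) (by intros; simp [inner_smul_left])
    refine Module.Finite.of_injective A ((injective_iff_map_eq_zero A).2 fun p hp => ?_)
    ext
    exact h.pressure p p.2 fun τ _ => LinearMap.congr_fun hp τ
  have : FiniteDimensional ℝ P := by
    let A : P →ₗ[ℝ] X →ₗ[ℝ] ℝ := LinearMap.mk₂ ℝ (fun p τ => inner ℝ (J τ) (p : L))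
      (by intros; simp [inner_add_right]) (by intros; simp [inner_smul_right])
      (by intros; simp [inner_add_left]) (by intros; simp [inner_smul_left])
    refine Module.Finite.of_injective A ((injective_iff_map_eq_zero A).2 fun p hp => ?_)
    ext
    exact h.multiplier p p.2 fun τ => LinearMap.congr_fun hp τ
  let B : (X₁ × X × M × P) →ₗ[ℝ] (X₁ × X × M × P) →ₗ[ℝ] ℝ := LinearMap.mk₂ ℝ (fun s t =>
      (inner ℝ (T s.1) (t.1 : H) + inner ℝ (s.2.1 : H) (t.1 : H)) +
      (inner ℝ (s.1 : H) (t.2.1 : H) + inner ℝ (D t.2.1) (s.2.2.1 : Q)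
        - inner ℝ (J t.2.1) (s.2.2.2 : L)) +
      inner ℝ (D s.2.1) (t.2.2.1 : Q) + inner ℝ (J s.2.1) (t.2.2.2 : L))
    (by intros; simp [inner_add_left, inner_add_right]; ring)
    (by intros; simp [inner_smul_left, inner_smul_right]; ring)
    (by intros; simp [inner_add_left, inner_add_right]; ring)
    (by intros; simp [inner_smul_left, inner_smul_right]; ring)
  have hB : ∀ s t, B s t =
      (inner ℝ (T s.1) (t.1 : H) + inner ℝ (s.2.1 : H) (t.1 : H)) +
      (inner ℝ (s.1 : H) (t.2.1 : H) + inner ℝ (D t.2.1) (s.2.2.1 : Q)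
        - inner ℝ (J t.2.1) (s.2.2.2 : L)) +
      inner ℝ (D s.2.1) (t.2.2.1 : Q) + inner ℝ (J s.2.1) (t.2.2.2 : L) := fun s t => rfl
  -- The four equations form one square linear system, the form being viewed as a map into the dual;
  -- trivial kernel gives solvability for every right-hand side.
  have hinj : Function.Injective B := by
    refine (injective_iff_map_eq_zero B).2 fun s hs => ?_
    have hs' : ∀ t, B s t = 0 := fun t => LinearMap.congr_fun hs t
    have e1 : ∀ ξ ∈ X₁, inner ℝ (T s.1) ξ + inner ℝ (s.2.1 : H) ξ = 0 := fun ξ hξ => by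
      simpa [hB] using hs' (⟨ξ, hξ⟩, 0, 0, 0)
    have e2 : ∀ τ : X, inner ℝ (s.1 : H) (τ : H) + inner ℝ (D τ) (s.2.2.1 : Q)
        - inner ℝ (J τ) (s.2.2.2 : L) = 0 := fun τ => by
      simpa [hB] using hs' (0, τ, 0, 0)
    have e3 : ∀ q ∈ M, inner ℝ (D s.2.1) q = 0 := fun q hq => by
      simpa [hB] using hs' (0, 0, ⟨q, hq⟩, 0)
    have e4 : ∀ π ∈ P, inner ℝ (J s.2.1) π = 0 := fun π hπ => by
      simpa [hB] using hs' (0, 0, 0, ⟨π, hπ⟩)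
    obtain ⟨hθ, hu, hp⟩ := h.eq_zero s.1.2 e4 s.2.2.1.2 e1
      (fun τ hτ => by simpa [hτ _ s.2.2.2.2] using e2 τ) e3
    have hμ : (s.2.2.2 : L) = 0 := h.multiplier _ s.2.2.2.2 fun τ => by
      have := e2 τ
      rw [hθ, hp, inner_zero_left, inner_zero_right] at this
      linarith
    exact Prod.ext (Subtype.ext hθ) (Prod.ext hu (Prod.ext (Subtype.ext hp) (Subtype.ext hμ)))
  have hsurj : Function.Surjective B :=
    (LinearMap.injective_iff_surjective_of_finrank_eq_finrank
      (Subspace.dual_finrank_eq (K := ℝ) (V := X₁ × X × M × P)).symm).1 hinj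
  let ℓ : (X₁ × X × M × P) →ₗ[ℝ] ℝ := (innerₗ Q F) ∘ₗ M.subtype ∘ₗ LinearMap.fst ℝ M P ∘ₗ
    LinearMap.snd ℝ X (M × P) ∘ₗ LinearMap.snd ℝ X₁ (X × M × P)
  obtain ⟨s, hs⟩ := hsurj ℓ
  have hs' : ∀ t : X₁ × X × M × P, B s t = inner ℝ F (t.2.2.1 : Q) := fun t => LinearMap.congr_fun hs t
  refine ⟨s.1, s.1.2, s.2.1, s.2.2.1, s.2.2.1.2, s.2.2.2, s.2.2.2.2, fun ξ hξ => ?_, fun τ => ?_,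
    fun q hq => ?_, fun π hπ => ?_⟩
  · simpa [hB] using hs' (⟨ξ, hξ⟩, 0, 0, 0)
  · exact sub_eq_zero.1 (by simpa [hB] using hs' (0, τ, 0, 0))
  · simpa [hB] using hs' (0, 0, ⟨q, hq⟩, 0)
  · simpa [hB] using hs' (0, 0, 0, ⟨π, hπ⟩)

end IsHybridSystem

/-! ### The finite element spaces as subspaces -/

section Spaces

variable {d N : ℕ} {ι : Type*} {Ω : Set (E d)} {cell : ι → Cell d}
  {k : E d → Matrix (Fin d) (Fin d) ℝ} {U : Fin N → E d → E d}

/-- The subspace of `L²(S)` of the functions that agree on each part with an element of a given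
space. -/
def piecewise {X F κ : Type*} [MeasurableSpace X] [NormedAddCommGroup F] [NormedSpace ℝ F]
    {μ : Measure X} (ν : κ → Measure X) (hν : ∀ j, ν j ≪ μ) (S : κ → Submodule ℝ (X → F)) :
    Submodule ℝ (Lp F 2 μ) where
  carrier := {u | ∀ j, ∃ s ∈ S j, u =ᵐ[ν j] s}
  zero_mem' j := ⟨0, zero_mem _, (hν j).ae_le (Lp.coeFn_zero F 2 μ)⟩
  add_mem' := by
    intro u v hu hv j
    obtain ⟨s, hs, hus⟩ := hu j
    obtain ⟨t, ht, hvt⟩ := hv j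
    exact ⟨s + t, add_mem hs ht,
      Filter.EventuallyEq.trans ((hν j).ae_le (Lp.coeFn_add u v)) (hus.add hvt)⟩
  smul_mem' := by
    intro c u hu j
    obtain ⟨s, hs, hus⟩ := hu j
    exact ⟨c • s, Submodule.smul_mem _ c hs,
      Filter.EventuallyEq.trans ((hν j).ae_le (Lp.coeFn_smul c u)) (hus.const_smul c)⟩

lemma restrict_dom_absolutelyContinuous (hΩ : interior (closure Ω) = Ω) (hmesh : IsMesh Ω cell)
    (K : ι) : volume.restrict (cell K).dom ≪ volume.restrict Ω :=
  Measure.absolutelyContinuous_of_le (Measure.restrict_mono (hmesh.dom_subset hΩ K) le_rfl)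

namespace Setting

/-- `X₁` as a subspace. -/
def spaceX1 (S : Setting Ω cell k U) : Submodule ℝ (L2v Ω) :=
  piecewise (fun K => volume.restrict (cell K).dom)
    (restrict_dom_absolutelyContinuous S.domain S.mesh) fun K => etaSpan k U (cell K)

/-- The discontinuous velocity space as a subspace. -/
def spaceX2 (S : Setting Ω cell k U) : Submodule ℝ (L2v Ω) :=
  piecewise (fun K => volume.restrict (cell K).dom)
    (restrict_dom_absolutelyContinuous S.domain S.mesh) fun K => psiSpan k U (cell K)

/-- `Q_h` as a subspace. -/
def spaceQ (S : Setting Ω cell k U) : Submodule ℝ (L2 Ω) :=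
  piecewise (fun K => volume.restrict (cell K).dom)
    (restrict_dom_absolutelyContinuous S.domain S.mesh)
    fun _ => LinearMap.range (LinearMap.pi fun _ : E d => LinearMap.id (R := ℝ) (M := ℝ))

lemma mem_spaceQ (S : Setting Ω cell k U) {q : L2 Ω} : q ∈ S.spaceQ ↔ q ∈ Qh Ω cell := by
  refine forall_congr' fun K => ⟨?_, ?_⟩
  · rintro ⟨_, ⟨c, rfl⟩, h⟩
    exact ⟨c, h⟩
  · rintro ⟨c, h⟩
    exact ⟨_, ⟨c, rfl⟩, h⟩

/-! ### The broken divergence and the jump -/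

lemma hasGreen_wdiv (S : Setting Ω cell k U) {u : L2v Ω} (hu : u ∈ S.spaceX2) (K : ι) :
    HasGreen (cell K) u (wdiv (cell K).dom u) (normalTrace (cell K) u) := by
  obtain ⟨a, h⟩ := S.hasGreen_X2tilde hu K
  exact h.hasNormalTrace.hasGreen

lemma hasGreen_add (S : Setting Ω cell k U) {u v : L2v Ω} (hu : u ∈ S.spaceX2) (hv : v ∈ S.spaceX2)
    (K : ι) : HasGreen (cell K) (u + v : L2v Ω)
      (wdiv (cell K).dom u + wdiv (cell K).dom v)
      (normalTrace (cell K) u + normalTrace (cell K) v) :=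
  ((S.hasGreen_wdiv hu K).add S.pos (S.hasGreen_wdiv hv K)).congr
    (Filter.EventuallyEq.symm ((restrict_dom_absolutelyContinuous S.domain S.mesh K).ae_le
      (Lp.coeFn_add u v))) (Filter.EventuallyEq.refl _ _) (Filter.EventuallyEq.refl _ _)

lemma hasGreen_smul (S : Setting Ω cell k U) {u : L2v Ω} (hu : u ∈ S.spaceX2) (c : ℝ) (K : ι) :
    HasGreen (cell K) (c • u : L2v Ω) (c • wdiv (cell K).dom u) (c • normalTrace (cell K) u) :=
  ((S.hasGreen_wdiv hu K).smul c).congr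
    (Filter.EventuallyEq.symm ((restrict_dom_absolutelyContinuous S.domain S.mesh K).ae_le
      (Lp.coeFn_smul c u))) (Filter.EventuallyEq.refl _ _) (Filter.EventuallyEq.refl _ _)

variable [Fintype ι]

/-- The multiplier space as a subspace. -/
def spacePi (S : Setting Ω cell k U) : Submodule ℝ (L2skel cell) where
  carrier := Pih Ω cell k U
  zero_mem' := by
    have h := (ae_skeleton_iff S.pos cell).1 (Lp.coeFn_zero ℝ 2 ((surf d).restrict (skeleton cell)))
    exact S.mem_Pih_of_ae (fun K l _ => ⟨0, (h K l).mono fun x hx => by simpa using hx⟩)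
      fun K l _ => h K l
  add_mem' := by
    intro π π' hπ hπ'
    have h := (ae_skeleton_iff S.pos cell).1 (Lp.coeFn_add π π')
    refine S.mem_Pih_of_ae (fun K l _ => ?_) fun K l hl => ?_
    · obtain ⟨γ, hγ⟩ := S.exists_Pih_face hπ K l
      obtain ⟨γ', hγ'⟩ := S.exists_Pih_face hπ' K l
      refine ⟨γ + γ', ?_⟩
      filter_upwards [h K l, hγ, hγ'] with x h1 h2 h3
      rw [h1, Pi.add_apply, h2, h3]
      simp [add_mul, Finset.sum_add_distrib]
    · filter_upwards [h K l, (hπ K l).2 hl, (hπ' K l).2 hl] with x h1 h2 h3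
      rw [h1, Pi.add_apply, h2, h3, add_zero]
  smul_mem' := by
    intro c π hπ
    have h := (ae_skeleton_iff S.pos cell).1 (Lp.coeFn_smul c π)
    refine S.mem_Pih_of_ae (fun K l _ => ?_) fun K l hl => ?_
    · obtain ⟨γ, hγ⟩ := S.exists_Pih_face hπ K l
      refine ⟨c • γ, ?_⟩
      filter_upwards [h K l, hγ] with x h1 h2
      simp [h1, h2, Finset.mul_sum, mul_assoc]
    · filter_upwards [h K l, (hπ K l).2 hl] with x h1 h2
      simp [h1, h2]

/-- Gluing fixed basis functions is linear in finitely many coefficients, and its range contains the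
space because each restriction to a cell is almost everywhere such a combination. -/
lemma finiteDimensional_spaceX2 (S : Setting Ω cell k U) : FiniteDimensional ℝ S.spaceX2 := by
  choose Ψ h1 h2 h3 using S.exists_psi_basis
  have hm : ∀ c : ∀ K, Fin N × (cell K).FaceIdx → ℝ,
      MemLp (glue cell fun K => ∑ p, c K p • Ψ K p) 2 (volume.restrict Ω) := fun c =>
    memLp_glue S.domain S.mesh fun K => (HasGreen.combo S.pos (h2 K) (c K)).field
  let Φ : (∀ K, Fin N × (cell K).FaceIdx → ℝ) →ₗ[ℝ] L2v Ω :=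
    { toFun := fun c => (hm c).toLp
      map_add' := fun c c' => by
        rw [← MemLp.toLp_add (hm c) (hm c'), MemLp.toLp_eq_toLp_iff]
        refine (ae_domain_iff S.domain S.mesh).2 fun K => ?_
        filter_upwards [glue_ae_eq S.mesh (fun K => ∑ p, (c + c') K p • Ψ K p) K,
          glue_ae_eq S.mesh (fun K => ∑ p, c K p • Ψ K p) K,
          glue_ae_eq S.mesh (fun K => ∑ p, c' K p • Ψ K p) K] with x e1 e2 e3
        refine e1.trans (Eq.trans ?_ (congrArg₂ (· + ·) e2 e3).symm)
        simp [add_smul, Finset.sum_add_distrib]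
      map_smul' := fun a c => by
        rw [RingHom.id_apply, ← MemLp.toLp_const_smul a (hm c), MemLp.toLp_eq_toLp_iff]
        refine (ae_domain_iff S.domain S.mesh).2 fun K => ?_
        filter_upwards [glue_ae_eq S.mesh (fun K => ∑ p, (a • c) K p • Ψ K p) K,
          glue_ae_eq S.mesh (fun K => ∑ p, c K p • Ψ K p) K] with x e1 e2
        refine e1.trans (Eq.trans ?_ (congrArg (a • ·) e2).symm)
        simp [Finset.smul_sum, mul_smul] }
  refine Submodule.finiteDimensional_of_le (S₂ := LinearMap.range Φ) fun u hu => ?_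
  choose s hs hus using hu
  choose c hc using fun K => h3 K (s K) (hs K)
  refine ⟨c, Lp.ext ((ae_domain_iff S.domain S.mesh).2 fun K => ?_)⟩
  filter_upwards [(ae_domain_iff S.domain S.mesh).1 (hm c).coeFn_toLp K,
    glue_ae_eq S.mesh (fun K => ∑ p, c K p • Ψ K p) K, hus K, hc K] with x e1 e2 e3 e4
  rw [e3, e4, ← e2]
  exact e1

lemma memLp_div (S : Setting Ω cell k U) (u : S.spaceX2) :
    MemLp (glue cell fun K => wdiv (cell K).dom (u : L2v Ω)) 2 (volume.restrict Ω) :=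
  memLp_glue S.domain S.mesh fun K => (S.hasGreen_wdiv u.2 K).div

lemma memLp_jumpTrace (S : Setting Ω cell k U) (u : S.spaceX2) :
    MemLp (jump cell fun K => normalTrace (cell K) (u : L2v Ω)) 2
      ((surf d).restrict (skeleton cell)) :=
  memLp_jump fun K => (S.hasGreen_wdiv u.2 K).trace

/-- The divergence, cell by cell, of the discontinuous velocities. -/
def divMap (S : Setting Ω cell k U) : S.spaceX2 →ₗ[ℝ] L2 Ω where
  toFun u := (S.memLp_div u).toLp
  map_add' u v := by
    rw [← MemLp.toLp_add (S.memLp_div u) (S.memLp_div v), MemLp.toLp_eq_toLp_iff]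
    refine (ae_domain_iff S.domain S.mesh).2 fun K => ?_
    filter_upwards [glue_ae_eq S.mesh (fun K => wdiv (cell K).dom (u + v : S.spaceX2)) K,
      glue_ae_eq S.mesh (fun K => wdiv (cell K).dom (u : L2v Ω)) K,
      glue_ae_eq S.mesh (fun K => wdiv (cell K).dom (v : L2v Ω)) K,
      (S.hasGreen_add u.2 v.2 K).wdiv_ae_eq] with x e1 e2 e3 e4
    rw [e1, Pi.add_apply, e2, e3]
    exact e4
  map_smul' c u := by
    rw [RingHom.id_apply, ← MemLp.toLp_const_smul c (S.memLp_div u), MemLp.toLp_eq_toLp_iff]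
    refine (ae_domain_iff S.domain S.mesh).2 fun K => ?_
    filter_upwards [glue_ae_eq S.mesh (fun K => wdiv (cell K).dom (c • u : S.spaceX2)) K,
      glue_ae_eq S.mesh (fun K => wdiv (cell K).dom (u : L2v Ω)) K,
      (S.hasGreen_smul u.2 c K).wdiv_ae_eq] with x e1 e2 e4
    rw [e1, Pi.smul_apply, e2]
    exact e4

end Setting

lemma jump_congr [Fintype ι] {g g' : ι → E d → ℝ}
    (h : ∀ K, g K =ᵐ[(surf d).restrict (cell K).bdry] g' K) :
    jump cell g =ᵐ[(surf d).restrict (skeleton cell)] jump cell g' := by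
  have h1 : ∀ᵐ x ∂(surf d).restrict (skeleton cell), ∀ K, x ∈ (cell K).bdry → g K x = g' K x :=
    ae_all_iff.2 fun K => ae_restrict_of_ae
      ((ae_restrict_iff' (cell K).isClosed_bdry.measurableSet).1 (h K))
  filter_upwards [h1] with x hx
  refine Finset.sum_congr rfl fun K _ => ?_
  by_cases hK : x ∈ (cell K).bdry
  · rw [Set.indicator_of_mem hK, Set.indicator_of_mem hK, hx K hK]
  · rw [Set.indicator_of_notMem hK, Set.indicator_of_notMem hK]

namespace Setting

variable [Fintype ι]

/-- The jump of the normal components of the discontinuous velocities. -/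
def jumpMap (S : Setting Ω cell k U) : S.spaceX2 →ₗ[ℝ] L2skel cell where
  toFun u := (S.memLp_jumpTrace u).toLp
  map_add' u v := by
    rw [← MemLp.toLp_add (S.memLp_jumpTrace u) (S.memLp_jumpTrace v), MemLp.toLp_eq_toLp_iff]
    refine (jump_congr fun K => (S.hasGreen_add u.2 v.2 K).normalTrace_ae_eq S.pos).trans
      (Filter.Eventually.of_forall fun x => ?_)
    simp only [jump, Pi.add_apply, ← Finset.sum_add_distrib, Set.indicator_add']
  map_smul' c u := by
    rw [RingHom.id_apply, ← MemLp.toLp_const_smul c (S.memLp_jumpTrace u),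
      MemLp.toLp_eq_toLp_iff]
    refine (jump_congr fun K => (S.hasGreen_smul u.2 c K).normalTrace_ae_eq S.pos).trans
      (Filter.Eventually.of_forall fun x => ?_)
    simp only [jump, Pi.smul_apply, Finset.smul_sum]
    exact Finset.sum_congr rfl fun K _ => Set.indicator_const_smul_apply _ c _ x

lemma inner_divMap (S : Setting Ω cell k U) (u : S.spaceX2) {q : E d → ℝ}
    (hq : MemLp q 2 (volume.restrict Ω)) :
    inner ℝ (S.divMap u) hq.toLp = brokenDiv cell (u : L2v Ω) q := by
  change inner ℝ (S.memLp_div u).toLp hq.toLp = _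
  rw [inner_toLp_toLp, setIntegral_domain S.domain S.mesh (integrable_inner_L2 (S.memLp_div u) hq)]
  refine Finset.sum_congr rfl fun K _ => integral_congr_ae ?_
  filter_upwards [glue_ae_eq S.mesh (fun K => wdiv (cell K).dom (u : L2v Ω)) K] with x hx
  rw [hx]
  exact mul_comm _ _

lemma inner_divMap_Lp (S : Setting Ω cell k U) (u : S.spaceX2) (q : L2 Ω) :
    inner ℝ (S.divMap u) q = brokenDiv cell (u : L2v Ω) q := by
  rw [← S.inner_divMap u (Lp.memLp q), Lp.toLp_coeFn]

lemma inner_jumpMap (S : Setting Ω cell k U) (u : S.spaceX2) (π : L2skel cell) :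
    inner ℝ (S.jumpMap u) π = Ch cell (u : L2v Ω) π := by
  rw [S.Ch_eq (S.hasGreen_wdiv u.2) (Lp.memLp π), L2.inner_def]
  refine integral_congr_ae ?_
  filter_upwards [(S.memLp_jumpTrace u).coeFn_toLp] with x hx
  change inner ℝ ((MemLp.toLp _ (S.memLp_jumpTrace u) : E d → ℝ) x) (π x) = _
  rw [hx]
  exact mul_comm _ _

lemma brokenDiv_eq_integral (S : Setting Ω cell k U) {u : L2v Ω} (hu : u ∈ X2 Ω cell k U) {q : E d → ℝ}
    (hq : MemLp q 2 (volume.restrict Ω)) :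
    brokenDiv cell u q = ∫ x in Ω, wdiv Ω u x * q x := by
  rw [setIntegral_domain S.domain S.mesh (integrable_mul_L2 hu.1.isWeakDiv.1 hq)]
  refine Finset.sum_congr rfl fun K _ => integral_congr_ae ?_
  filter_upwards [hu.1.wdiv_ae_eq_mono (cell K).isOpen_dom (S.mesh.dom_subset S.domain K)]
    with x hx
  rw [hx]

/-- The exactness of the hybridization: the multiplier space is large enough to enforce normal
continuity and contains nothing that constrains X₂ further. -/
lemma mem_X2_iff (S : Setting Ω cell k U) (u : S.spaceX2) :
    (u : L2v Ω) ∈ X2 Ω cell k U ↔ ∀ π ∈ S.spacePi, inner ℝ (S.jumpMap u) π = 0 := by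
  simp_rw [S.inner_jumpMap]
  exact ⟨fun h π hπ => S.Ch_eq_zero h hπ, fun h => S.mem_X2_of_Ch u.2 h⟩

/-- The operator is multiplication by k. The relation ψ = -kη, read in both directions on the spans,
shows that it maps X₁ onto the velocities; the minus sign is harmless since the spaces are linear.
-/
lemma isHybridSystem (S : Setting Ω cell k U) (hN : 1 ≤ N) : ∃ T : L2v Ω →L[ℝ] L2v Ω,
    (∀ ζ : L2v Ω, T ζ =ᵐ[volume.restrict Ω] app k ζ) ∧
    IsHybridSystem S.spaceX1 S.spaceX2 S.spaceQ S.spacePi T S.divMap S.jumpMap := by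
  have hΩm := (isOpen_of_interior_closure S.domain).measurableSet
  obtain ⟨T, α, hα, hT, hc⟩ := S.coeff.exists_operator le_rfl hΩm
  have hTK := fun (ζ : L2v Ω) => (ae_domain_iff S.domain S.mesh).1 (hT ζ)
  refine ⟨T, hT, ⟨α, hα, hc⟩, S.finiteDimensional_spaceX2, ?_, ?_, ?_, ?_, ?_⟩
  · intro θ hθ
    rw [← neg_mem_iff]
    intro K
    obtain ⟨s, hs, hθs⟩ := hθ K
    obtain ⟨t, ht, hts⟩ := exists_psiSpan_of_etaSpan S.coeff (S.mesh.dom_subset S.domain K) hs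
    refine ⟨t, ht, ?_⟩
    filter_upwards [(ae_domain_iff S.domain S.mesh).1 (Lp.coeFn_neg (T θ)) K, hTK θ K,
      app_congr (k := k) hθs, hts] with x e1 e2 e3 e4
    rw [e1, e4, Pi.neg_apply, Pi.neg_apply, e2, e3]
  · intro u hu
    choose t ht hut using hu
    choose s hs hts using fun K =>
      exists_etaSpan_of_psiSpan S.coeff (S.mesh.dom_subset S.domain K) (ht K)
    have hm := memLp_glue S.domain S.mesh fun K => memLp_of_mem_etaSpan (hs K)
    have hmK : ∀ K, hm.toLp =ᵐ[volume.restrict (cell K).dom] s K := fun K =>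
      Filter.EventuallyEq.trans ((ae_domain_iff S.domain S.mesh).1 hm.coeFn_toLp K)
        (glue_ae_eq S.mesh s K)
    refine ⟨-hm.toLp, neg_mem (fun K => ⟨s K, hs K, hmK K⟩), ?_⟩
    rw [map_neg]
    refine Lp.ext ((ae_domain_iff S.domain S.mesh).2 fun K => ?_)
    filter_upwards [(ae_domain_iff S.domain S.mesh).1 (Lp.coeFn_neg (T hm.toLp)) K,
      hTK hm.toLp K, app_congr (k := k) (hmK K), hts K, hut K] with x e1 e2 e3 e4 e5
    rw [e1, Pi.neg_apply, e2, e3, e5, e4, Pi.neg_apply]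
  · intro u
    refine S.mem_spaceQ.2 fun K => ?_
    obtain ⟨a, ha⟩ := S.hasGreen_X2tilde u.2 K
    refine ⟨a, ?_⟩
    filter_upwards [(ae_domain_iff S.domain S.mesh).1 (S.memLp_div u).coeFn_toLp K,
      glue_ae_eq S.mesh (fun K => wdiv (cell K).dom (u : L2v Ω)) K, ha.wdiv_ae_eq]
      with x e1 e2 e3
    rw [← e3, ← e2]
    exact e1
  · intro p hp h
    refine S.Qh_eq_zero hN (S.mem_spaceQ.1 hp) fun τ hτ => ?_
    rw [← S.inner_divMap_Lp ⟨τ, hτ.2⟩]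
    exact h _ ((S.mem_X2_iff ⟨τ, hτ.2⟩).1 hτ)
  · intro π hπ h
    refine S.Pih_eq_zero hπ fun τ hτ => ?_
    rw [← S.inner_jumpMap ⟨τ, hτ⟩]
    exact h _

end Setting

end Spaces

/-! ### The discrete problems -/

namespace Setting

variable {d N : ℕ} {ι : Type*} [Fintype ι] {Ω : Set (E d)} {cell : ι → Cell d}
  {k : E d → Matrix (Fin d) (Fin d) ℝ} {U : Fin N → E d → E d} {f : E d → ℝ}

lemma inner_app {T : L2v Ω →L[ℝ] L2v Ω} (hT : ∀ ζ : L2v Ω, T ζ =ᵐ[volume.restrict Ω] app k ζ)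
    (θ ξ : L2v Ω) : inner ℝ (T θ) ξ = ∫ x in Ω, inner ℝ (app k θ x) (ξ x) := by
  rw [L2.inner_def]
  refine integral_congr_ae ?_
  filter_upwards [hT θ] with x hx
  rw [hx]

lemma inner_toLp_L2 {q : L2 Ω} (hf : MemLp f 2 (volume.restrict Ω)) :
    inner ℝ hf.toLp q = ∫ x in Ω, f x * q x := by
  rw [L2.inner_def]
  refine integral_congr_ae ?_
  filter_upwards [hf.coeFn_toLp] with x hx
  rw [hx]
  exact mul_comm _ _

lemma brokenDiv_eq_integral_mul (S : Setting Ω cell k U) {τ : L2v Ω} (hτ : τ ∈ X2 Ω cell k U)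
    (p : L2 Ω) : ∫ x in Ω, p x * wdiv Ω τ x = brokenDiv cell τ p := by
  simp_rw [mul_comm (p _)]
  exact (S.brokenDiv_eq_integral hτ (Lp.memLp p)).symm

/-- A solution of the hybridized problem gives a solution of the global problem. -/
lemma isSolution_of_hybrid (S : Setting Ω cell k U) {s : L2v Ω × L2v Ω × L2 Ω × L2skel cell}
    (h : IsHybridSolution Ω cell k U f s) :
    IsSolution Ω cell k U f (s.1, s.2.1, s.2.2.1) where
  theta_mem := h.theta_mem
  u_mem := S.mem_X2_of_Ch h.u_mem h.eq4
  p_mem := h.p_mem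
  eq1 := h.eq1
  eq2 τ hτ := by
    rw [S.brokenDiv_eq_integral_mul hτ, h.eq2 τ hτ.2, S.Ch_eq_zero hτ h.lam_mem]
  eq3 q hq := by
    rw [← h.eq3 q hq]
    exact (S.brokenDiv_eq_integral (S.mem_X2_of_Ch h.u_mem h.eq4) (Lp.memLp q)).symm

/-- The difference of two solutions solves the homogeneous constrained problem of
`IsHybridSystem.eq_zero`, with X₂ described by the multipliers. -/
lemma isSolution_unique (S : Setting Ω cell k U) (hN : 1 ≤ N) {t t' : L2v Ω × L2v Ω × L2 Ω}
    (h : IsSolution Ω cell k U f t) (h' : IsSolution Ω cell k U f t') : t = t' := by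
  obtain ⟨T, hT, H⟩ := S.isHybridSystem hN
  let u : S.spaceX2 := ⟨t.2.1, h.u_mem.2⟩
  let u' : S.spaceX2 := ⟨t'.2.1, h'.u_mem.2⟩
  have e1 : ∀ ξ ∈ S.spaceX1, inner ℝ (T (t.1 - t'.1)) ξ + inner ℝ ((u - u' : S.spaceX2) : L2v Ω) ξ
      = 0 := by
    intro ξ hξ
    have a1 := h.eq1 ξ hξ
    have a2 := h'.eq1 ξ hξ
    rw [← inner_app hT, ← L2.inner_def (𝕜 := ℝ)] at a1 a2
    rw [map_sub, inner_sub_left, AddSubgroupClass.coe_sub, inner_sub_left]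
    linarith
  have e2 : ∀ τ : S.spaceX2, (∀ π ∈ S.spacePi, inner ℝ (S.jumpMap τ) π = 0) →
      inner ℝ (t.1 - t'.1) (τ : L2v Ω) + inner ℝ (S.divMap τ) (t.2.2 - t'.2.2) = 0 := by
    intro τ hτ
    have hτ' := (S.mem_X2_iff τ).2 hτ
    have a1 := h.eq2 τ hτ'
    have a2 := h'.eq2 τ hτ'
    rw [S.brokenDiv_eq_integral_mul hτ', ← S.inner_divMap_Lp, ← L2.inner_def (𝕜 := ℝ)] at a1 a2
    rw [inner_sub_left, inner_sub_right]
    linarith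
  have e3 : ∀ q ∈ S.spaceQ, inner ℝ (S.divMap (u - u')) q = 0 := by
    intro q hq
    have a1 := h.eq3 q (S.mem_spaceQ.1 hq)
    have a2 := h'.eq3 q (S.mem_spaceQ.1 hq)
    rw [← S.brokenDiv_eq_integral h.u_mem (Lp.memLp q)] at a1
    rw [← S.brokenDiv_eq_integral h'.u_mem (Lp.memLp q), ← a1] at a2
    rw [map_sub, inner_sub_left, S.inner_divMap_Lp, S.inner_divMap_Lp, sub_eq_zero]
    exact a2.symm
  have e4 : ∀ π ∈ S.spacePi, inner ℝ (S.jumpMap (u - u')) π = 0 := by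
    intro π hπ
    rw [map_sub, inner_sub_left, (S.mem_X2_iff u).1 h.u_mem π hπ,
      (S.mem_X2_iff u').1 h'.u_mem π hπ, sub_zero]
  obtain ⟨b1, b2, b3⟩ := H.eq_zero (sub_mem h.theta_mem h'.theta_mem) e4
    (sub_mem (S.mem_spaceQ.2 h.p_mem) (S.mem_spaceQ.2 h'.p_mem)) e1 e2 e3
  exact Prod.ext (sub_eq_zero.1 b1) (Prod.ext (congrArg Subtype.val (sub_eq_zero.1 b2))
    (sub_eq_zero.1 b3))

/-- The first three components solve the global problem and so coincide; then the second equation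
gives both multipliers the same pairing with every discontinuous velocity. -/
lemma isHybridSolution_unique (S : Setting Ω cell k U) (hN : 1 ≤ N)
    {s s' : L2v Ω × L2v Ω × L2 Ω × L2skel cell}
    (h : IsHybridSolution Ω cell k U f s) (h' : IsHybridSolution Ω cell k U f s') : s = s' := by
  obtain ⟨T, -, H⟩ := S.isHybridSystem hN
  have e := S.isSolution_unique hN (S.isSolution_of_hybrid h) (S.isSolution_of_hybrid h')
  obtain ⟨e1, e2, e3⟩ : s.1 = s'.1 ∧ s.2.1 = s'.2.1 ∧ s.2.2.1 = s'.2.2.1 := by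
    simpa only [Prod.mk.injEq] using e
  refine Prod.ext e1 (Prod.ext e2 (Prod.ext e3 (sub_eq_zero.1 ?_)))
  have hs : s.2.2.2 ∈ S.spacePi := h.lam_mem
  have hs' : s'.2.2.2 ∈ S.spacePi := h'.lam_mem
  refine H.multiplier _ (sub_mem hs hs') fun τ => ?_
  rw [inner_sub_right, S.inner_jumpMap, S.inner_jumpMap, ← h.eq2 τ τ.2, ← h'.eq2 τ τ.2, e1, e3,
    sub_self]

lemma exists_hybridSolution (S : Setting Ω cell k U) (hN : 1 ≤ N)
    (hf : MemLp f 2 (volume.restrict Ω)) : ∃ s, IsHybridSolution Ω cell k U f s := by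
  obtain ⟨T, hT, H⟩ := S.isHybridSystem hN
  obtain ⟨θ, hθ, u, p, hp, μ, hμ, h1, h2, h3, h4⟩ := H.exists_solution hf.toLp
  refine ⟨(θ, u, p, μ), hθ, u.2, S.mem_spaceQ.1 hp, hμ, fun ξ hξ => ?_, fun τ hτ => ?_,
    fun q hq => ?_, fun π hπ => ?_⟩
  · rw [← inner_app hT, ← L2.inner_def (𝕜 := ℝ)]
    exact h1 ξ hξ
  · rw [← L2.inner_def (𝕜 := ℝ), ← S.inner_divMap_Lp ⟨τ, hτ⟩, ← S.inner_jumpMap ⟨τ, hτ⟩]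
    exact h2 ⟨τ, hτ⟩
  · rw [← inner_toLp_L2 hf, ← S.inner_divMap_Lp u]
    exact h3 q (S.mem_spaceQ.2 hq)
  · rw [← S.inner_jumpMap u]
    exact h4 π hπ

end Setting

end MsFEM

end

theorem theorem4p5 {d : ℕ} (hd : d = 2 ∨ d = 3)
    {ι : Type*} [Fintype ι] {N : ℕ} (hN : 1 ≤ N)
    (Ω : Set (MsFEM.E d)) (hΩ : interior (closure Ω) = Ω)
    (cell : ι → MsFEM.Cell d) (hmesh : MsFEM.IsMesh Ω cell)
    (k : MsFEM.E d → Matrix (Fin d) (Fin d) ℝ) (hk : MsFEM.IsCoefficient Ω k)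
    (U : Fin N → MsFEM.E d → MsFEM.E d) (hU : MsFEM.IsGlobalFields Ω cell U)
    (f : MsFEM.E d → ℝ) (hf : MemLp f 2 (volume.restrict Ω)) :
    (∃! t, MsFEM.IsSolution Ω cell k U f t) ∧
    (∃! s, MsFEM.IsHybridSolution Ω cell k U f s) ∧
    ∀ t s, MsFEM.IsSolution Ω cell k U f t → MsFEM.IsHybridSolution Ω cell k U f s →
      (s.1, s.2.1, s.2.2.1) = t := by
  have S : MsFEM.Setting Ω cell k U := ⟨by omega, hΩ, hmesh, hk, hU⟩
  obtain ⟨s, hs⟩ := S.exists_hybridSolution hN hf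
  -- Existence is proved only for the hybrid problem; its solution also supplies the global one.
  exact ⟨⟨_, S.isSolution_of_hybrid hs, fun t ht =>
      S.isSolution_unique hN ht (S.isSolution_of_hybrid hs)⟩,
    ⟨s, hs, fun s' hs' => S.isHybridSolution_unique hN hs' hs⟩,
    fun t s ht hs => S.isSolution_unique hN (S.isSolution_of_hybrid hs) ht⟩
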